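/- A $3$-uniform hypergraph $H=(V,E)$ consists of a finite vertex set $V$ and a set $E$ of $3$-element subsets of $V$, called edges. The degree of a vertex is the number of edges containing it, and $\delta(H)$ denotes the minimum degree over all vertices. A tight Hamiltonian cycle in $H$ is a cyclic arrangement $x_1,\dots,x_n$ of all $n=|V|\ge 4$ vertices of $H$, each appearing exactly once, such that $\{x_i,x_{i+1},x_{i+2}\}\in E$ for every $i$ (indices modulo $n$). Theorem. (a) For every real $\alpha>0$ there exists an integer $n_0$ such that every $3$-uniform hypergraph $H$ with $n\ge n_0$ vertices and with $$\delta(H)\ge\Bigl(\frac59+\alpha\Bigr)\frac{n^2}{2}$$ contains a tight Hamiltonian cycle. (b) The constant $5/9$ is asymptotically optimal: for every real $\varepsilon>0$ there exists an integer $n_0$ such that for every $n\ge n_0$ there is a $3$-uniform hypergraph $H$ on $n$ vertices with $$\delta(H)\ge\Bigl(\frac59-\varepsilon\Bigr)\frac{n^2}{2}$$ that contains no tight Hamiltonian cycle. -/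

import Mathlib

open scoped Hypergraph

universe u

namespace Hypergraph

/-- A hypergraph is `k`-uniform if every edge has exactly `k` vertices. -/
def IsUniform {V : Type u} (H : Hypergraph V) (k : ℕ) : Prop :=
  ∀ e ∈ E(H), e.Finite ∧ e.ncard = k

/-- The degree of a vertex: the number of edges containing it. -/
noncomputable def degree {V : Type u} (H : Hypergraph V) (v : V) : ℕ :=
  {e ∈ E(H) | v ∈ e}.ncard

/-- The minimum vertex degree, i.e. the minimum of the degrees over all vertices of `H`. -/
noncomputable def minDegree {V : Type u} (H : Hypergraph V) : ℕ :=
  sInf (H.degree '' V(H))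

/-- `C` is a (not necessarily induced) subhypergraph of `H`. -/
def IsSubhypergraph {V : Type u} (C H : Hypergraph V) : Prop :=
  V(C) ⊆ V(H) ∧ E(C) ⊆ E(H)

/-- `C` is a tight cycle of length `l ≥ 4`: its vertices can be arranged cyclically, without
repetition, as `x 0, …, x (l - 1)`, so that its edges are exactly the triples of cyclically
consecutive vertices. -/
def IsTightCycle {V : Type u} (C : Hypergraph V) (l : ℕ) : Prop :=
  4 ≤ l ∧ ∃ x : ZMod l → V, Function.Injective x ∧ V(C) = Set.range x ∧
    E(C) = Set.range fun i : ZMod l => ({x i, x (i + 1), x (i + 2)} : Set V)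

/-- `H` contains a tight Hamiltonian cycle: a tight cycle through all vertices of `H`. -/
def HasTightHamiltonianCycle {V : Type u} (H : Hypergraph V) : Prop :=
  ∃ (C : Hypergraph V) (l : ℕ), C.IsTightCycle l ∧ C.IsSubhypergraph H ∧ V(C) = V(H)

end Hypergraph

universe v

namespace TightHam

open Finset Classical

/-! ### Counting with real values: averaging and double counting. -/

section Counting

variable {ι κ : Type*} [Fintype ι] [Fintype κ]

/-- The number of elements satisfying `p`, as a real number. -/
noncomputable def cnt {ι : Type*} [Fintype ι] (p : ι → Prop) : ℝ :=
  ((univ.filter p).card : ℝ)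

lemma cnt_nonneg (p : ι → Prop) : 0 ≤ cnt p := Nat.cast_nonneg _

lemma cnt_eq_sum (p : ι → Prop) : cnt p = ∑ x, if p x then (1 : ℝ) else 0 := by
  simp [cnt]

lemma cnt_mono {p q : ι → Prop} (h : ∀ x, p x → q x) : cnt p ≤ cnt q := by
  unfold cnt
  exact_mod_cast card_le_card (fun x hx => by
    simp only [mem_filter, mem_univ, true_and] at *; exact h x hx)

lemma cnt_congr {p q : ι → Prop} (h : ∀ x, p x ↔ q x) : cnt p = cnt q :=
  le_antisymm (cnt_mono fun x => (h x).1) (cnt_mono fun x => (h x).2)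

lemma cnt_le_card (p : ι → Prop) : cnt p ≤ Fintype.card ι := by
  unfold cnt
  exact_mod_cast card_le_univ _

lemma cnt_true : cnt (fun _ : ι => True) = Fintype.card ι := by simp [cnt]

lemma cnt_false : cnt (fun _ : ι => False) = 0 := by simp [cnt]

lemma cnt_mem (s : Finset ι) : cnt (fun x => x ∈ s) = s.card := by simp [cnt]

lemma cnt_prod (p : ι → κ → Prop) :
    cnt (fun z : ι × κ => p z.1 z.2) = ∑ a, cnt (p a) := by
  simp only [cnt_eq_sum]
  rw [Fintype.sum_prod_type]

lemma sum_cnt_comm (p : ι → κ → Prop) :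
    ∑ a, cnt (p a) = ∑ b, cnt (fun a => p a b) := by
  simp only [cnt_eq_sum]
  exact sum_comm

lemma cnt_or_le (p q : ι → Prop) : cnt (fun x => p x ∨ q x) ≤ cnt p + cnt q := by
  unfold cnt
  refine le_trans (Nat.cast_le.2 (card_le_card (t := univ.filter p ∪ univ.filter q)
    fun x hx => ?_)) (by exact_mod_cast card_union_le _ _)
  simpa using hx

lemma cnt_split (p q : ι → Prop) :
    cnt p = cnt (fun x => p x ∧ q x) + cnt (fun x => p x ∧ ¬ q x) := by
  unfold cnt
  rw [← card_filter_add_card_filter_not (s := univ.filter p) q, filter_filter, filter_filter]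
  push_cast
  congr!

lemma cnt_sub_le (p q : ι → Prop) : cnt p - cnt q ≤ cnt (fun x => p x ∧ ¬ q x) := by
  have h := cnt_split p q
  have : cnt (fun x => p x ∧ q x) ≤ cnt q := cnt_mono fun x h => h.2
  linarith

lemma cnt_le_of_injOn {p : ι → Prop} {q : κ → Prop} (f : ι → κ)
    (h : ∀ x, p x → q (f x)) (hf : ∀ x y, p x → p y → f x = f y → x = y) : cnt p ≤ cnt q := by
  unfold cnt
  exact_mod_cast card_le_card_of_injOn f (fun x hx => by
    simp only [coe_filter, mem_univ, true_and, Set.mem_ofPred_eq] at *; exact h x hx)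
    (fun x hx y hy hxy => by
      simp only [coe_filter, mem_univ, true_and, Set.mem_ofPred_eq] at hx hy
      exact hf x y hx hy hxy)

lemma cnt_equiv (e : ι ≃ κ) (q : κ → Prop) : cnt (fun x => q (e x)) = cnt q :=
  le_antisymm (cnt_le_of_injOn e (fun _ h => h) fun _ _ _ _ h => e.injective h)
    (cnt_le_of_injOn e.symm (fun x h => by simpa using h) fun _ _ _ _ h => e.symm.injective h)

lemma cnt_and_prod (p : ι → Prop) (q : κ → Prop) :
    cnt (fun z : ι × κ => p z.1 ∧ q z.2) = cnt p * cnt q := by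
  rw [cnt_prod (fun a b => p a ∧ q b), cnt_eq_sum p, sum_mul]
  refine sum_congr rfl fun a _ => ?_
  by_cases h : p a <;> simp [h, cnt]

/-- Averaging: a bounded function with large sum is large at many points. -/
lemma sum_le_cnt (f : ι → ℝ) {M c : ℝ} (hc : 0 ≤ c) (hM : ∀ x, f x ≤ M) :
    ∑ x, f x ≤ M * cnt (fun x => c ≤ f x) + c * Fintype.card ι := by
  have h : ∀ x, f x ≤ M * (if c ≤ f x then 1 else 0) + c := by
    intro x
    split_ifs with h
    · linarith [hM x]
    · push Not at h; linarith
  calc ∑ x, f x ≤ ∑ x, (M * (if c ≤ f x then 1 else 0) + c) := sum_le_sum fun x _ => h x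
    _ = _ := by
      rw [sum_add_distrib, ← mul_sum, ← cnt_eq_sum, sum_const, card_univ, nsmul_eq_mul]; ring

lemma mul_cnt_le_sum (f : ι → ℝ) {c : ℝ} {p : ι → Prop} (h0 : ∀ x, 0 ≤ f x)
    (h : ∀ x, p x → c ≤ f x) : c * cnt p ≤ ∑ x, f x := by
  rw [cnt_eq_sum, mul_sum]
  refine sum_le_sum fun x _ => ?_
  split_ifs with hx
  · simpa using h x hx
  · simpa using h0 x

lemma exists_of_cnt_lt {p q : ι → Prop} (h : cnt q < cnt p) : ∃ x, p x ∧ ¬ q x := by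
  by_contra! hcon
  exact absurd (cnt_mono hcon) (not_le.2 h)

lemma exists_of_cnt_pos {p : ι → Prop} (h : 0 < cnt p) : ∃ x, p x := by
  by_contra! hcon
  have : cnt p = 0 := by simp [cnt, hcon]
  linarith

lemma cnt_exists_le {σ : Type*} [Fintype σ] (p : σ → ι → Prop) :
    cnt (fun x => ∃ s, p s x) ≤ ∑ s, cnt (p s) := by
  rw [sum_cnt_comm, cnt_eq_sum]
  refine sum_le_sum fun x _ => ?_
  split_ifs with h
  · obtain ⟨s, hs⟩ := h
    have : (1 : ℝ) ≤ cnt (fun s => p s x) := by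
      unfold cnt
      exact_mod_cast card_pos.2 ⟨s, by simp [hs]⟩
    exact this
  · exact cnt_nonneg _

lemma cnt_fiber_le {p : ι → Prop} {q : κ → Prop} (f : ι → κ) {C : ℝ}
    (h : ∀ x, p x → q (f x)) (hC : ∀ y, cnt (fun x => f x = y) ≤ C) :
    cnt p ≤ C * cnt q := by
  have h1 : cnt p ≤ ∑ y, cnt (fun x => q y ∧ f x = y) := by
    rw [sum_cnt_comm, cnt_eq_sum]
    refine sum_le_sum fun x _ => ?_
    split_ifs with hx
    · unfold cnt
      exact_mod_cast card_pos.2 ⟨f x, by simp [h x hx]⟩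
    · exact cnt_nonneg _
  refine h1.trans ?_
  rw [cnt_eq_sum q, mul_sum]
  refine sum_le_sum fun y _ => ?_
  by_cases hy : q y
  · simpa [hy] using hC y
  · simp [hy, cnt]

end Counting

/-! ### Counting lists of vertices of a given length. -/

section Lists

variable {V : Type u}

/-- The lists of length `k` with all entries in `S`. -/
noncomputable def listsIn (S : Finset V) : ℕ → Finset (List V)
  | 0 => {[]}
  | k + 1 => (S ×ˢ listsIn S k).image fun p => p.1 :: p.2

lemma mem_listsIn {S : Finset V} {k : ℕ} {l : List V} :
    l ∈ listsIn S k ↔ l.length = k ∧ ∀ v ∈ l, v ∈ S := by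
  induction k generalizing l with
  | zero => simp only [listsIn, mem_singleton, List.length_eq_zero_iff]; aesop
  | succ k ih =>
    simp only [listsIn, mem_image, mem_product, Prod.exists]
    constructor
    · rintro ⟨a, m, ⟨ha, hm⟩, rfl⟩
      rw [ih] at hm
      simpa [hm.1, ha] using hm.2
    · rintro ⟨h1, h2⟩
      match l, h1, h2 with
      | a :: m, h1, h2 =>
        exact ⟨a, m, ⟨h2 a (by simp), ih.2 ⟨by simpa using h1, fun v hv => h2 v (by simp [hv])⟩⟩, rfl⟩

lemma card_listsIn (S : Finset V) (k : ℕ) : (listsIn S k).card = S.card ^ k := by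
  induction k with
  | zero => simp [listsIn]
  | succ k ih =>
    rw [listsIn, card_image_of_injective, card_product, ih, pow_succ']
    rintro ⟨a, l⟩ ⟨b, m⟩ h
    simpa using h

variable [Fintype V]

/-- The number of lists of length `k` satisfying `p`. -/
noncomputable def lcnt (k : ℕ) (p : List V → Prop) : ℝ :=
  (((listsIn (univ : Finset V) k).filter p).card : ℝ)

lemma lcnt_nonneg (k : ℕ) (p : List V → Prop) : 0 ≤ lcnt k p := Nat.cast_nonneg _

lemma mem_lists_univ {k : ℕ} {l : List V} : l ∈ listsIn (univ : Finset V) k ↔ l.length = k := by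
  simp [mem_listsIn]

lemma lcnt_mono {k : ℕ} {p q : List V → Prop} (h : ∀ l, l.length = k → p l → q l) :
    lcnt k p ≤ lcnt k q := by
  unfold lcnt
  exact_mod_cast card_le_card (fun l hl => by
    simp only [mem_filter, mem_lists_univ] at *; exact ⟨hl.1, h l hl.1 hl.2⟩)

lemma lcnt_le (k : ℕ) (p : List V → Prop) : lcnt k p ≤ (Fintype.card V : ℝ) ^ k := by
  unfold lcnt
  have := card_filter_le (listsIn (univ : Finset V) k) p
  rw [card_listsIn, card_univ] at this
  exact_mod_cast this

lemma lcnt_zero (p : List V → Prop) : lcnt 0 p = if p [] then 1 else 0 := by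
  unfold lcnt
  simp only [listsIn, filter_singleton]
  split_ifs <;> simp

lemma lcnt_succ (k : ℕ) (p : List V → Prop) :
    lcnt (k + 1) p = ∑ a, lcnt k (fun l => p (a :: l)) := by
  unfold lcnt
  rw [← Nat.cast_sum, ← card_sigma]
  congr 1
  symm
  refine card_bij (fun x _ => x.1 :: x.2) ?_ ?_ ?_
  · rintro ⟨a, l⟩ h
    simp only [mem_sigma, mem_univ, mem_filter, mem_lists_univ, true_and] at h
    simp [mem_filter, mem_lists_univ, h]
  · rintro ⟨a, l⟩ _ ⟨b, m⟩ _ h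
    simpa using h
  · intro l hl
    simp only [mem_filter, mem_lists_univ] at hl
    match l, hl with
    | a :: l, hl => exact ⟨⟨a, l⟩, by simpa [mem_lists_univ] using hl, rfl⟩

lemma lcnt_split (k : ℕ) (p q : List V → Prop) :
    lcnt k p = lcnt k (fun x => p x ∧ q x) + lcnt k (fun x => p x ∧ ¬ q x) := by
  unfold lcnt
  rw [← card_filter_add_card_filter_not (s := (listsIn univ k).filter p) q, filter_filter,
    filter_filter]
  push_cast
  congr!

lemma lcnt_sub_le (k : ℕ) (p q : List V → Prop) :
    lcnt k p - lcnt k q ≤ lcnt k (fun x => p x ∧ ¬ q x) := by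
  have h := lcnt_split k p q
  have : lcnt k (fun x => p x ∧ q x) ≤ lcnt k q := lcnt_mono fun x _ h => h.2
  linarith

lemma lcnt_or_le (k : ℕ) (p q : List V → Prop) :
    lcnt k (fun x => p x ∨ q x) ≤ lcnt k p + lcnt k q := by
  unfold lcnt
  refine le_trans (Nat.cast_le.2 (card_le_card (t := (listsIn univ k).filter p ∪
    (listsIn univ k).filter q) fun x hx => ?_)) (by exact_mod_cast card_union_le _ _)
  simp only [mem_filter, mem_union] at *
  tauto

/-- Few lists meet a small set. -/
lemma lcnt_meet_le (k : ℕ) (S : Finset V) :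
    lcnt k (fun l => ∃ v ∈ l, v ∈ S) ≤ k * S.card * (Fintype.card V : ℝ) ^ (k - 1) := by
  induction k with
  | zero => simp [lcnt_zero]
  | succ k ih =>
    rw [lcnt_succ]
    have h : ∀ a : V, lcnt k (fun l => ∃ v ∈ a :: l, v ∈ S) ≤
        (if a ∈ S then (Fintype.card V : ℝ) ^ k else 0) +
          k * S.card * (Fintype.card V : ℝ) ^ (k - 1) := by
      intro a
      split_ifs with ha
      · refine (lcnt_le _ _).trans ?_
        have : 0 ≤ k * S.card * (Fintype.card V : ℝ) ^ (k - 1) := by positivity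
        linarith
      · refine le_trans (lcnt_mono fun l _ => ?_) (ih.trans (by simp))
        rintro ⟨v, hv, hS⟩
        rcases List.mem_cons.1 hv with rfl | hv
        · exact absurd hS ha
        · exact ⟨v, hv, hS⟩
    refine (sum_le_sum fun a _ => h a).trans ?_
    rw [sum_add_distrib, sum_ite_mem, univ_inter, sum_const, sum_const, card_univ]
    simp only [nsmul_eq_mul, add_tsub_cancel_right]
    push_cast
    rcases k with _ | k
    · simp
    · simp only [add_tsub_cancel_right]
      apply le_of_eq
      push_cast
      ring

/-- Few lists have a repeated entry. -/
lemma lcnt_not_nodup_le (k : ℕ) :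
    lcnt k (fun l : List V => ¬ l.Nodup) ≤ k ^ 2 * (Fintype.card V : ℝ) ^ (k - 1) := by
  induction k with
  | zero => simp [lcnt_zero]
  | succ k ih =>
    rw [lcnt_succ]
    have h : ∀ a : V, lcnt k (fun l => ¬ (a :: l).Nodup) ≤
        k * (Fintype.card V : ℝ) ^ (k - 1) + k ^ 2 * (Fintype.card V : ℝ) ^ (k - 1) := by
      intro a
      refine le_trans (lcnt_mono (q := fun l => (∃ v ∈ l, v ∈ ({a} : Finset V)) ∨ ¬ l.Nodup)
        fun l _ h => ?_) ((lcnt_or_le _ _ _).trans (add_le_add ?_ ih))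
      · rw [List.nodup_cons] at h
        simp only [mem_singleton, exists_eq_right]
        tauto
      · simpa using lcnt_meet_le k ({a} : Finset V)
    refine (sum_le_sum fun a _ => h a).trans ?_
    rw [sum_const, card_univ, nsmul_eq_mul]
    simp only [add_tsub_cancel_right]
    rcases k with _ | k
    · simp
    · simp only [add_tsub_cancel_right]
      push_cast
      have : (0 : ℝ) ≤ (Fintype.card V : ℝ) ^ (k + 1) := by positivity
      have e : (Fintype.card V : ℝ) * (((k : ℝ) + 1) * (Fintype.card V : ℝ) ^ k +
        ((k : ℝ) + 1) ^ 2 * (Fintype.card V : ℝ) ^ k) =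
          (((k : ℝ) + 1) + (k + 1) ^ 2) * (Fintype.card V : ℝ) ^ (k + 1) := by ring
      rw [e]
      refine mul_le_mul_of_nonneg_right ?_ this
      have : (0 : ℝ) ≤ k := Nat.cast_nonneg _
      nlinarith

end Lists

/-- A 3-uniform hypergraph on `V`, as a symmetric relation on triples of distinct vertices. -/
structure TripleSystem (V : Type u) where
  /-- the edges -/
  adj : V → V → V → Prop
  swap12 : ∀ {a b c}, adj a b c → adj b a c
  swap23 : ∀ {a b c}, adj a b c → adj a c b
  ne : ∀ {a b c}, adj a b c → a ≠ b

/-! ### Tight paths as lists, and how they are glued. -/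

namespace TripleSystem

variable {V : Type u} (T : TripleSystem V)

lemma rot {T : TripleSystem V} {a b c : V} (h : T.adj a b c) : T.adj b c a := T.swap23 (T.swap12 h)

lemma rot' {T : TripleSystem V} {a b c : V} (h : T.adj a b c) : T.adj c a b := T.swap12 (T.swap23 h)

lemma rev {T : TripleSystem V} {a b c : V} (h : T.adj a b c) : T.adj c b a :=
  T.swap12 (T.swap23 (T.swap12 h))

/-- Any three consecutive entries of the list form an edge. -/
def Tight : List V → Prop
  | a :: b :: c :: l => T.adj a b c ∧ Tight (b :: c :: l)
  | _ => True

variable {T}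

@[simp] lemma tight_cons3 {a b c : V} {l : List V} :
    T.Tight (a :: b :: c :: l) ↔ T.adj a b c ∧ T.Tight (b :: c :: l) := by
  rw [Tight]

@[simp] lemma tight_pair {a b : V} : T.Tight [a, b] := by simp [Tight]

/-- Every triple of consecutive entries lies on one side of the cut once the two entries c, d are
shared, so tight lists glue along common pairs. -/
lemma tight_overlap (l : List V) (c d : V) (m : List V) :
    T.Tight (l ++ c :: d :: m) ↔ T.Tight (l ++ [c, d]) ∧ T.Tight (c :: d :: m) := by
  induction l with
  | nil => simp
  | cons a l ih =>
    match l, ih with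
    | [], ih => simp
    | [b], ih =>
      simp only [List.cons_append, List.nil_append, tight_cons3, tight_pair, and_true] at *
      tauto
    | b :: b' :: l, ih =>
      simp only [List.cons_append, tight_cons3] at *
      tauto

lemma Tight.tail {a : V} {m : List V} (h : T.Tight (a :: m)) : T.Tight m := by
  match m, h with
  | [], h => simp [Tight]
  | [b], h => simp [Tight]
  | b :: c :: m, h => exact h.2

lemma Tight.get {l : List V} (h : T.Tight l) (i : ℕ) (hi : i + 2 < l.length) :
    T.adj (l[i]'(by omega)) (l[i + 1]'(by omega)) (l[i + 2]) := by
  induction l generalizing i with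
  | nil => simp at hi
  | cons a l ih =>
    rcases i with _ | i
    · match l, h, hi with
      | b :: c :: l, h, hi => exact h.1
    · exact ih h.tail i (by simp only [List.length_cons] at hi; omega)

/-- The list starts with `a, b` and ends with `c, d`, without overlap. -/
def HasEnds (l : List V) (a b c d : V) : Prop := ∃ m, l = a :: b :: (m ++ [c, d])

/-- The middle condition sees only the end pairs, so each outer list may be exchanged for any tight
list with the same ends. This exchange is the mechanism of absorption. -/
lemma tight_join {l l' t : List V} {a b c d a' b' c' d' : V} (h : HasEnds l a b c d)
    (h' : HasEnds l' a' b' c' d') :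
    T.Tight (l ++ t ++ l') ↔ T.Tight l ∧ T.Tight ([c, d] ++ t ++ [a', b']) ∧ T.Tight l' := by
  obtain ⟨m, rfl⟩ := h
  obtain ⟨m', rfl⟩ := h'
  have e : a :: b :: (m ++ [c, d]) ++ t ++ a' :: b' :: (m' ++ [c', d']) =
    (a :: b :: m) ++ c :: d :: (t ++ a' :: b' :: (m' ++ [c', d'])) := by simp
  rw [e, tight_overlap (a :: b :: m) c d]
  have e2 : c :: d :: (t ++ a' :: b' :: (m' ++ [c', d'])) =
    (c :: d :: t) ++ a' :: b' :: (m' ++ [c', d']) := by simp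
  rw [e2, tight_overlap (c :: d :: t) a' b']
  simp only [List.cons_append, List.nil_append]

lemma HasEnds.join {l l' : List V} {a b c d a' b' c' d' : V} (h : HasEnds l a b c d) (t : List V)
    (h' : HasEnds l' a' b' c' d') : HasEnds (l ++ t ++ l') a b c' d' := by
  obtain ⟨m, rfl⟩ := h
  obtain ⟨m', rfl⟩ := h'
  exact ⟨m ++ [c, d] ++ t ++ a' :: b' :: m', by simp⟩

end TripleSystem

/-! ### Dense graphs: robust parts and counts of walks. -/

section Graphs

variable {V : Type u}

/-- The indicator of a proposition. -/
noncomputable def ind (p : Prop) : ℝ := if p then 1 else 0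

lemma ind_nonneg (p : Prop) : 0 ≤ ind p := by unfold ind; split_ifs <;> norm_num

lemma ind_le_one (p : Prop) : ind p ≤ 1 := by unfold ind; split_ifs <;> norm_num

lemma ind_of {p : Prop} (h : p) : ind p = 1 := by simp [ind, h]

/-- The number of pairs in `A ×ˢ B` related by `L`. -/
noncomputable def ec (L : V → V → Prop) (A B : Finset V) : ℝ := ∑ a ∈ A, ∑ b ∈ B, ind (L a b)

variable {L : V → V → Prop}

lemma ec_nonneg (A B : Finset V) : 0 ≤ ec L A B :=
  sum_nonneg fun _ _ => sum_nonneg fun _ _ => ind_nonneg _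

lemma ec_comm (hL : ∀ a b, L a b → L b a) (A B : Finset V) : ec L A B = ec L B A := by
  unfold ec
  rw [sum_comm]
  refine sum_congr rfl fun a _ => sum_congr rfl fun b _ => ?_
  rw [show L b a ↔ L a b from ⟨hL _ _, hL _ _⟩]

lemma ec_le (A B : Finset V) : ec L A B ≤ A.card * B.card := by
  unfold ec
  refine (sum_le_sum fun a _ => sum_le_sum fun b _ => ind_le_one _).trans ?_
  simp

lemma ec_union_left {A B : Finset V} (h : Disjoint A B) (D : Finset V) :
    ec L (A ∪ B) D = ec L A D + ec L B D := sum_union h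

lemma ec_union_right {A B : Finset V} (h : Disjoint A B) (D : Finset V) :
    ec L D (A ∪ B) = ec L D A + ec L D B := by
  unfold ec
  rw [← sum_add_distrib]
  exact sum_congr rfl fun _ _ => sum_union h

lemma ec_mono {A B A' B' : Finset V} (h : A ⊆ A') (h' : B ⊆ B') : ec L A B ≤ ec L A' B' := by
  unfold ec
  refine (sum_le_sum fun a _ => sum_le_sum_of_subset_of_nonneg h' fun _ _ _ => ind_nonneg _).trans
    (sum_le_sum_of_subset_of_nonneg h fun _ _ _ => sum_nonneg fun _ _ => ind_nonneg _)

variable [Fintype V]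

lemma ec_univ_le (hL : ∀ a b, L a b → L b a) (Y : Finset V) :
    ec L univ univ = ec L Y Y + 2 * ec L Y Yᶜ + ec L Yᶜ Yᶜ := by
  have h : (univ : Finset V) = Y ∪ Yᶜ := by simp
  rw [h, ec_union_left disjoint_compl_right, ec_union_right disjoint_compl_right,
    ec_union_right disjoint_compl_right, ec_comm hL Yᶜ Y]
  ring

lemma card_compl_real (Y : Finset V) : ((Yᶜ).card : ℝ) = Fintype.card V - Y.card := by
  rw [card_compl, Nat.cast_sub (card_le_univ _)]

/-- `Y` spans a robustly connected part of the graph `L`, with few edges leaving `Y`. -/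
structure RobustPart (L : V → V → Prop) (μ : ℝ) (Y : Finset V) : Prop where
  card : 2 / 3 * (Fintype.card V : ℝ) ≤ Y.card
  cross : ec L Y Yᶜ ≤ μ * (Fintype.card V : ℝ) ^ 2
  cut : ∀ A ⊆ Y, μ * Fintype.card V * A.card ≤ ec L A (Y \ A) ∨
    μ * Fintype.card V * (Y \ A).card ≤ ec L A (Y \ A)

lemma sq_sum_le_half {a b c n : ℝ} (ha : 0 ≤ a) (hb : 0 ≤ b) (hc : 0 ≤ c) (h : a + b + c = n)
    (ha' : a ≤ n / 2) (hb' : b ≤ n / 2) (hc' : c ≤ n / 2) : a ^ 2 + b ^ 2 + c ^ 2 ≤ n ^ 2 / 2 := by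
  nlinarith

/-- Let Y minimise the boundary ec(Y, Yᶜ) plus the penalty μn|Y| among sets with at least n/2
vertices. Comparison with the whole vertex set bounds the boundary. If |Y| < 2n/3, then Y and its
complement together carry density at most 5/9, which contradicts the hypothesis. For a cut of Y, a
side with at least n/2 vertices competes with Y in the minimisation, and this gives the cut bound.
If both sides are smaller, all three parts have at most n/2 vertices, so they carry density at most
1/2, and the excess over 1/2 must cross the cut. -/
lemma exists_robustPart [Nonempty V] (hL : ∀ a b, L a b → L b a) {α μ : ℝ} (hμ : 0 < μ)
    (hμ' : μ ≤ 1 / 100) (hα : 2 * μ ≤ α)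
    (hd : (5 / 9 + α) * (Fintype.card V : ℝ) ^ 2 ≤ ec L univ univ) :
    ∃ Y, RobustPart L μ Y := by
  set n : ℝ := (Fintype.card V : ℝ) with hn
  have hn0 : 0 < n := by rw [hn]; exact_mod_cast Fintype.card_pos
  obtain ⟨Y, hY, hmin⟩ := exists_min_image
    ((univ : Finset (Finset V)).filter fun Y => n ≤ 2 * (Y.card : ℝ))
    (fun Y => ec L Y Yᶜ + μ * n * Y.card) ⟨univ, by simp [hn]; linarith⟩
  simp only [mem_filter, mem_univ, true_and] at hY hmin
  have hcross : ec L Y Yᶜ ≤ μ * n ^ 2 := by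
    have := hmin univ (by rw [card_univ]; linarith)
    have h0 : ec L (univ : Finset V) univᶜ = 0 := by simp [ec]
    rw [h0, card_univ, ← hn] at this
    have : 0 ≤ μ * n * Y.card := by positivity
    nlinarith
  have htot := ec_univ_le hL Y
  have h1 := ec_le (L := L) Y Y
  have h2 := ec_le (L := L) Yᶜ Yᶜ
  have hYn : (Y.card : ℝ) ≤ n := by rw [hn]; exact_mod_cast card_le_univ Y
  rw [card_compl_real, ← hn] at h2
  set y : ℝ := (Y.card : ℝ) with hy
  have hcard : 2 / 3 * n ≤ y := by
    by_contra! hlt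
    have : y ^ 2 + (n - y) ^ 2 ≤ 5 / 9 * n ^ 2 := by nlinarith
    have : 0 < μ * n ^ 2 := by positivity
    have : 2 * μ * n ^ 2 ≤ α * n ^ 2 := by gcongr
    nlinarith
  have key : ∀ A ⊆ Y, n ≤ 2 * (A.card : ℝ) → μ * n * (Y \ A).card ≤ ec L A (Y \ A) := by
    intro A hA hAn
    have h3 := hmin A hAn
    have h4 : Aᶜ = (Y \ A) ∪ Yᶜ := by
      ext v; simp only [mem_compl, mem_union, mem_sdiff]; have := @hA v; tauto
    have h5 : Disjoint (Y \ A) Yᶜ :=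
      disjoint_left.2 fun v hv hv' => (mem_compl.1 hv') (mem_sdiff.1 hv).1
    rw [h4, ec_union_right h5] at h3
    have h6 : ec L A Yᶜ ≤ ec L Y Yᶜ := ec_mono hA subset_rfl
    have h7 : ((Y \ A).card : ℝ) = y - A.card := by
      rw [card_sdiff_of_subset hA, Nat.cast_sub (card_le_card hA)]
    rw [h7]
    nlinarith
  refine ⟨Y, hcard, hcross, fun A hA => ?_⟩
  by_cases hA1 : n ≤ 2 * (A.card : ℝ)
  · exact Or.inr (key A hA hA1)
  by_cases hA2 : n ≤ 2 * ((Y \ A).card : ℝ)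
  · have := key (Y \ A) sdiff_subset hA2
    rw [Finset.sdiff_sdiff_eq_self hA, ec_comm hL] at this
    exact Or.inl this
  push Not at hA1 hA2
  left
  have h7 : ((Y \ A).card : ℝ) = y - A.card := by
    rw [card_sdiff_of_subset hA, Nat.cast_sub (card_le_card hA)]
  have h8 : ec L Y Y = ec L A A + 2 * ec L A (Y \ A) + ec L (Y \ A) (Y \ A) := by
    conv_lhs => rw [← union_sdiff_of_subset hA]
    rw [ec_union_left disjoint_sdiff, ec_union_right disjoint_sdiff, ec_union_right disjoint_sdiff,
      ec_comm hL (Y \ A) A]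
    ring
  have h9 := ec_le (L := L) A A
  have h10 := ec_le (L := L) (Y \ A) (Y \ A)
  rw [h7] at h10 hA2
  have hA0 : (0 : ℝ) ≤ A.card := Nat.cast_nonneg _
  have hA3 : (A.card : ℝ) ≤ y := Nat.cast_le.2 (card_le_card hA)
  have h11 := sq_sum_le_half (a := A.card) (b := y - A.card) (c := n - y) (n := n)
    hA0 (by linarith) (by linarith) (by ring) (by linarith) (by linarith) (by linarith)
  have h12 : μ * n * A.card ≤ μ * n * (n / 2) := by gcongr; linarith
  nlinarith [sq_nonneg n, mul_pos hn0 hn0]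

lemma RobustPart.deg {μ : ℝ} {Y : Finset V} (h : RobustPart L μ Y) (hμ : 0 < μ)
    (hn : 2 ≤ Fintype.card V)
    {y : V} (hy : y ∈ Y) : μ * Fintype.card V ≤ ∑ z ∈ Y, ind (L y z) := by
  have h1 := h.cut {y} (by simpa using hy)
  have e : ec L {y} (Y \ {y}) ≤ ∑ z ∈ Y, ind (L y z) := by
    simp only [ec, sum_singleton]
    exact sum_le_sum_of_subset_of_nonneg sdiff_subset fun _ _ _ => ind_nonneg _
  have hc := h.card
  have hn' : (2 : ℝ) ≤ Fintype.card V := by exact_mod_cast hn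
  have hp : 0 < μ * Fintype.card V := by positivity
  rcases h1 with h1 | h1
  · simp only [card_singleton, Nat.cast_one, mul_one] at h1
    linarith
  · have h2 : (1 : ℝ) ≤ (Y \ {y}).card := by
      have : 1 < Y.card := by
        have : (1 : ℝ) < Y.card := by linarith
        exact_mod_cast this
      rw [card_sdiff_of_subset (by simpa using hy), card_singleton]
      exact_mod_cast (by omega)
    nlinarith

/-- If Y consisted of two almost independent sets and a negligible rest, the density of the graph
would be about y²/2 + (n - y)² ≤ n²/2, below 5/9. Here s, s', x are the sizes of the two sets and
the rest. -/
lemma split_part_absurd {s s' x y n μ δ α t : ℝ} (hn0 : 0 < n) (hμ' : μ ≤ 1 / 100)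
    (hδ : 0 < δ) (hδ' : δ ≤ 1 / 1000) (hα : 0 < α) (s0 : 0 ≤ s) (s1 : 0 ≤ s') (x0 : 0 ≤ x)
    (d1 : y = s + s' + x) (hXc : x ≤ 2 * δ * n) (hYn : y ≤ n) (hc : 2 / 3 * n ≤ y)
    (hd : (5 / 9 + α) * n ^ 2 ≤ t)
    (ht : t ≤ μ * δ * n ^ 2 + 2 * (s * s') + 2 * ((s + s') * x) + x * x + 2 * (μ * n ^ 2) +
      (n - y) * (n - y)) : False := by
  have f1 : (s + s') * x ≤ n * (2 * δ * n) := mul_le_mul (by linarith) hXc x0 hn0.le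
  have f2 : x * x ≤ n * (2 * δ * n) := mul_le_mul (by linarith) hXc x0 hn0.le
  have f3 : 2 * (s * s') ≤ y ^ 2 / 2 := by
    have : (s + s') ^ 2 ≤ y ^ 2 := pow_le_pow_left₀ (by linarith) (by linarith) 2
    linarith [sq_nonneg (s - s')]
  have f4 : y ^ 2 / 2 + (n - y) * (n - y) ≤ n ^ 2 / 2 := by
    linarith [mul_nonneg (by linarith : (0 : ℝ) ≤ y - n / 3) (sub_nonneg.2 hYn)]
  have n2 : 0 < n ^ 2 := by positivity
  have g0 : μ * δ ≤ 1 / 1000 := by nlinarith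
  have g1 : μ * δ * n ^ 2 ≤ 1 / 1000 * n ^ 2 := mul_le_mul_of_nonneg_right g0 n2.le
  have g2 : δ * n ^ 2 ≤ 1 / 1000 * n ^ 2 := mul_le_mul_of_nonneg_right hδ' n2.le
  have g3 : μ * n ^ 2 ≤ 1 / 100 * n ^ 2 := mul_le_mul_of_nonneg_right hμ' n2.le
  have g4 : 0 < α * n ^ 2 := by positivity
  linarith

/-- D and E are to be the sets reached by walks of two consecutive lengths. If few edges lead from D
out of E and from E out of D, then D ∩ E and D ∪ E both have sparse boundary, so each is almost
empty or almost all of Y. The size conditions leave only the case that D \ E and E \ D almost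
partition Y. Both are then almost independent, which `split_part_absurd` excludes: the graph is not
nearly bipartite. -/
lemma RobustPart.expand {μ α δ : ℝ} {Y : Finset V} (h : RobustPart L μ Y) (hμ : 0 < μ)
    (hL : ∀ a b, L a b → L b a) (hμ' : μ ≤ 1 / 100) (hδ : 0 < δ) (hδ' : δ ≤ 1 / 1000) (hα : 0 < α)
    (hn : 0 < Fintype.card V)
    (hd : (5 / 9 + α) * (Fintype.card V : ℝ) ^ 2 ≤ ec L univ univ) {D E : Finset V} (hD : D ⊆ Y)
    (hE : E ⊆ Y) (h1 : 2 * δ * Fintype.card V < D.card + E.card)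
    (h2 : 2 * δ * Fintype.card V < (Y \ D).card + (Y \ E).card) :
    μ * δ * (Fintype.card V : ℝ) ^ 2 ≤ ec L D (Y \ E) + ec L E (Y \ D) := by
  set n : ℝ := (Fintype.card V : ℝ) with hn'
  have hn0 : 0 < n := by rw [hn']; exact_mod_cast hn
  have hμn : 0 < μ * n := by positivity
  by_contra! hlt
  have e1 := ec_nonneg (L := L) D (Y \ E)
  have e2 := ec_nonneg (L := L) E (Y \ D)
  -- A vertex of Y outside D ∩ E lies outside E or outside D, so edges leaving D ∩ E are counted in
  -- one of the two sums.
  have cutP : ((D ∩ E).card : ℝ) ≤ δ * n ∨ ((Y \ (D ∩ E)).card : ℝ) ≤ δ * n := by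
    have hle : ec L (D ∩ E) (Y \ (D ∩ E)) ≤ ec L D (Y \ E) + ec L E (Y \ D) := by
      have e3 : Y \ (D ∩ E) = (Y \ E) ∪ ((Y \ D) \ (Y \ E)) := by
        ext v; simp only [mem_sdiff, mem_inter, mem_union]; tauto
      rw [e3, ec_union_right disjoint_sdiff]
      exact add_le_add (ec_mono inter_subset_left subset_rfl)
        (ec_mono inter_subset_right sdiff_subset)
    rcases h.cut (D ∩ E) (inter_subset_left.trans hD) with h3 | h3
    · left
      by_contra! h4
      have : μ * n * (δ * n) < μ * n * (D ∩ E).card := by gcongr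
      nlinarith
    · right
      by_contra! h4
      have : μ * n * (δ * n) < μ * n * (Y \ (D ∩ E)).card := by gcongr
      nlinarith
  have cutQ : ((Y \ (D ∪ E)).card : ℝ) ≤ δ * n ∨ ((D ∪ E).card : ℝ) ≤ δ * n := by
    have hle : ec L (D ∪ E) (Y \ (D ∪ E)) ≤ ec L D (Y \ E) + ec L E (Y \ D) := by
      have e3 : D ∪ E = D ∪ (E \ D) := by simp
      conv_lhs => rw [e3]
      rw [ec_union_left disjoint_sdiff]
      refine add_le_add (ec_mono subset_rfl ?_) (ec_mono sdiff_subset ?_)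
      · intro v; simp only [mem_sdiff, mem_union]; tauto
      · intro v; simp only [mem_sdiff, mem_union]; tauto
    rcases h.cut (D ∪ E) (union_subset hD hE) with h3 | h3
    · right
      by_contra! h4
      have : μ * n * (δ * n) < μ * n * (D ∪ E).card := by gcongr
      nlinarith
    · left
      by_contra! h4
      have : μ * n * (δ * n) < μ * n * (Y \ (D ∪ E)).card := by gcongr
      nlinarith
  rcases cutP with hP | hP
  swap
  · have a1 : ((Y \ D).card : ℝ) ≤ (Y \ (D ∩ E)).card :=
      Nat.cast_le.2 (card_le_card (sdiff_subset_sdiff subset_rfl inter_subset_left))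
    have a2 : ((Y \ E).card : ℝ) ≤ (Y \ (D ∩ E)).card :=
      Nat.cast_le.2 (card_le_card (sdiff_subset_sdiff subset_rfl inter_subset_right))
    linarith
  rcases cutQ with hQ | hQ
  swap
  · have a1 : (D.card : ℝ) ≤ (D ∪ E).card := Nat.cast_le.2 (card_le_card subset_union_left)
    have a2 : (E.card : ℝ) ≤ (D ∪ E).card := Nat.cast_le.2 (card_le_card subset_union_right)
    linarith
  -- the part splits into two nearly independent sets, which is too sparse
  set S := D \ E with hS
  set S' := E \ D with hS'
  set X := (D ∩ E) ∪ (Y \ (D ∪ E)) with hX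
  have hSS : Disjoint S S' := disjoint_left.2 fun v hv hv' => by
    simp only [hS, hS', mem_sdiff] at hv hv'; tauto
  have hSX : Disjoint (S ∪ S') X := disjoint_left.2 fun v hv hv' => by
    simp only [hS, hS', hX, mem_sdiff, mem_union, mem_inter] at hv hv'; tauto
  have hYeq : Y = (S ∪ S') ∪ X := by
    ext v
    have := @hD v
    have := @hE v
    simp only [hS, hS', hX, mem_sdiff, mem_union, mem_inter]; tauto
  have hXc : (X.card : ℝ) ≤ 2 * δ * n := by
    have : (X.card : ℝ) ≤ (D ∩ E).card + (Y \ (D ∪ E)).card := by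
      exact_mod_cast card_union_le _ _
    linarith
  have b1 : ec L S S ≤ ec L D (Y \ E) := ec_mono sdiff_subset (sdiff_subset_sdiff hD subset_rfl)
  have b2 : ec L S' S' ≤ ec L E (Y \ D) := ec_mono sdiff_subset (sdiff_subset_sdiff hE subset_rfl)
  have b3 : ec L Y Y = ec L S S + ec L S' S' + 2 * ec L S S' + 2 * ec L (S ∪ S') X + ec L X X := by
    conv_lhs => rw [hYeq]
    rw [ec_union_left hSX, ec_union_right hSX, ec_union_right hSX, ec_comm hL X (S ∪ S'),
      ec_union_right hSS, ec_union_left hSS S, ec_union_left hSS S', ec_comm hL S' S]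
    ring
  have c1 := ec_le (L := L) S S'
  have c2 := ec_le (L := L) (S ∪ S') X
  have c3 := ec_le (L := L) X X
  have c4 := ec_le (L := L) Yᶜ Yᶜ
  rw [card_compl_real, ← hn'] at c4
  have htot := ec_univ_le hL Y
  have d1 : (Y.card : ℝ) = S.card + S'.card + X.card := by
    conv_lhs => rw [hYeq]
    rw [card_union_of_disjoint hSX, card_union_of_disjoint hSS]
    push_cast; ring
  have d2 : ((S ∪ S').card : ℝ) = S.card + S'.card := by
    rw [card_union_of_disjoint hSS]; push_cast; ring
  rw [d2] at c2
  have hYn : (Y.card : ℝ) ≤ n := by rw [hn']; exact_mod_cast card_le_univ Y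
  have hc := h.card
  have hcr := h.cross
  rw [← hn'] at hc hcr
  have s0 : (0 : ℝ) ≤ S.card := Nat.cast_nonneg _
  have s1 : (0 : ℝ) ≤ S'.card := Nat.cast_nonneg _
  have x0 : (0 : ℝ) ≤ X.card := Nat.cast_nonneg _
  set s : ℝ := (S.card : ℝ)
  set s' : ℝ := (S'.card : ℝ)
  set x : ℝ := (X.card : ℝ)
  set y : ℝ := (Y.card : ℝ)
  exact split_part_absurd hn0 hμ' hδ hδ' hα s0 s1 x0 d1 hXc hYn hc hd
    (by linarith : ec L univ univ ≤ μ * δ * n ^ 2 + 2 * (s * s') + 2 * ((s + s') * x) + x * x +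
      2 * (μ * n ^ 2) + (n - y) * (n - y))

/-- The number of walks from `x` to `y` with `m` interior vertices. -/
noncomputable def walks (R : V → V → Prop) : ℕ → V → V → ℝ
  | 0, x, y => ind (R x y)
  | m + 1, x, y => ∑ z, walks R m x z * ind (R z y)

variable {R : V → V → Prop}

lemma walks_nonneg (m : ℕ) (x y : V) : 0 ≤ walks R m x y := by
  induction m generalizing y with
  | zero => exact ind_nonneg _
  | succ m ih => exact sum_nonneg fun z _ => mul_nonneg (ih z) (ind_nonneg _)

lemma walks_le (m : ℕ) (x y : V) : walks R m x y ≤ (Fintype.card V : ℝ) ^ m := by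
  induction m generalizing y with
  | zero => simpa [walks] using ind_le_one _
  | succ m ih =>
    rw [walks]
    refine (sum_le_sum (g := fun _ => (Fintype.card V : ℝ) ^ m) fun z _ => ?_).trans ?_
    · exact (mul_le_of_le_one_right (walks_nonneg _ _ _) (ind_le_one _)).trans (ih z)
    · simp [pow_succ']

/-- Walks can be prolonged by two steps, if all degrees are large. -/
lemma walks_wait (hR : ∀ a b, R a b → R b a) {d b : ℝ} (hd0 : 0 < d) (hb : 0 < b)
    (hn : 0 < Fintype.card V)
    (hd : ∀ a b, R a b → d * Fintype.card V ≤ ∑ z, ind (R a z))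
    {m : ℕ} {x y : V} (h : b * (Fintype.card V : ℝ) ^ (m + 1) ≤ walks R (m + 1) x y) :
    d ^ 2 * b ^ 2 * (Fintype.card V : ℝ) ^ (m + 3) ≤ walks R (m + 3) x y := by
  set n : ℝ := (Fintype.card V : ℝ) with hn'
  have hn0 : 0 < n := by rw [hn']; exact_mod_cast hn
  have hnm : 0 < n ^ m := by positivity
  -- H a counts the walks from x that reach a through a vertex z adjacent to y. It bounds from below
  -- the walks from x to a. Divided by nᵐ, it also bounds the number of w with a ~ w ~ y, since each
  -- z accounts for at most nᵐ walks. Concatenating gives at least Σ H(a)²/nᵐ walks x … z a w y, and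
  -- Cauchy–Schwarz finishes.
  set H : V → ℝ := fun a => ∑ z, walks R m x z * ind (R z y) * ind (R z a) with hH
  have hH0 : ∀ a, 0 ≤ H a := fun a => sum_nonneg fun z _ =>
    mul_nonneg (mul_nonneg (walks_nonneg _ _ _) (ind_nonneg _)) (ind_nonneg _)
  have hsymm : ∀ a b, ind (R a b) = ind (R b a) := fun a b => by
    rw [show R a b ↔ R b a from ⟨hR _ _, hR _ _⟩]
  have hsum : d * n * walks R (m + 1) x y ≤ ∑ a, H a := by
    simp only [hH]
    rw [sum_comm, walks, mul_sum]
    refine sum_le_sum fun z _ => ?_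
    rw [← mul_sum]
    by_cases hz : R z y
    · have := hd z y hz
      rw [mul_comm (d * n)]
      exact mul_le_mul_of_nonneg_left this (mul_nonneg (walks_nonneg _ _ _) (ind_nonneg _))
    · simp [ind, hz]
  have hlow : ∑ a, H a * (H a / n ^ m) ≤ walks R (m + 3) x y := by
    have e : walks R (m + 3) x y = ∑ w, (∑ a, (∑ z, walks R m x z * ind (R z a)) * ind (R a w)) *
      ind (R w y) := rfl
    rw [e]
    have e2 : ∑ w, (∑ a, (fun a => ∑ z, walks R m x z * ind (R z a)) a * ind (R a w)) * ind (R w y) =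
      ∑ a, (fun a => ∑ z, walks R m x z * ind (R z a)) a * ∑ w, ind (R a w) * ind (R w y) := by
      generalize (fun a => ∑ z, walks R m x z * ind (R z a)) = F
      simp only [sum_mul, mul_sum, mul_assoc]
      exact sum_comm
    refine le_trans ?_ e2.ge
    refine sum_le_sum fun a _ => mul_le_mul ?_ ?_ (div_nonneg (hH0 a) hnm.le) ?_
    · refine sum_le_sum fun z _ => mul_le_mul_of_nonneg_right ?_ (ind_nonneg _)
      exact mul_le_of_le_one_right (walks_nonneg _ _ _) (ind_le_one _)
    · rw [div_le_iff₀ hnm, sum_mul]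
      refine sum_le_sum fun z _ => ?_
      rw [hsymm a z]
      have := walks_le (R := R) m x z
      have h1 := ind_nonneg (R z y)
      have h2 := ind_nonneg (R z a)
      calc walks R m x z * ind (R z y) * ind (R z a) ≤ n ^ m * ind (R z y) * ind (R z a) := by
            gcongr
        _ = _ := by ring
    · exact sum_nonneg fun z _ => mul_nonneg (walks_nonneg _ _ _) (ind_nonneg _)
  have hcs : (∑ a, H a) ^ 2 ≤ n * ∑ a, H a ^ 2 := by
    have := sq_sum_le_card_mul_sum_sq (s := (univ : Finset V)) (f := H)
    rwa [card_univ] at this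
  have h1 : d * b * n ^ (m + 2) ≤ ∑ a, H a := by
    calc d * b * n ^ (m + 2) = d * n * (b * n ^ (m + 1)) := by ring
      _ ≤ d * n * walks R (m + 1) x y := by gcongr
      _ ≤ _ := hsum
  have h2 : (d * b * n ^ (m + 2)) ^ 2 ≤ n * ∑ a, H a ^ 2 := le_trans (by gcongr) hcs
  have h3 : ∑ a, H a * (H a / n ^ m) = (∑ a, H a ^ 2) / n ^ m := by
    rw [sum_div]
    exact sum_congr rfl fun a _ => by ring
  rw [h3] at hlow
  refine le_trans ?_ hlow
  rw [le_div_iff₀ hnm]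
  have e : (d * b * n ^ (m + 2)) ^ 2 = n * (d ^ 2 * b ^ 2 * n ^ (m + 3) * n ^ m) := by ring
  rw [e] at h2
  exact le_of_mul_le_mul_left h2 hn0

end Graphs

/-! ### Many walks of one common length inside a robust part. -/

section Walks

variable {V : Type u} [Fintype V]

/-- The restriction of a graph to a vertex set. -/
def restr (L : V → V → Prop) (Y : Finset V) (a b : V) : Prop := L a b ∧ a ∈ Y ∧ b ∈ Y

variable {L : V → V → Prop} {Y : Finset V}

lemma sum_ind_restr {y : V} (hy : y ∈ Y) :
    ∑ z, ind (restr L Y y z) = ∑ z ∈ Y, ind (L y z) := by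
  rw [← sum_subset (subset_univ Y)]
  · exact sum_congr rfl fun z hz => by simp [restr, hy, hz]
  · intro z _ hz
    simp [restr, hz, ind]

lemma mul_card_le_walks_succ {R : V → V → Prop} {A : Finset V} {c : ℝ} {m : ℕ} {x y : V}
    (hA : ∀ z ∈ A, c ≤ walks R m x z) :
    c * ∑ z ∈ A, ind (R z y) ≤ walks R (m + 1) x y := by
  rw [walks, mul_sum]
  refine le_trans (sum_le_sum fun z hz => mul_le_mul_of_nonneg_right (hA z hz) (ind_nonneg _)) ?_
  exact sum_le_sum_of_subset_of_nonneg (subset_univ A)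
    fun z _ _ => mul_nonneg (walks_nonneg _ _ _) (ind_nonneg _)

/-- The hypotheses under which all pairs of vertices of `Y` are joined by many walks. -/
structure WalkSetup (L : V → V → Prop) (α μ : ℝ) (Y : Finset V) : Prop where
  symm : ∀ a b, L a b → L b a
  card : 2 ≤ Fintype.card V
  dens : (5 / 9 + α) * (Fintype.card V : ℝ) ^ 2 ≤ ec L univ univ
  part : RobustPart L μ Y

/-- One expansion step: the set of vertices of `Y` outside `E` with many neighbours in `D`. -/
lemma exists_new {D E : Finset V} {c : ℝ} (hc : 0 ≤ c) :
    ec L D (Y \ E) ≤ Fintype.card V * (((Y \ E).filter fun y => c ≤ ∑ z ∈ D, ind (L z y)).card : ℝ)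
      + c * Fintype.card V := by
  have e : ec L D (Y \ E) = ∑ y ∈ Y \ E, ∑ z ∈ D, ind (L z y) := sum_comm
  rw [e]
  have h : ∀ y ∈ Y \ E, ∑ z ∈ D, ind (L z y) ≤
      Fintype.card V * (if c ≤ ∑ z ∈ D, ind (L z y) then (1 : ℝ) else 0) + c := by
    intro y _
    split_ifs with hy
    · have : ∑ z ∈ D, ind (L z y) ≤ Fintype.card V := by
        refine (sum_le_sum fun z _ => ind_le_one _).trans ?_
        simp only [sum_const, nsmul_eq_mul, mul_one]
        exact_mod_cast card_le_univ D
      linarith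
    · push Not at hy; linarith
  refine (sum_le_sum h).trans ?_
  rw [sum_add_distrib, ← mul_sum, sum_const, nsmul_eq_mul, sum_boole]
  have : ((Y \ E).card : ℝ) ≤ Fintype.card V := by exact_mod_cast card_le_univ _
  rw [mul_comm c]
  gcongr

/-- D and E are sets reached from x by many walks with i + 1 and i + 2 interior vertices. While D
and E do not nearly exhaust Y, `RobustPart.expand` provides many edges from D out of E or from E out
of D. Hence |D| + |E| grows by a fixed multiple of n in each round, and boundedly many rounds
suffice. -/
lemma walk_reach {α μ : ℝ} (hα : 0 < α) (hμ : 0 < μ) (hμ' : μ ≤ 1 / 100) (i : ℕ) :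
    ∃ β : ℝ, 0 < β ∧ ∀ (V : Type u) [Fintype V] (L : V → V → Prop) (Y : Finset V),
      WalkSetup L α μ Y → ∀ x ∈ Y, ∃ D E : Finset V, D ⊆ Y ∧ E ⊆ Y ∧
        (∀ y ∈ D, β * (Fintype.card V : ℝ) ^ (i + 1) ≤ walks (restr L Y) (i + 1) x y) ∧
        (∀ y ∈ E, β * (Fintype.card V : ℝ) ^ (i + 2) ≤ walks (restr L Y) (i + 2) x y) ∧
        2 * (μ ^ 2 / 1000) * Fintype.card V < (D.card : ℝ) + E.card ∧
        min (2 * (Y.card : ℝ) - 2 * (μ ^ 2 / 1000) * Fintype.card V)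
          (i * (μ ^ 3 / 2000) * Fintype.card V) ≤ (D.card : ℝ) + E.card := by
  induction i with
  | zero =>
    refine ⟨μ ^ 2 / 2, by positivity, ?_⟩
    intro V _ L Y h x hx
    set n : ℝ := (Fintype.card V : ℝ) with hn
    have hn2 : (2 : ℝ) ≤ n := by rw [hn]; exact_mod_cast h.card
    have hn0 : 0 < n := by linarith
    set R := restr L Y with hR
    have hdeg : ∀ y ∈ Y, μ * n ≤ ∑ z, ind (R y z) := fun y hy => by
      rw [hR, sum_ind_restr hy]
      exact h.part.deg hμ h.card hy
    have hsum : μ * n * (μ * n) ≤ ∑ y, walks R 1 x y := by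
      have e : ∑ y, walks R 1 x y = ∑ z, ind (R x z) * ∑ y, ind (R z y) := by
        simp only [walks, mul_sum]
        exact sum_comm
      rw [e]
      calc μ * n * (μ * n) ≤ (∑ z, ind (R x z)) * (μ * n) := by
            have := hdeg x hx
            gcongr
        _ = ∑ z, ind (R x z) * (μ * n) := sum_mul _ _ _
        _ ≤ _ := sum_le_sum fun z _ => by
            by_cases hz : R x z
            · exact mul_le_mul_of_nonneg_left (hdeg z hz.2.2) (ind_nonneg _)
            · simp [ind, hz]
    have hav := sum_le_cnt (fun y => walks R 1 x y) (M := n) (c := μ ^ 2 / 2 * n) (by positivity)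
      (fun y => by simpa using walks_le (R := R) 1 x y)
    have hcnt : cnt (fun y => μ ^ 2 / 2 * n ≤ walks R 1 x y) =
        ((univ.filter fun y => μ ^ 2 / 2 * n ≤ walks R 1 x y).card : ℝ) := by
      unfold cnt; congr!
    rw [hcnt, ← hn] at hav
    set D := univ.filter fun y => μ ^ 2 / 2 * n ≤ walks R 1 x y with hD
    have hDc : μ ^ 2 / 2 * n ≤ D.card := by
      have : n * (μ ^ 2 / 2 * n) ≤ n * D.card := by nlinarith
      exact le_of_mul_le_mul_left this hn0
    refine ⟨D, ∅, ?_, by simp, ?_, by simp, ?_, ?_⟩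
    · intro y hy
      simp only [hD, mem_filter, mem_univ, true_and] at hy
      by_contra hyY
      have : walks R 1 x y = 0 := by
        simp only [walks]
        exact sum_eq_zero fun z _ => by simp [hR, restr, hyY, ind]
      have : 0 < μ ^ 2 / 2 * n := by positivity
      linarith
    · intro y hy
      simp only [hD, mem_filter, mem_univ, true_and] at hy
      simpa using hy
    · simp only [card_empty, Nat.cast_zero, add_zero]
      have : 0 < μ ^ 2 * n := by positivity
      linarith
    · refine (min_le_right _ _).trans ?_
      simp only [Nat.cast_zero, zero_mul, card_empty, add_zero]
      positivity
  | succ i ih =>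
    obtain ⟨β, hβ, ih⟩ := ih
    set ν := μ ^ 3 / 1000 with hν
    have hν0 : 0 < ν := by positivity
    refine ⟨min β (min (β * (ν / 4)) (μ ^ 2 * β ^ 2)), by positivity, ?_⟩
    intro V _ L Y h x hx
    obtain ⟨D, E, hD, hE, hDw, hEw, hlow, hgrow⟩ := ih V L Y h x hx
    set n : ℝ := (Fintype.card V : ℝ) with hn
    have hn2 : (2 : ℝ) ≤ n := by rw [hn]; exact_mod_cast h.card
    have hn0 : 0 < n := by linarith
    set R := restr L Y with hR
    have hRs : ∀ a b, R a b → R b a := fun a b hab => ⟨h.symm _ _ hab.1, hab.2.2, hab.2.1⟩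
    have hdeg : ∀ a b, R a b → μ * n ≤ ∑ z, ind (R a z) := fun y b hy => by
      rw [hR, sum_ind_restr hy.2.1]
      exact h.part.deg hμ h.card hy.2.1
    have hstep : ∀ {m : ℕ} {A : Finset V}, A ⊆ Y →
        (∀ y ∈ A, β * n ^ m ≤ walks R m x y) → ∀ y ∈ Y, ν / 4 * n ≤ ∑ z ∈ A, ind (L z y) →
        β * (ν / 4) * n ^ (m + 1) ≤ walks R (m + 1) x y := by
      intro m A hA hw y hy hyA
      have e : ∑ z ∈ A, ind (L z y) = ∑ z ∈ A, ind (R z y) :=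
        sum_congr rfl fun z hz => by simp [hR, restr, hA hz, hy]
      rw [e] at hyA
      calc β * (ν / 4) * n ^ (m + 1) = β * n ^ m * (ν / 4 * n) := by ring
        _ ≤ β * n ^ m * ∑ z ∈ A, ind (R z y) := by gcongr
        _ ≤ _ := mul_card_le_walks_succ hw
    set A := (Y \ E).filter fun y => ν / 4 * n ≤ ∑ z ∈ D, ind (L z y) with hA
    set B := (Y \ D).filter fun y => ν / 4 * n ≤ ∑ z ∈ E, ind (L z y) with hB
    have hAY : A ⊆ Y := (filter_subset _ _).trans sdiff_subset
    have hBY : B ⊆ Y := (filter_subset _ _).trans sdiff_subset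
    have hEA : Disjoint E A := disjoint_left.2 fun v hv hv' => by
      simp only [hA, mem_filter, mem_sdiff] at hv'; tauto
    have hDB : Disjoint D B := disjoint_left.2 fun v hv hv' => by
      simp only [hB, mem_filter, mem_sdiff] at hv'; tauto
    have hcE : ((E ∪ A).card : ℝ) = E.card + A.card := by
      rw [card_union_of_disjoint hEA]; push_cast; ring
    have hcD : ((D ∪ B).card : ℝ) = D.card + B.card := by
      rw [card_union_of_disjoint hDB]; push_cast; ring
    have hA0 : (0 : ℝ) ≤ A.card := Nat.cast_nonneg _
    have hB0 : (0 : ℝ) ≤ B.card := Nat.cast_nonneg _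
    -- The roles shift by one length: E keeps its walks and gains A through one step from D. D keeps
    -- its parity by waiting two steps (`walks_wait`) and gains B through one step from E.
    refine ⟨E ∪ A, D ∪ B, union_subset hE hAY, union_subset hD hBY, ?_, ?_, ?_, ?_⟩
    · intro y hy
      rcases mem_union.1 hy with hy | hy
      · refine le_trans ?_ (hEw y hy)
        gcongr
        exact min_le_left _ _
      · simp only [hA, mem_filter, mem_sdiff] at hy
        refine le_trans ?_ (hstep hD hDw y hy.1.1 hy.2)
        gcongr
        exact (min_le_right _ _).trans (min_le_left _ _)
    · intro y hy
      rcases mem_union.1 hy with hy | hy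
      · refine le_trans ?_ (walks_wait hRs hμ hβ (by have := h.card; omega) hdeg (hDw y hy))
        rw [← hn]
        gcongr
        exact (min_le_right _ _).trans (min_le_right _ _)
      · simp only [hB, mem_filter, mem_sdiff] at hy
        refine le_trans ?_ (hstep hE hEw y hy.1.1 hy.2)
        gcongr
        exact (min_le_right _ _).trans (min_le_left _ _)
    · rw [hcE, hcD]; linarith
    · rw [hcE, hcD]
      by_cases hfull : 2 * (Y.card : ℝ) - 2 * (μ ^ 2 / 1000) * n ≤ D.card + E.card
      · exact (min_le_left _ _).trans (by linarith)
      push Not at hfull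
      have h1 : (i : ℝ) * (μ ^ 3 / 2000) * n ≤ D.card + E.card := by
        rcases min_le_iff.1 hgrow with h1 | h1
        · linarith
        · exact h1
      have hx1 : ((Y \ D).card : ℝ) = Y.card - D.card := by
        rw [card_sdiff_of_subset hD, Nat.cast_sub (card_le_card hD)]
      have hx2 : ((Y \ E).card : ℝ) = Y.card - E.card := by
        rw [card_sdiff_of_subset hE, Nat.cast_sub (card_le_card hE)]
      have hexp := h.part.expand hμ h.symm hμ' (δ := μ ^ 2 / 1000) (by positivity) (by nlinarith) hα
        (by have := h.card; omega) h.dens hD hE hlow (by rw [hx1, hx2]; linarith)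
      have hn1 := exists_new (L := L) (Y := Y) (D := D) (E := E) (c := ν / 4 * n) (by positivity)
      have hn2 := exists_new (L := L) (Y := Y) (D := E) (E := D) (c := ν / 4 * n) (by positivity)
      rw [← hn, ← hA] at hn1
      rw [← hn, ← hB] at hn2
      rw [← hn] at hexp
      have hAB : ν / 2 * n ≤ A.card + B.card := by
        have : n * (ν / 2 * n) ≤ n * (A.card + B.card) := by
          have e : μ * (μ ^ 2 / 1000) * n ^ 2 = ν * n ^ 2 := by rw [hν]; ring
          rw [e] at hexp
          nlinarith
        exact le_of_mul_le_mul_left this hn0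
      refine (min_le_right _ _).trans ?_
      push_cast
      have : μ ^ 3 / 2000 = ν / 2 := by rw [hν]; ring
      rw [this] at h1 ⊢
      linarith

/-- In a robust part all pairs of vertices are joined by many walks of the same length, which has
an even number of interior vertices. -/
theorem exists_many_walks {α μ : ℝ} (hα : 0 < α) (hμ : 0 < μ) (hμ' : μ ≤ 1 / 100) :
    ∃ (h : ℕ) (β : ℝ), 0 < β ∧ ∀ (V : Type u) [Fintype V] (L : V → V → Prop) (Y : Finset V),
      WalkSetup L α μ Y → ∀ x ∈ Y, ∀ y ∈ Y,
        β * (Fintype.card V : ℝ) ^ (2 * h) ≤ walks (restr L Y) (2 * h) x y := by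
  -- After 2k + 1 rounds |D| + |E| has reached its cap of almost 2|Y|, so E misses fewer than half
  -- of the guaranteed neighbours of y. One more step into y turns 2k + 3 interior vertices into the
  -- even number 2(k + 2).
  obtain ⟨k, hk⟩ := exists_nat_gt (2 / (μ ^ 3 / 2000))
  obtain ⟨β, hβ, hw⟩ := walk_reach.{u} hα hμ hμ' (2 * k + 1)
  refine ⟨k + 2, β * (μ / 2), by positivity, ?_⟩
  intro V _ L Y h x hx y hy
  obtain ⟨D, E, hD, hE, -, hEw, -, hgrow⟩ := hw V L Y h x hx
  set n : ℝ := (Fintype.card V : ℝ) with hn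
  have hn2 : (2 : ℝ) ≤ n := by rw [hn]; exact_mod_cast h.card
  have hn0 : 0 < n := by linarith
  have hDY : (D.card : ℝ) ≤ Y.card := Nat.cast_le.2 (card_le_card hD)
  have hYn : (Y.card : ℝ) ≤ n := by rw [hn]; exact_mod_cast card_le_univ Y
  have hbig : 2 * n ≤ ((2 * k + 1 : ℕ) : ℝ) * (μ ^ 3 / 2000) * n := by
    have : 2 ≤ (k : ℝ) * (μ ^ 3 / 2000) := by
      rw [div_lt_iff₀ (by positivity)] at hk
      exact hk.le
    have h2 : (2 : ℝ) ≤ ((2 * k + 1 : ℕ) : ℝ) * (μ ^ 3 / 2000) := by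
      push_cast
      have : 0 < μ ^ 3 / 2000 := by positivity
      nlinarith
    gcongr
  have hEfull : (Y.card : ℝ) - μ / 2 * n ≤ E.card := by
    have h1 : 2 * (Y.card : ℝ) - 2 * (μ ^ 2 / 1000) * n ≤ D.card + E.card := by
      rcases min_le_iff.1 hgrow with h1 | h1
      · exact h1
      · have : 0 < μ ^ 2 / 1000 * n := by positivity
        linarith
    have h2 : 2 * (μ ^ 2 / 1000) * n ≤ μ / 2 * n := by
      gcongr
      nlinarith
    linarith
  have hdeg := h.part.deg hμ h.card hy
  rw [← hn] at hdeg
  have h1 : μ / 2 * n ≤ ∑ z ∈ E, ind (restr L Y z y) := by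
    have e : ∑ z ∈ E, ind (restr L Y z y) = ∑ z ∈ E, ind (L y z) :=
      sum_congr rfl fun z hz => by
        rw [show restr L Y z y ↔ L y z from
          ⟨fun hh => h.symm _ _ hh.1, fun hh => ⟨h.symm _ _ hh, hE hz, hy⟩⟩]
    rw [e]
    have h2 : ∑ z ∈ Y, ind (L y z) = ∑ z ∈ Y \ E, ind (L y z) + ∑ z ∈ E, ind (L y z) :=
      (sum_sdiff hE).symm
    have h3 : ∑ z ∈ Y \ E, ind (L y z) ≤ (Y \ E).card := by
      refine (sum_le_sum fun z _ => ind_le_one _).trans ?_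
      simp
    have h4 : ((Y \ E).card : ℝ) = Y.card - E.card := by
      rw [card_sdiff_of_subset hE, Nat.cast_sub (card_le_card hE)]
    linarith
  have h2 := mul_card_le_walks_succ (y := y) hEw
  calc β * (μ / 2) * n ^ (2 * (k + 2)) = β * n ^ (2 * k + 1 + 2) * (μ / 2 * n) := by ring
    _ ≤ β * n ^ (2 * k + 1 + 2) * ∑ z ∈ E, ind (restr L Y z y) := by gcongr
    _ ≤ _ := h2

end Walks

open TripleSystem

/-! ### Finite sets behind the counting functions. -/

section Filters

/-- The set of elements satisfying `p`. -/
noncomputable def fil {ι : Type*} [Fintype ι] (p : ι → Prop) : Finset ι := univ.filter p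

lemma mem_fil {ι : Type*} [Fintype ι] {p : ι → Prop} {x : ι} : x ∈ fil p ↔ p x := by simp [fil]

lemma card_fil {ι : Type*} [Fintype ι] (p : ι → Prop) : ((fil p).card : ℝ) = cnt p := rfl

/-- The set of lists of length `k` satisfying `p`. -/
noncomputable def lfil {V : Type u} [Fintype V] (k : ℕ) (p : List V → Prop) : Finset (List V) :=
  (listsIn univ k).filter p

lemma mem_lfil {V : Type u} [Fintype V] {k : ℕ} {p : List V → Prop} {l : List V} :
    l ∈ lfil k p ↔ l.length = k ∧ p l := by simp [lfil, mem_lists_univ]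

lemma card_lfil {V : Type u} [Fintype V] (k : ℕ) (p : List V → Prop) :
    ((lfil k p).card : ℝ) = lcnt k p := rfl

lemma cnt_eq_ind {ι : Type*} [Fintype ι] (p : ι → Prop) : cnt p = ∑ x, ind (p x) := cnt_eq_sum p

lemma lcnt_eq_ind {V : Type u} [Fintype V] (k : ℕ) (p : List V → Prop) :
    lcnt k p = ∑ l ∈ listsIn univ k, ind (p l) := by
  simp [lcnt, ind]

lemma ind_and (p q : Prop) : ind (p ∧ q) = ind p * ind q := by
  by_cases p <;> by_cases q <;> simp [ind, *]

lemma ind_of_not {p : Prop} (h : ¬ p) : ind p = 0 := by simp [ind, h]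

end Filters

/-! ### Restricted links and the connecting lemma. -/

section Links

variable {V : Type u} [Fintype V]

lemma ec_eq_cnt (L : V → V → Prop) (A B : Finset V) :
    ec L A B = cnt (fun z : V × V => (z.1 ∈ A ∧ z.2 ∈ B) ∧ L z.1 z.2) := by
  rw [cnt_prod (fun a b => (a ∈ A ∧ b ∈ B) ∧ L a b)]
  simp only [cnt_eq_sum, ec]
  rw [← sum_subset (subset_univ A)]
  · refine sum_congr rfl fun a ha => ?_
    rw [← sum_subset (subset_univ B)]
    · exact sum_congr rfl fun b hb => by simp [ha, hb, ind]
    · intro b _ hb; simp [hb]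
  · intro a _ ha; simp [ha]

lemma cnt_mem_prod (A B : Finset V) :
    cnt (fun z : V × V => z.1 ∈ A ∧ z.2 ∈ B) = A.card * B.card := by
  rw [cnt_and_prod (fun a => a ∈ A) (fun b => b ∈ B), cnt_mem, cnt_mem]

/-- The link of `u`, restricted to the set `Y u`. -/
def lk (T : TripleSystem V) (Y : V → Finset V) (u : V) : V → V → Prop := restr (T.adj u) (Y u)

variable {T : TripleSystem V} {Y : V → Finset V}

omit [Fintype V] in
lemma lk_symm {u a b : V} (h : lk T Y u a b) : lk T Y u b a := ⟨T.swap23 h.1, h.2.2, h.2.1⟩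

/-- All links are dense and robustly connected on the sets `Y u`. -/
structure RobustLinks (T : TripleSystem V) (α μ β : ℝ) (h : ℕ) (Y : V → Finset V) : Prop where
  card2 : 2 ≤ Fintype.card V
  dens : ∀ u, (5 / 9 + α) * (Fintype.card V : ℝ) ^ 2 ≤ ec (T.adj u) univ univ
  part : ∀ u, RobustPart (T.adj u) μ (Y u)
  walks : ∀ u, ∀ x ∈ Y u, ∀ y ∈ Y u,
    β * (Fintype.card V : ℝ) ^ (2 * h) ≤ walks (lk T Y u) (2 * h) x y

theorem exists_robustLinks {α μ : ℝ} (hμ : 0 < μ) (hμ' : μ ≤ 1 / 100) (hα : 2 * μ ≤ α) :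
    ∃ (h : ℕ) (β : ℝ), 0 < β ∧ ∀ (V : Type u) [Fintype V] (T : TripleSystem V),
      2 ≤ Fintype.card V →
      (∀ u, (5 / 9 + α) * (Fintype.card V : ℝ) ^ 2 ≤ ec (T.adj u) univ univ) →
      ∃ Y, RobustLinks T α μ β h Y := by
  have hα0 : 0 < α := by linarith
  obtain ⟨h, β, hβ, hw⟩ := exists_many_walks.{u} hα0 hμ hμ'
  refine ⟨h, β, hβ, fun V _ T h2 hd => ?_⟩
  have : Nonempty V := Fintype.card_pos_iff.1 (by omega)
  have hs : ∀ u a b, T.adj u a b → T.adj u b a := fun u a b hh => T.swap23 hh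
  choose Y hY using fun u => exists_robustPart (hs u) hμ hμ' hα (hd u)
  exact ⟨Y, h2, hd, hY, fun u => hw V (T.adj u) (Y u) ⟨hs u, h2, hd u, hY u⟩⟩

variable {α μ β : ℝ} {h : ℕ}

lemma RobustLinks.pos (hR : RobustLinks T α μ β h Y) : (0 : ℝ) < Fintype.card V := by
  have := hR.card2
  exact_mod_cast (by omega : 0 < Fintype.card V)

lemma RobustLinks.le_ec (hR : RobustLinks T α μ β h Y) (u : V) :
    (5 / 9 + α - 2 * μ) * (Fintype.card V : ℝ) ^ 2 - ((Fintype.card V : ℝ) - (Y u).card) ^ 2 ≤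
      ec (T.adj u) (Y u) (Y u) := by
  have h1 := ec_univ_le (fun a b hh => T.swap23 hh) (L := T.adj u) (Y u)
  have h2 := hR.dens u
  have h3 := (hR.part u).cross
  have h4 := ec_le (L := T.adj u) (Y u)ᶜ (Y u)ᶜ
  rw [card_compl_real] at h4
  linarith

lemma cnt_nonadj_le (hR : RobustLinks T α μ β h Y) (u : V) {C : Finset V} (hC : C ⊆ Y u) :
    cnt (fun z : V × V => (z.1 ∈ C ∧ z.2 ∈ C) ∧ ¬ T.adj u z.1 z.2) ≤
      ((Y u).card : ℝ) ^ 2 + ((Fintype.card V : ℝ) - (Y u).card) ^ 2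
        - (5 / 9 + α - 2 * μ) * (Fintype.card V : ℝ) ^ 2 := by
  have h1 := hR.le_ec u
  rw [ec_eq_cnt] at h1
  have h2 := cnt_split (fun z : V × V => z.1 ∈ Y u ∧ z.2 ∈ Y u) (fun z => T.adj u z.1 z.2)
  rw [cnt_mem_prod] at h2
  have h3 : cnt (fun z : V × V => (z.1 ∈ C ∧ z.2 ∈ C) ∧ ¬ T.adj u z.1 z.2) ≤
      cnt (fun z : V × V => (z.1 ∈ Y u ∧ z.2 ∈ Y u) ∧ ¬ T.adj u z.1 z.2) :=
    cnt_mono fun z hz => ⟨⟨hC hz.1.1, hC hz.1.2⟩, hz.2⟩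
  linarith

/-- With c = a + b - n the right-hand side equals n²/9 - (a - b)² + (2α - 4μ)n². As a and b lie
between 2n/3 and n, (a - b)² ≤ n²/9. This is where the lower bound 2/3 on the parts and the density
5/9 balance exactly. -/
lemma common_numeric {a b c n α μ : ℝ} (hn : 0 ≤ n) (ha : 2 / 3 * n ≤ a) (hb : 2 / 3 * n ≤ b)
    (ha' : a ≤ n) (hb' : b ≤ n) (hc : a + b - n ≤ c) (hμ : 4 * μ ≤ α) :
    α * n ^ 2 ≤ c * c - (a ^ 2 + (n - a) ^ 2 - (5 / 9 + α - 2 * μ) * n ^ 2) -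
      (b ^ 2 + (n - b) ^ 2 - (5 / 9 + α - 2 * μ) * n ^ 2) := by
  have h1 : (a + b - n) ^ 2 ≤ c ^ 2 := pow_le_pow_left₀ (by linarith) hc 2
  have h2 : (a - b) ^ 2 ≤ (n / 3) ^ 2 := by
    apply sq_le_sq'
    · linarith
    · linarith
  have h3 : 0 ≤ (α - 4 * μ) * n ^ 2 := mul_nonneg (by linarith) (by positivity)
  linarith

/-- Any two restricted links have many common edges. -/
lemma RobustLinks.common (hR : RobustLinks T α μ β h Y) (hμ : 4 * μ ≤ α) (u v : V) :
    α * (Fintype.card V : ℝ) ^ 2 ≤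
      cnt (fun z : V × V => lk T Y u z.1 z.2 ∧ lk T Y v z.1 z.2) := by
  set n : ℝ := (Fintype.card V : ℝ) with hn
  set C := Y u ∩ Y v with hC
  have h1 := cnt_nonadj_le hR u (C := C) inter_subset_left
  have h2 := cnt_nonadj_le hR v (C := C) inter_subset_right
  have h3 : (Y u).card + ((Y v).card : ℝ) - n ≤ C.card := by
    have e : (Y u).card + (Y v).card = (Y u ∪ Y v).card + C.card :=
      (card_union_add_card_inter _ _).symm
    have e2 : ((Y u ∪ Y v).card : ℝ) ≤ n := by rw [hn]; exact_mod_cast card_le_univ _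
    have e3 : ((Y u).card : ℝ) + (Y v).card = (Y u ∪ Y v).card + C.card := by exact_mod_cast e
    linarith
  have h4 : cnt (fun z : V × V => z.1 ∈ C ∧ z.2 ∈ C) ≤
      cnt (fun z : V × V => lk T Y u z.1 z.2 ∧ lk T Y v z.1 z.2) +
      (cnt (fun z : V × V => (z.1 ∈ C ∧ z.2 ∈ C) ∧ ¬ T.adj u z.1 z.2) +
      cnt (fun z : V × V => (z.1 ∈ C ∧ z.2 ∈ C) ∧ ¬ T.adj v z.1 z.2)) := by
    refine le_trans ?_ ((cnt_or_le _ _).trans (add_le_add le_rfl (cnt_or_le _ _)))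
    refine cnt_mono fun z hz => ?_
    have := mem_inter.1 hz.1
    have := mem_inter.1 hz.2
    simp only [lk, restr]
    tauto
  rw [cnt_mem_prod] at h4
  have a1 := (hR.part u).card
  have a2 := (hR.part v).card
  have b1 : ((Y u).card : ℝ) ≤ n := by rw [hn]; exact_mod_cast card_le_univ _
  have b2 : ((Y v).card : ℝ) ≤ n := by rw [hn]; exact_mod_cast card_le_univ _
  have := common_numeric hR.pos.le a1 a2 b1 b2 h3 hμ
  linarith

/-- The pair `x, y` lies in at least `ζ n` restricted links of vertices outside `B`. -/
def Conn (T : TripleSystem V) (Y : V → Finset V) (B : Finset V) (ζ : ℝ) (x y : V) : Prop :=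
  ζ * Fintype.card V ≤ cnt (fun u => u ∉ B ∧ lk T Y u x y)

lemma Conn.symm {B : Finset V} {ζ : ℝ} {x y : V} (hc : Conn T Y B ζ x y) : Conn T Y B ζ y x :=
  hc.trans (cnt_mono fun _ hu => ⟨hu.1, lk_symm hu.2⟩)

section WalkLists

variable {R : V → V → Prop}

lemma walks_succ' (m : ℕ) (x y : V) :
    walks R (m + 1) x y = ∑ z, ind (R x z) * walks R m z y := by
  induction m generalizing y with
  | zero => rfl
  | succ m ih =>
    rw [walks]
    simp_rw [ih, walks, sum_mul, mul_sum]
    rw [sum_comm]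
    exact sum_congr rfl fun _ _ => sum_congr rfl fun _ _ => by ring

lemma walks_eq_lcnt (m : ℕ) (x y : V) :
    walks R m x y = lcnt m (fun l => List.IsChain R (x :: (l ++ [y]))) := by
  induction m generalizing x with
  | zero => simp [walks, lcnt_zero, ind]
  | succ m ih =>
    rw [walks_succ', lcnt_succ]
    refine sum_congr rfl fun z _ => ?_
    rw [ih]
    by_cases hz : R x z
    · simp [hz, ind_of]
    · have : ∀ l : List V, ¬ List.IsChain R (x :: ((z :: l) ++ [y])) := fun l hl => by
        rw [List.cons_append, List.isChain_cons_cons] at hl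
        exact hz hl.1
      simp only [this, ind, hz]
      simp [lcnt]

end WalkLists

/-- Insert the entries of the first list after every two entries of the second. -/
def interleave : List V → List V → List V
  | u :: us, a :: a' :: as => u :: a :: a' :: interleave us as
  | us, _ => us

omit [Fintype V] in
lemma length_interleave {us as : List V} {h : ℕ} (h1 : us.length = h + 1)
    (h2 : as.length = 2 * h) : (interleave us as).length = 3 * h + 1 := by
  induction h generalizing us as with
  | zero =>
    have : as = [] := List.length_eq_zero_iff.1 h2
    subst this
    match us, h1 with
    | [u], _ => simp [interleave]
  | succ h ih =>
    match us, as, h1, h2 with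
    | u :: us, a :: a' :: as, h1, h2 =>
      simp only [interleave, List.length_cons] at *
      rw [ih (by omega) (by omega)]
      ring

omit [Fintype V] in
lemma mem_interleave {us as : List V} {v : V} (hv : v ∈ interleave us as) : v ∈ us ∨ v ∈ as := by
  induction us, as using interleave.induct with
  | case1 u us a a' as ih => simp only [interleave, List.mem_cons] at *; tauto
  | case2 us as hne =>
    rw [interleave] at hv
    · exact Or.inl hv
    · exact hne

omit [Fintype V] in
lemma interleave_inj {us as us' as' : List V} {h : ℕ} (h1 : us.length = h + 1)
    (h2 : as.length = 2 * h) (h1' : us'.length = h + 1) (h2' : as'.length = 2 * h)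
    (he : interleave us as = interleave us' as') : us = us' ∧ as = as' := by
  induction h generalizing us as us' as' with
  | zero =>
    have e : as = [] := List.length_eq_zero_iff.1 h2
    have e' : as' = [] := List.length_eq_zero_iff.1 h2'
    subst e e'
    simpa [interleave] using he
  | succ h ih =>
    match us, as, us', as', h1, h2, h1', h2' with
    | u :: us, a :: b :: as, u' :: us', a' :: b' :: as', h1, h2, h1', h2' =>
      simp only [interleave, List.length_cons, List.cons.injEq] at *
      have := ih (by omega) (by omega) (by omega) (by omega) he.2.2.2
      tauto

omit [Fintype V] in
-- Each triple of the interleaved list consists of one inserted vertex u and two consecutive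
-- vertices of the walk, so it is an edge because the walk lies in the link of u. One insertion per
-- two walk vertices explains why walks with an even number of interior vertices are wanted.
lemma tight_interleave {us as : List V} {h : ℕ} {x y p q : V} (h1 : us.length = h + 1)
    (h2 : as.length = 2 * h)
    (hc : ∀ u ∈ us, List.IsChain (T.adj u) (x :: y :: (as ++ [p, q]))) :
    T.Tight (x :: y :: (interleave us as ++ [p, q])) := by
  induction h generalizing us as x y with
  | zero =>
    have e : as = [] := List.length_eq_zero_iff.1 h2
    subst e
    match us, h1 with
    | [u], _ =>
      have := hc u (by simp)
      simp only [List.nil_append, List.isChain_cons_cons] at this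
      simp only [interleave, List.cons_append, List.nil_append, tight_cons3, tight_pair, and_true]
      exact ⟨rot this.1, T.swap12 this.2.1, this.2.2.1⟩
  | succ h ih =>
    match us, as, h1, h2 with
    | u :: us, a :: a' :: as, h1, h2 =>
      have h0 := hc u (by simp)
      simp only [List.cons_append, List.isChain_cons_cons] at h0
      simp only [interleave, List.length_cons, List.cons_append, tight_cons3] at *
      refine ⟨rot h0.1, T.swap12 h0.2.1, h0.2.2.1, ih (by omega) (by omega) fun w hw => ?_⟩
      have := hc w (by simp [hw])
      simp only [List.isChain_cons_cons] at this
      simpa [List.isChain_cons_cons] using this.2.2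

lemma lcnt_meet_le' (k : ℕ) (S : Finset V) {κ : ℝ} (hS : (S.card : ℝ) ≤ κ * Fintype.card V) :
    lcnt k (fun l => ∃ v ∈ l, v ∈ S) ≤ k * κ * (Fintype.card V : ℝ) ^ k := by
  refine (lcnt_meet_le k S).trans ?_
  rcases k with _ | k
  · simp
  · simp only [add_tsub_cancel_right]
    calc ((k + 1 : ℕ) : ℝ) * S.card * (Fintype.card V : ℝ) ^ k
        ≤ ((k + 1 : ℕ) : ℝ) * (κ * Fintype.card V) * (Fintype.card V : ℝ) ^ k := by gcongr
      _ = _ := by ring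

/-- Two pairs lying in many common restricted links are joined by many tight walks. -/
lemma RobustLinks.half_connect (hR : RobustLinks T α μ β h Y) (hβ : 0 < β) {η : ℝ} (hη : 0 < η)
    {B : Finset V} (hB : (B.card : ℝ) ≤ β / (4 * h + 4) * Fintype.card V) {x y p q : V}
    (hu : η * Fintype.card V ≤ cnt (fun u => u ∉ B ∧ lk T Y u x y ∧ lk T Y u p q)) :
    (η * β / 4) ^ (h + 2) * (Fintype.card V : ℝ) ^ (3 * h + 1) ≤
      lcnt (3 * h + 1) (fun l => (∀ v ∈ l, v ∉ B) ∧ T.Tight (x :: y :: (l ++ [p, q]))) := by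
  set n : ℝ := (Fintype.card V : ℝ) with hn
  have hn0 : 0 < n := hR.pos
  set c := η * β / 4 with hc
  have hc0 : 0 < c := by positivity
  set U : V → Prop := fun u => u ∉ B ∧ lk T Y u x y ∧ lk T Y u p q with hU
  set P : V → List V → Prop := fun u a =>
    (List.IsChain (lk T Y u) (y :: (a ++ [p]))) ∧ ¬ ∃ v ∈ a, v ∈ B with hP
  have hwalk : ∀ u, U u → β / 2 * n ^ (2 * h) ≤ lcnt (2 * h) (P u) := by
    intro u hu
    have h1 := hR.walks u y hu.2.1.2.2 p hu.2.2.2.1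
    rw [walks_eq_lcnt, ← hn] at h1
    have h2 := lcnt_meet_le' (2 * h) B hB
    rw [← hn] at h2
    have h3 := lcnt_sub_le (2 * h) (fun a => List.IsChain (lk T Y u) (y :: (a ++ [p])))
      (fun a => ∃ v ∈ a, v ∈ B)
    have h4 : ((2 * h : ℕ) : ℝ) * (β / (4 * h + 4)) ≤ β / 2 := by
      push_cast
      rw [mul_div_assoc', div_le_div_iff₀ (by positivity) (by positivity)]
      nlinarith
    have h5 : ((2 * h : ℕ) : ℝ) * (β / (4 * h + 4)) * n ^ (2 * h) ≤ β / 2 * n ^ (2 * h) := by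
      gcongr
    linarith
  set S : List V → Finset V := fun a => fil fun u => U u ∧ P u a with hS
  have htot : η * n * (β / 2 * n ^ (2 * h)) ≤
      ∑ a ∈ listsIn (univ : Finset V) (2 * h), ((S a).card : ℝ) := by
    calc η * n * (β / 2 * n ^ (2 * h)) ≤ cnt U * (β / 2 * n ^ (2 * h)) := by gcongr
      _ = ∑ u, ind (U u) * (β / 2 * n ^ (2 * h)) := by rw [cnt_eq_ind, sum_mul]
      _ ≤ ∑ u, ∑ a ∈ listsIn (univ : Finset V) (2 * h), ind (U u ∧ P u a) := by
          refine sum_le_sum fun u _ => ?_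
          by_cases hu : U u
          · simp only [ind_and, ind_of hu, one_mul]
            rw [← lcnt_eq_ind]
            exact hwalk u hu
          · simp [ind_and, ind_of_not hu]
      _ = _ := by
          rw [sum_comm]
          refine sum_congr rfl fun a _ => ?_
          rw [hS, card_fil, cnt_eq_ind]
  -- The walks lying in the restricted links of at least c·n admissible u. For each of them, any h +
  -- 1 of these u, repetitions included, may be inserted.
  set G := (listsIn (univ : Finset V) (2 * h)).filter fun a => c * n ≤ ((S a).card : ℝ) with hG
  have hGc : c * n ^ (2 * h) ≤ G.card := by
    have hle : ∀ a ∈ listsIn (univ : Finset V) (2 * h), ((S a).card : ℝ) ≤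
        n * (if c * n ≤ ((S a).card : ℝ) then (1 : ℝ) else 0) + c * n := by
      intro a _
      split_ifs with h1
      · have : ((S a).card : ℝ) ≤ n := by rw [hn]; exact_mod_cast card_le_univ _
        have : 0 < c * n := by positivity
        linarith
      · push Not at h1; linarith
    have h2 := htot.trans (sum_le_sum hle)
    rw [sum_add_distrib, ← mul_sum, sum_boole, sum_const, card_listsIn, card_univ, nsmul_eq_mul,
      ← hG] at h2
    push_cast at h2
    rw [← hn] at h2
    have h3 : n * (c * n ^ (2 * h)) ≤ n * G.card := by
      have : η * n * (β / 2 * n ^ (2 * h)) = 2 * (n * (c * n ^ (2 * h))) := by rw [hc]; ring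
      nlinarith
    exact le_of_mul_le_mul_left h3 hn0
  have hinj : (G.sigma fun a => listsIn (S a) (h + 1)).card ≤
      (lfil (3 * h + 1) fun l => (∀ v ∈ l, v ∉ B) ∧
        T.Tight (x :: y :: (l ++ [p, q]))).card := by
    refine card_le_card_of_injOn (fun z => interleave z.2 z.1) ?_ ?_
    · rintro ⟨a, us⟩ hz
      simp only [coe_sigma, Set.mem_sigma_iff, mem_coe, mem_listsIn, hG, mem_filter, mem_univ,
        implies_true, and_true, hS, mem_fil] at hz
      obtain ⟨⟨ha, hac⟩, hus, husS⟩ := hz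
      simp only [mem_coe, mem_lfil]
      have hne : us ≠ [] := by intro h0; simp [h0] at hus
      obtain ⟨u0, hu0⟩ := List.exists_mem_of_ne_nil us hne
      refine ⟨length_interleave hus ha, ?_, tight_interleave hus ha fun u hu => ?_⟩
      · intro v hv
        rcases mem_interleave hv with hv | hv
        · exact (husS v hv).1.1
        · intro hvB
          exact (husS u0 hu0).2.2 ⟨v, hv, hvB⟩
      · obtain ⟨⟨_, hxy, hpq⟩, hch, _⟩ := husS u hu
        have hch' : List.IsChain (T.adj u) (y :: (a ++ [p])) := hch.imp fun _ _ hh => hh.1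
        have e : y :: (a ++ [p, q]) = (y :: (a ++ [p])) ++ [q] := by simp
        rw [List.isChain_cons_cons, e]
        refine ⟨hxy.1, hch'.append (by simp) ?_⟩
        intro b hb b' hb'
        rw [← List.cons_append, List.getLast?_concat] at hb
        simp only [Option.mem_def, Option.some.injEq, List.head?_cons] at hb hb'
        subst hb hb'
        exact hpq.1
    · rintro ⟨a, us⟩ hz ⟨a', us'⟩ hz' he
      simp only [coe_sigma, Set.mem_sigma_iff, mem_coe, mem_listsIn, hG, mem_filter, mem_univ,
        implies_true, and_true] at hz hz'
      obtain ⟨e1, e2⟩ := interleave_inj hz.2.1 hz.1.1 hz'.2.1 hz'.1.1 he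
      subst e1 e2
      rfl
  have hlow : c * n ^ (2 * h) * (c * n) ^ (h + 1) ≤
      ((G.sigma fun a => listsIn (S a) (h + 1)).card : ℝ) := by
    rw [card_sigma]
    push_cast
    calc c * n ^ (2 * h) * (c * n) ^ (h + 1) ≤ G.card * (c * n) ^ (h + 1) := by gcongr
      _ = ∑ a ∈ G, (c * n) ^ (h + 1) := by rw [sum_const, nsmul_eq_mul]
      _ ≤ _ := by
          refine sum_le_sum fun a ha => ?_
          rw [card_listsIn]
          push_cast
          have := (mem_filter.1 ha).2
          gcongr
  calc c ^ (h + 2) * n ^ (3 * h + 1) = c * n ^ (2 * h) * (c * n) ^ (h + 1) := by ring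
    _ ≤ _ := hlow
    _ ≤ _ := by
      rw [← card_lfil]
      exact_mod_cast hinj

/-- **Connecting lemma.** Any two connectable pairs are joined by many tight walks. -/
theorem RobustLinks.connect (hR : RobustLinks T α μ β h Y) (hβ : 0 < β) (hα : 0 < α)
    (hμ : 4 * μ ≤ α) {ζ : ℝ} (hζ : 0 < ζ) {B : Finset V}
    (hB : (B.card : ℝ) ≤ min (β / (4 * h + 4)) (α / 4) * Fintype.card V) {x y z w : V}
    (hxy : Conn T Y B ζ x y) (hzw : Conn T Y B ζ z w) :
    ζ ^ 2 * α / 4 * ((ζ ^ 2 * α / 4 * β / 4) ^ (h + 2)) ^ 2 *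
        (Fintype.card V : ℝ) ^ (6 * h + 4) ≤
      lcnt (6 * h + 4) (fun l => (∀ v ∈ l, v ∉ B) ∧ T.Tight (x :: y :: (l ++ [z, w]))) := by
  set n : ℝ := (Fintype.card V : ℝ) with hn
  have hn0 : 0 < n := hR.pos
  set η := ζ ^ 2 * α / 4 with hη
  have hη0 : 0 < η := by positivity
  have hB1 : (B.card : ℝ) ≤ β / (4 * h + 4) * n :=
    hB.trans (mul_le_mul_of_nonneg_right (min_le_left _ _) hn0.le)
  have hB2 : (B.card : ℝ) ≤ α / 4 * n :=
    hB.trans (mul_le_mul_of_nonneg_right (min_le_right _ _) hn0.le)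
  set U : V → V × V → Prop := fun u s => (u ∉ B ∧ lk T Y u x y) ∧ lk T Y u s.1 s.2 with hU
  set W : V → V × V → Prop := fun u s => (u ∉ B ∧ lk T Y u z w) ∧ lk T Y u s.1 s.2 with hW
  set C : V × V → Prop := fun s => ¬ (s.1 ∈ B ∨ s.2 ∈ B) with hC
  have hmeet : cnt (fun s : V × V => s.1 ∈ B ∨ s.2 ∈ B) ≤ α / 2 * n ^ 2 := by
    refine (cnt_or_le _ _).trans ?_
    have e1 : cnt (fun s : V × V => s.1 ∈ B) = B.card * n := by
      rw [cnt_congr (q := fun s : V × V => s.1 ∈ B ∧ s.2 ∈ (univ : Finset V)) (by simp),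
        cnt_mem_prod, card_univ]
    have e2 : cnt (fun s : V × V => s.2 ∈ B) = n * B.card := by
      rw [cnt_congr (q := fun s : V × V => s.1 ∈ (univ : Finset V) ∧ s.2 ∈ B) (by simp),
        cnt_mem_prod, card_univ]
    rw [e1, e2]
    nlinarith
  have hpair : ∀ u v : V, (u ∉ B ∧ lk T Y u x y) → (v ∉ B ∧ lk T Y v z w) →
      α / 2 * n ^ 2 ≤ cnt (fun s => (U u s ∧ W v s) ∧ C s) := by
    intro u v hu hv
    have h1 := hR.common hμ u v
    have h2 := cnt_sub_le (fun s : V × V => lk T Y u s.1 s.2 ∧ lk T Y v s.1 s.2)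
      (fun s : V × V => s.1 ∈ B ∨ s.2 ∈ B)
    have h3 : cnt (fun s : V × V => (lk T Y u s.1 s.2 ∧ lk T Y v s.1 s.2) ∧
        ¬ (s.1 ∈ B ∨ s.2 ∈ B)) ≤ cnt (fun s => (U u s ∧ W v s) ∧ C s) :=
      cnt_mono fun s hs => ⟨⟨⟨hu, hs.1.1⟩, ⟨hv, hs.1.2⟩⟩, hs.2⟩
    linarith
  -- Middle pairs s outside B, weighted by the number of (u, v) such that u sees both x, y and s,
  -- and v sees both z, w and s. Every admissible u and v share many such s, so many s have large
  -- weight, and for these both halves are provided by `RobustLinks.half_connect`.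
  set f : V × V → ℝ := fun s => if C s then cnt (fun u => U u s) * cnt (fun v => W v s) else 0
    with hf
  have hsum : (ζ * n) ^ 2 * (α / 2 * n ^ 2) ≤ ∑ s, f s := by
    have e : ∑ s, f s = ∑ u, ∑ v, cnt (fun s => (U u s ∧ W v s) ∧ C s) := by
      have e1 : ∀ s, f s = ∑ u, ∑ v, ind ((U u s ∧ W v s) ∧ C s) := by
        intro s
        by_cases hs : C s
        · simp only [hf, hs, if_true, and_true, cnt_eq_sum]
          rw [sum_mul_sum]
          refine sum_congr rfl fun u _ => sum_congr rfl fun v _ => ?_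
          by_cases h1 : U u s <;> by_cases h2 : W v s <;> simp [h1, h2, ind]
        · simp [hf, hs, ind]
      simp_rw [e1, cnt_eq_sum]
      rw [sum_comm]
      exact sum_congr rfl fun u _ => sum_comm
    rw [e]
    calc (ζ * n) ^ 2 * (α / 2 * n ^ 2)
        = (ζ * n) * ((ζ * n) * (α / 2 * n ^ 2)) := by ring
      _ ≤ cnt (fun u => u ∉ B ∧ lk T Y u x y) *
          (cnt (fun v => v ∉ B ∧ lk T Y v z w) * (α / 2 * n ^ 2)) := by
          have h1 : ζ * n ≤ _ := hxy
          have h2 : ζ * n ≤ _ := hzw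
          have h3 := cnt_nonneg (fun u => u ∉ B ∧ lk T Y u x y)
          gcongr
      _ ≤ _ := by
          rw [mul_comm]
          refine mul_cnt_le_sum _ (fun u => sum_nonneg fun v _ => cnt_nonneg _) fun u hu => ?_
          rw [mul_comm]
          exact mul_cnt_le_sum _ (fun v => cnt_nonneg _) fun v hv => hpair u v hu hv
  have hf1 : ∀ s, f s ≤ n ^ 2 := by
    intro s
    simp only [hf]
    split_ifs
    · rw [sq]
      exact mul_le_mul (cnt_le_card _) (cnt_le_card _) (cnt_nonneg _) hn0.le
    · positivity
  have hav := sum_le_cnt f (M := n ^ 2) (c := η * n ^ 2) (by positivity) hf1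
  set D : Finset (V × V) := fil fun s => η * n ^ 2 ≤ f s with hD
  have hDc : η * n ^ 2 ≤ D.card := by
    rw [← card_fil, ← hD, Fintype.card_prod] at hav
    push_cast at hav
    rw [← hn] at hav
    have e2 : (ζ * n) ^ 2 * (α / 2 * n ^ 2) = 2 * (η * n ^ 2) * n ^ 2 := by rw [hη]; ring
    have h3 : n ^ 2 * (η * n ^ 2) ≤ n ^ 2 * D.card := by nlinarith
    exact le_of_mul_le_mul_left h3 (by positivity)
  have hDmem : ∀ s ∈ D, C s ∧ η * n ≤ cnt (fun u => U u s) ∧ η * n ≤ cnt (fun u => W u s) := by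
    intro s hs
    have hs' := mem_fil.1 hs
    simp only [hf] at hs'
    split_ifs at hs' with hCs
    · have a1 : cnt (fun u => U u s) ≤ n := cnt_le_card _
      have a2 : cnt (fun u => W u s) ≤ n := cnt_le_card _
      have a3 := cnt_nonneg (fun u => U u s)
      have a4 := cnt_nonneg (fun u => W u s)
      refine ⟨hCs, ?_, ?_⟩
      · refine le_of_mul_le_mul_right (a := n) ?_ hn0
        nlinarith
      · refine le_of_mul_le_mul_right (a := n) ?_ hn0
        nlinarith
    · have : 0 < η * n ^ 2 := by positivity
      linarith
  set θ := (η * β / 4) ^ (h + 2) with hθ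
  have hθ0 : 0 < θ := by positivity
  set L1 : V × V → Finset (List V) := fun s => lfil (3 * h + 1) fun l =>
    (∀ v ∈ l, v ∉ B) ∧ T.Tight (x :: y :: (l ++ [s.1, s.2])) with hL1
  set L2 : V × V → Finset (List V) := fun s => lfil (3 * h + 1) fun l =>
    (∀ v ∈ l, v ∉ B) ∧ T.Tight (s.1 :: s.2 :: (l ++ [z, w])) with hL2
  have hL1c : ∀ s ∈ D, θ * n ^ (3 * h + 1) ≤ (L1 s).card := by
    intro s hs
    have := hR.half_connect hβ hη0 hB1 (x := x) (y := y) (p := s.1) (q := s.2)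
      ((hDmem s hs).2.1.trans (cnt_mono fun u hu => ⟨hu.1.1, hu.1.2, hu.2⟩))
    exact this
  have hL2c : ∀ s ∈ D, θ * n ^ (3 * h + 1) ≤ (L2 s).card := by
    intro s hs
    have := hR.half_connect hβ hη0 hB1 (x := s.1) (y := s.2) (p := z) (q := w)
      ((hDmem s hs).2.2.trans (cnt_mono fun u hu => ⟨hu.1.1, hu.2, hu.1.2⟩))
    exact this
  have hinj : (D.sigma fun s => L1 s ×ˢ L2 s).card ≤
      (lfil (6 * h + 4) fun l => (∀ v ∈ l, v ∉ B) ∧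
        T.Tight (x :: y :: (l ++ [z, w]))).card := by
    refine card_le_card_of_injOn (fun t => t.2.1 ++ t.1.1 :: t.1.2 :: t.2.2) ?_ ?_
    · rintro ⟨⟨p, q⟩, l1, l2⟩ ht
      simp only [coe_sigma, Set.mem_sigma_iff, mem_coe, hL1, hL2, mem_product, mem_lfil] at ht
      obtain ⟨hs, ⟨k1, v1, t1⟩, k2, v2, t2⟩ := ht
      have hCs := (hDmem _ hs).1
      simp only [hC, not_or] at hCs
      simp only [mem_coe, mem_lfil]
      refine ⟨by simp [k1, k2]; ring, ?_, ?_⟩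
      · intro v hv
        simp only [List.mem_append, List.mem_cons] at hv
        rcases hv with hv | rfl | rfl | hv
        · exact v1 v hv
        · exact hCs.1
        · exact hCs.2
        · exact v2 v hv
      · have e : x :: y :: (l1 ++ p :: q :: l2 ++ [z, w]) =
          (x :: y :: l1) ++ p :: q :: (l2 ++ [z, w]) := by simp
        rw [e, tight_overlap]
        exact ⟨by simpa using t1, t2⟩
    · rintro ⟨⟨p, q⟩, l1, l2⟩ ht ⟨⟨p', q'⟩, l1', l2'⟩ ht' he
      simp only [coe_sigma, Set.mem_sigma_iff, mem_coe, hL1, hL2, mem_product, mem_lfil] at ht ht'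
      obtain ⟨e1, e2⟩ := List.append_inj he (ht.2.1.1.trans ht'.2.1.1.symm)
      simp only [List.cons.injEq] at e2
      obtain ⟨rfl, rfl, rfl⟩ := e2
      subst e1
      rfl
  have hlow : η * n ^ 2 * (θ * n ^ (3 * h + 1)) ^ 2 ≤
      ((D.sigma fun s => L1 s ×ˢ L2 s).card : ℝ) := by
    rw [card_sigma]
    push_cast
    calc η * n ^ 2 * (θ * n ^ (3 * h + 1)) ^ 2 ≤ D.card * (θ * n ^ (3 * h + 1)) ^ 2 := by gcongr
      _ = ∑ s ∈ D, (θ * n ^ (3 * h + 1)) ^ 2 := by rw [sum_const, nsmul_eq_mul]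
      _ ≤ _ := by
          refine sum_le_sum fun s hs => ?_
          rw [card_product, sq]
          push_cast
          have h1 := hL1c s hs
          have h2 := hL2c s hs
          gcongr
  calc η * θ ^ 2 * n ^ (6 * h + 4) = η * n ^ 2 * (θ * n ^ (3 * h + 1)) ^ 2 := by ring
    _ ≤ _ := hlow
    _ ≤ _ := by
      rw [← card_lfil]
      exact_mod_cast hinj

end Links

/-! ### Complete blow-ups in dense relations. -/

section BlowUp

lemma cnt_forall {X : Type v} [Fintype X] {ι : Type*} [Fintype ι] [DecidableEq ι]
    (p : X → Prop) : cnt (fun f : ι → X => ∀ j, p (f j)) = cnt p ^ Fintype.card ι := by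
  have : fil (fun f : ι → X => ∀ j, p (f j)) = Fintype.piFinset fun _ => fil p := by
    ext f; simp [mem_fil, Fintype.mem_piFinset]
  rw [← card_fil, this, Fintype.card_piFinset, prod_const, card_univ, ← card_fil]
  push_cast
  rfl

/-- Convexity of the t-th power: the number of t-tuples over w is the t-th power of the degree of w,
so it is smallest on average when all degrees are equal. -/
lemma cnt_power {W : Type*} {X : Type v} [Fintype W] [Fintype X] (A : W → X → Prop) {c : ℝ}
    (hc : 0 ≤ c) (hX : 0 < Fintype.card X) (t : ℕ)
    (h : c * (Fintype.card W * Fintype.card X) ≤ cnt (fun z : W × X => A z.1 z.2)) :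
    c ^ t * (Fintype.card W * (Fintype.card X : ℝ) ^ t) ≤
      cnt (fun z : W × (Fin t → X) => ∀ j, A z.1 (z.2 j)) := by
  rw [cnt_prod (fun (w : W) (f : Fin t → X) => ∀ j, A w (f j))]
  rw [cnt_prod A] at h
  simp_rw [cnt_forall, Fintype.card_fin]
  rcases t with _ | t
  · simp
  rcases Nat.eq_zero_or_pos (Fintype.card W) with hW | hW
  · simp only [hW, Nat.cast_zero, zero_mul, mul_zero]
    exact sum_nonneg fun _ _ => pow_nonneg (cnt_nonneg _) _
  have hW' : (0 : ℝ) < Fintype.card W := by exact_mod_cast hW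
  have h1 := pow_sum_div_card_le_sum_pow (s := (univ : Finset W)) (f := fun w => cnt (A w))
    (fun _ _ => cnt_nonneg _) t
  rw [card_univ] at h1
  refine le_trans ?_ h1
  rw [le_div_iff₀ (by positivity)]
  calc c ^ (t + 1) * (Fintype.card W * (Fintype.card X : ℝ) ^ (t + 1)) * (Fintype.card W : ℝ) ^ t
      = (c * (Fintype.card W * Fintype.card X)) ^ (t + 1) := by ring
    _ ≤ _ := by gcongr

/-- **Blow-up lemma.** A dense `k`-partite relation contains many complete blow-ups. -/
theorem exists_blowup (k t : ℕ) {c : ℝ} (hc : 0 < c) :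
    ∃ c' : ℝ, 0 < c' ∧ ∀ (X : Type v) [Fintype X], 0 < Fintype.card X →
      ∀ A : (Fin k → X) → Prop, c * (Fintype.card X : ℝ) ^ k ≤ cnt A →
        c' * (Fintype.card X : ℝ) ^ (k * t) ≤
          cnt (fun Φ : Fin k → Fin t → X => ∀ f : Fin k → Fin t, A fun a => Φ a (f a)) := by
  induction k generalizing c with
  | zero =>
    refine ⟨1, one_pos, fun X _ _ A hA => ?_⟩
    simp only [pow_zero, mul_one, Nat.zero_mul] at *
    obtain ⟨f, hf⟩ := exists_of_cnt_pos (lt_of_lt_of_le hc hA)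
    rw [cnt_congr (q := fun _ => True) fun Φ => iff_true_intro fun g => by
      rwa [Subsingleton.elim (fun a => Φ a (g a)) f], cnt_true]
    simp
  | succ k ih =>
    obtain ⟨c', hc', h'⟩ := ih (c := c ^ t / 2) (by positivity)
    refine ⟨c ^ t / 2 * c', by positivity, fun X _ hX A hA => ?_⟩
    set n : ℝ := (Fintype.card X : ℝ) with hn
    have hn0 : 0 < n := by rw [hn]; exact_mod_cast hX
    have h1 : cnt A = cnt (fun z : (Fin k → X) × X => A (Fin.cons z.2 z.1)) :=
      (cnt_equiv ((Equiv.prodComm _ _).trans (Fin.consEquiv fun _ => X)) A).symm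
    have hcard : (Fintype.card (Fin k → X) : ℝ) = n ^ k := by simp [hn]
    -- Coordinate 0 is replaced by a t-tuple first. Averaging then yields many tuples g, each
    -- compatible as a whole with many w, and the induction hypothesis blows up the remaining
    -- coordinates of that relation on w.
    have h2 := cnt_power (fun (w : Fin k → X) (x : X) => A (Fin.cons x w)) hc.le hX t
      (by rw [← h1, hcard, ← hn, ← pow_succ]; exact hA)
    rw [hcard, ← hn, cnt_prod (fun (w : Fin k → X) (g : Fin t → X) => ∀ j, A (Fin.cons (g j) w)),
      sum_cnt_comm] at h2
    have h3 := sum_le_cnt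
      (fun g : Fin t → X => cnt fun w : Fin k → X => ∀ j, A (Fin.cons (g j) w))
      (M := n ^ k) (c := c ^ t / 2 * n ^ k) (by positivity)
      (fun g => by simpa [hcard] using cnt_le_card (fun w : Fin k → X => ∀ j, A (Fin.cons (g j) w)))
    have hcard' : (Fintype.card (Fin t → X) : ℝ) = n ^ t := by simp [hn]
    rw [hcard'] at h3
    set G : (Fin t → X) → Prop := fun g =>
      c ^ t / 2 * n ^ k ≤ cnt fun w : Fin k → X => ∀ j, A (Fin.cons (g j) w) with hG
    have h4 : c ^ t / 2 * n ^ t ≤ cnt G := by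
      refine le_of_mul_le_mul_left (a := n ^ k) ?_ (by positivity)
      linarith
    have h5 : cnt (fun Φ : Fin (k + 1) → Fin t → X => ∀ f : Fin (k + 1) → Fin t,
        A fun a => Φ a (f a)) = ∑ g : Fin t → X, cnt (fun Ψ : Fin k → Fin t → X =>
          ∀ f : Fin k → Fin t, ∀ j, A (Fin.cons (g j) fun a => Ψ a (f a))) := by
      rw [← cnt_prod (fun (g : Fin t → X) (Ψ : Fin k → Fin t → X) =>
          ∀ f : Fin k → Fin t, ∀ j, A (Fin.cons (g j) fun a => Ψ a (f a))),
        ← cnt_equiv (Fin.consEquiv fun _ => Fin t → X)]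
      refine cnt_congr fun z => ?_
      constructor
      · intro hz f j
        have := hz (Fin.cons j f)
        convert this using 1
        funext a
        refine Fin.cases ?_ (fun i => ?_) a <;> simp [Fin.consEquiv]
      · intro hz f
        have := hz (fun i => f i.succ) (f 0)
        convert this using 1
        funext a
        refine Fin.cases ?_ (fun i => ?_) a <;> simp [Fin.consEquiv]
    rw [h5]
    calc c ^ t / 2 * c' * n ^ ((k + 1) * t) = (c' * n ^ (k * t)) * (c ^ t / 2 * n ^ t) := by ring
      _ ≤ (c' * n ^ (k * t)) * cnt G := by gcongr
      _ ≤ _ := by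
        refine mul_cnt_le_sum _ (fun g => cnt_nonneg _) fun g hg => ?_
        refine (h' X hX (fun w => ∀ j, A (Fin.cons (g j) w)) hg).trans (cnt_mono fun Ψ hΨ => hΨ)

/-- A family of functions is not much larger than the family of its restrictions. -/
lemma cnt_restrict_le {ι κ : Type*} {X : Type v} [Fintype ι] [Fintype κ] [Fintype X]
    [DecidableEq ι] [DecidableEq κ] (e : κ → ι)
    (he : Function.Injective e) {p : (ι → X) → Prop} {q : (κ → X) → Prop}
    (h : ∀ Φ, p Φ → q (Φ ∘ e)) :
    cnt p ≤ (Fintype.card X : ℝ) ^ (Fintype.card ι - Fintype.card κ) * cnt q := by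
  refine cnt_fiber_le (fun Φ => Φ ∘ e) h fun g => ?_
  have hc : Fintype.card {i // i ∉ Set.range e} = Fintype.card ι - Fintype.card κ := by
    rw [Fintype.card_subtype_compl, ← Set.card_range_of_injective he]
  have h1 : cnt (fun Φ : ι → X => Φ ∘ e = g) ≤
      cnt (fun _ : {i // i ∉ Set.range e} → X => True) := by
    refine cnt_le_of_injOn (fun Φ i => Φ i.1) (fun _ _ => trivial) ?_
    intro Φ Ψ hΦ hΨ hh
    funext i
    by_cases hi : i ∈ Set.range e
    · obtain ⟨j, rfl⟩ := hi
      exact congrFun (hΦ.trans hΨ.symm) j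
    · exact congrFun hh ⟨i, hi⟩
  refine h1.trans (le_of_eq ?_)
  rw [cnt_true, Fintype.card_fun, hc]
  push_cast
  rfl

lemma lcnt_eq_cnt {V : Type u} [Fintype V] (k : ℕ) (p : List V → Prop) :
    lcnt k p = cnt (fun g : Fin k → V => p (List.ofFn g)) := by
  induction k generalizing p with
  | zero =>
    rw [lcnt_zero, cnt_eq_sum]
    simp
  | succ k ih =>
    rw [lcnt_succ]
    simp_rw [ih]
    rw [← cnt_prod (fun (a : V) (g : Fin k → V) => p (a :: List.ofFn g)),
      ← cnt_equiv (Fin.consEquiv fun _ => V)]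
    exact cnt_congr fun z => by simp [Fin.consEquiv, List.ofFn_succ]

end BlowUp

/-! ### Edges useful for absorption: weighting by inverse codegrees. -/

section Rich

variable {V : Type u} [Fintype V]

lemma cnt3_eq_sum (p : V → V → V → Prop) :
    cnt (fun z : V × V × V => p z.1 z.2.1 z.2.2) = ∑ a, ∑ b, ∑ c, ind (p a b c) := by
  rw [cnt_eq_ind, Fintype.sum_prod_type]
  exact sum_congr rfl fun a _ => Fintype.sum_prod_type _

lemma sum3_rot (f : V → V → V → ℝ) : ∑ a, ∑ b, ∑ c, f a b c = ∑ a, ∑ b, ∑ c, f b c a := by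
  rw [sum_comm]
  calc ∑ b, ∑ a, ∑ c, f a b c = ∑ b, ∑ c, ∑ a, f a b c := sum_congr rfl fun _ _ => sum_comm
    _ = ∑ c, ∑ b, ∑ a, f a b c := sum_comm
    _ = ∑ c, ∑ a, ∑ b, f a b c := sum_congr rfl fun _ _ => sum_comm
    _ = _ := rfl

lemma cnt3_rot (p : V → V → V → Prop) :
    cnt (fun z : V × V × V => p z.1 z.2.1 z.2.2) =
      cnt (fun z : V × V × V => p z.2.1 z.2.2 z.1) := by
  rw [cnt3_eq_sum, cnt3_eq_sum (fun a b c => p b c a)]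
  exact sum3_rot fun a b c => ind (p a b c)

lemma cnt3_swap (p : V → V → V → Prop) :
    cnt (fun z : V × V × V => p z.1 z.2.1 z.2.2) =
      cnt (fun z : V × V × V => p z.2.1 z.1 z.2.2) := by
  rw [cnt3_eq_sum, cnt3_eq_sum (fun a b c => p b a c), sum_comm]

variable (T : TripleSystem V) (Y : V → Finset V)

/-- The edge `a, b, c` crosses none of the sets `Y a`, `Y b`, `Y c`. -/
def Flat (a b c : V) : Prop :=
  T.adj a b c ∧ (b ∈ Y a ↔ c ∈ Y a) ∧ (a ∈ Y b ↔ c ∈ Y b) ∧ (a ∈ Y c ↔ b ∈ Y c)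

variable {T Y}

omit [Fintype V] in
lemma Flat.swap12 {a b c : V} (h : Flat T Y a b c) : Flat T Y b a c :=
  ⟨T.swap12 h.1, h.2.2.1, h.2.1, h.2.2.2.symm⟩

omit [Fintype V] in
lemma Flat.swap23 {a b c : V} (h : Flat T Y a b c) : Flat T Y a c b :=
  ⟨T.swap23 h.1, h.2.1.symm, h.2.2.2, h.2.2.1⟩

omit [Fintype V] in
lemma Flat.rot {a b c : V} (h : Flat T Y a b c) : Flat T Y b c a := h.swap12.swap23

variable {α μ β : ℝ} {h : ℕ}

lemma RobustLinks.cnt_cross_le (hR : RobustLinks T α μ β h Y) :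
    cnt (fun z : V × V × V => T.adj z.1 z.2.1 z.2.2 ∧ ¬ (z.2.1 ∈ Y z.1 ↔ z.2.2 ∈ Y z.1)) ≤
      2 * μ * (Fintype.card V : ℝ) ^ 3 := by
  rw [cnt_prod (fun a (z : V × V) => T.adj a z.1 z.2 ∧ ¬ (z.1 ∈ Y a ↔ z.2 ∈ Y a))]
  have h1 : ∀ a, cnt (fun z : V × V => T.adj a z.1 z.2 ∧ ¬ (z.1 ∈ Y a ↔ z.2 ∈ Y a)) ≤
      2 * μ * (Fintype.card V : ℝ) ^ 2 := by
    intro a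
    have h2 := (hR.part a).cross
    have h3 := ec_comm (L := T.adj a) (fun _ _ hh => T.swap23 hh) (Y a) (Y a)ᶜ
    have h4 : cnt (fun z : V × V => T.adj a z.1 z.2 ∧ ¬ (z.1 ∈ Y a ↔ z.2 ∈ Y a)) ≤
        ec (T.adj a) (Y a) (Y a)ᶜ + ec (T.adj a) (Y a)ᶜ (Y a) := by
      rw [ec_eq_cnt, ec_eq_cnt]
      refine le_trans (cnt_mono fun z hz => ?_) (cnt_or_le _ _)
      simp only [mem_compl]
      tauto
    linarith
  refine (sum_le_sum fun a _ => h1 a).trans (le_of_eq ?_)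
  rw [sum_const, card_univ, nsmul_eq_mul]
  ring

/-- Each of the three vertices of an edge may be the one whose set is crossed, and each case loses
at most 2μn³ ordered triples, which the surplus α absorbs. -/
lemma RobustLinks.le_cnt_flat (hR : RobustLinks T α μ β h Y) (hμ : 6 * μ ≤ α) :
    5 / 9 * (Fintype.card V : ℝ) ^ 3 ≤
      cnt (fun z : V × V × V => Flat T Y z.1 z.2.1 z.2.2) := by
  set n : ℝ := (Fintype.card V : ℝ) with hn
  set X : V → V → V → Prop := fun a b c => T.adj a b c ∧ ¬ (b ∈ Y a ↔ c ∈ Y a) with hX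
  have h1 : (5 / 9 + α) * n ^ 3 ≤ cnt (fun z : V × V × V => T.adj z.1 z.2.1 z.2.2) := by
    rw [cnt_prod (fun a (z : V × V) => T.adj a z.1 z.2)]
    have h2 : ∀ a, (5 / 9 + α) * n ^ 2 ≤ cnt (fun z : V × V => T.adj a z.1 z.2) := fun a => by
      refine (hR.dens a).trans ?_
      rw [ec_eq_cnt]
      exact cnt_mono fun z hz => hz.2
    calc (5 / 9 + α) * n ^ 3 = ∑ _a : V, (5 / 9 + α) * n ^ 2 := by
          rw [sum_const, card_univ, nsmul_eq_mul, ← hn]; ring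
      _ ≤ _ := sum_le_sum fun a _ => h2 a
  have hX1 : cnt (fun z : V × V × V => X z.1 z.2.1 z.2.2) ≤ 2 * μ * n ^ 3 := hR.cnt_cross_le
  have hX2 := hX1
  rw [cnt3_swap X] at hX2
  have hX3 := hX1
  rw [cnt3_rot X, cnt3_rot (fun a b c => X b c a)] at hX3
  have h3 : cnt (fun z : V × V × V => T.adj z.1 z.2.1 z.2.2) ≤
      cnt (fun z : V × V × V => Flat T Y z.1 z.2.1 z.2.2) +
      (cnt (fun z : V × V × V => X z.1 z.2.1 z.2.2) +
      (cnt (fun z : V × V × V => X z.2.1 z.1 z.2.2) +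
      cnt (fun z : V × V × V => X z.2.2 z.1 z.2.1))) := by
    refine le_trans ?_ ((cnt_or_le _ _).trans (add_le_add le_rfl
      ((cnt_or_le _ _).trans (add_le_add le_rfl (cnt_or_le _ _)))))
    refine cnt_mono fun z hz => ?_
    have e1 := T.swap12 hz
    have e2 := rot' hz
    simp only [Flat, hX]
    tauto
  have : 6 * μ * n ^ 3 ≤ α * n ^ 3 := by gcongr
  linarith

variable (T Y)

/-- The codegree of a pair with respect to non-crossing edges. -/
noncomputable def codeg (a b : V) : ℝ := cnt (Flat T Y a b)

/-- The number of common neighbours of two pairs which share `b`. -/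
noncomputable def codeg2 (a b c d : V) : ℝ := cnt (fun z => Flat T Y a b z ∧ Flat T Y c d z)

/-- Sum of the inverse codegrees of the three pairs. -/
noncomputable def invdeg (a b c : V) : ℝ := 1 / codeg T Y a b + 1 / codeg T Y b c + 1 / codeg T Y a c

variable {T Y}

lemma codeg_nonneg (a b : V) : 0 ≤ codeg T Y a b := cnt_nonneg _

lemma codeg_pos {a b c : V} (hf : Flat T Y a b c) : 0 < codeg T Y a b := by
  unfold codeg cnt
  exact_mod_cast card_pos.2 ⟨c, by simpa using hf⟩

lemma sum_ind_inv_le (f : V → V → V → Prop) :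
    ∑ a, ∑ b, ∑ c, ind (f a b c) * (1 / cnt (f a b)) ≤ (Fintype.card V : ℝ) ^ 2 := by
  have h1 : ∀ a b, ∑ c, ind (f a b c) * (1 / cnt (f a b)) ≤ 1 := by
    intro a b
    rw [← sum_mul, ← cnt_eq_ind]
    rcases (cnt_nonneg (f a b)).eq_or_lt with h0 | h0
    · rw [← h0]; norm_num
    · rw [mul_one_div, div_self h0.ne']
  calc _ ≤ ∑ _a : V, ∑ _b : V, (1 : ℝ) := sum_le_sum fun a _ => sum_le_sum fun b _ => h1 a b
    _ = _ := by simp [card_univ]; ring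

/-- For one fixed position of the pair, summing the inverse codegree over the completions of the
pair gives 1 or 0. There are n² ordered pairs and three positions. -/
lemma sum_invdeg_le :
    ∑ a, ∑ b, ∑ c, ind (Flat T Y a b c) * invdeg T Y a b c ≤ 3 * (Fintype.card V : ℝ) ^ 2 := by
  have h1 := sum_ind_inv_le (Flat T Y)
  have h2 : ∑ a, ∑ b, ∑ c, ind (Flat T Y a b c) * (1 / codeg T Y b c) ≤
      (Fintype.card V : ℝ) ^ 2 := by
    rw [sum3_rot (fun a b c => ind (Flat T Y a b c) * (1 / codeg T Y b c)), sum3_rot]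
    refine le_trans (le_of_eq ?_) h1
    refine sum_congr rfl fun a _ => sum_congr rfl fun b _ => sum_congr rfl fun c _ => ?_
    rw [show Flat T Y c a b ↔ Flat T Y a b c from ⟨fun hh => hh.rot, fun hh => hh.rot.rot⟩]
    rfl
  have h3 : ∑ a, ∑ b, ∑ c, ind (Flat T Y a b c) * (1 / codeg T Y a c) ≤
      (Fintype.card V : ℝ) ^ 2 := by
    have e : ∑ a, ∑ b, ∑ c, ind (Flat T Y a b c) * (1 / codeg T Y a c) =
        ∑ a, ∑ c, ∑ b, ind (Flat T Y a b c) * (1 / codeg T Y a c) :=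
      sum_congr rfl fun a _ => sum_comm
    rw [e]
    refine le_trans (le_of_eq ?_) h1
    refine sum_congr rfl fun a _ => sum_congr rfl fun b _ => sum_congr rfl fun c _ => ?_
    rw [show Flat T Y a c b ↔ Flat T Y a b c from ⟨fun hh => hh.swap23, fun hh => hh.swap23⟩]
    rfl
  have h4 : ∑ a, ∑ b, ∑ c, ind (Flat T Y a b c) * invdeg T Y a b c =
      ∑ a, ∑ b, ∑ c, ind (Flat T Y a b c) * (1 / codeg T Y a b) +
      ∑ a, ∑ b, ∑ c, ind (Flat T Y a b c) * (1 / codeg T Y b c) +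
      ∑ a, ∑ b, ∑ c, ind (Flat T Y a b c) * (1 / codeg T Y a c) := by
    simp only [← sum_add_distrib, invdeg]
    refine sum_congr rfl fun a _ => sum_congr rfl fun b _ => sum_congr rfl fun c _ => by ring
  have h1' : ∑ a, ∑ b, ∑ c, ind (Flat T Y a b c) * (1 / codeg T Y a b) ≤
      (Fintype.card V : ℝ) ^ 2 := h1
  linarith

/-- Both p and s are at most m - q, and 1/q + 2/(m - q) has minimum (1 + √2)²/m = (3 + 2√2)/m >
5.82/m, attained at q = (√2 - 1)m. The slack 1/300 in m costs the step from 5.82 to 5.8. -/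
lemma inv_numeric {p q s n : ℝ} (hp : 0 < p) (hq : 0 < q) (hs : 0 < s) (hn : 0 < n)
    (h1 : q + p ≤ (1 + 1 / 300) * n) (h2 : q + s ≤ (1 + 1 / 300) * n) :
    5.8 / n ≤ 1 / p + 1 / q + 1 / s := by
  set m := (1 + 1 / 300) * n with hm
  have hmq : 0 < m - q := by linarith
  have hm0 : 0 < m := by linarith
  have e1 : 1 / (m - q) ≤ 1 / p := one_div_le_one_div_of_le hp (by linarith)
  have e2 : 1 / (m - q) ≤ 1 / s := one_div_le_one_div_of_le hs (by linarith)
  have e3 : 5.82 / m ≤ 1 / q + 2 / (m - q) := by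
    rw [div_add_div _ _ hq.ne' hmq.ne', div_le_div_iff₀ hm0 (by positivity)]
    -- The constant approximates the vertex 4.82/11.64 of the quadratic 5.82q² - 4.82qm + m², which
    -- is what has to be nonnegative.
    nlinarith [sq_nonneg (q - 0.41408 * m), mul_pos hm0 hm0]
  have e4 : 5.8 / n ≤ 5.82 / m := by
    rw [div_le_div_iff₀ hn hm0, hm]
    nlinarith
  have e5 : 2 / (m - q) = 1 / (m - q) + 1 / (m - q) := by ring
  linarith

variable (T Y)

/-- The pair `b, c` has many common neighbours with `x, b` and with `x, c`. -/
def RichAt (x b c : V) : Prop :=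
  1 / 300 * (Fintype.card V : ℝ) ≤ codeg2 T Y x b b c ∧
    1 / 300 * (Fintype.card V : ℝ) ≤ codeg2 T Y x c b c

/-- Some pair of the triple lies in the restricted link of the third vertex. -/
def LinkTriple (a b c : V) : Prop := lk T Y a b c ∨ lk T Y b c a ∨ lk T Y c a b

variable {T Y}

lemma codeg_add_le {a b c d : V} (hc : codeg2 T Y a b c d < 1 / 300 * (Fintype.card V : ℝ)) :
    codeg T Y a b + codeg T Y c d ≤ (1 + 1 / 300) * (Fintype.card V : ℝ) := by
  have h1 := cnt_split (Flat T Y a b) (Flat T Y c d)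
  have h2 := cnt_split (fun _ : V => True) (Flat T Y c d)
  rw [cnt_true] at h2
  have h3 : cnt (fun z => Flat T Y a b z ∧ ¬ Flat T Y c d z) ≤
    cnt (fun z => True ∧ ¬ Flat T Y c d z) := cnt_mono fun z hz => ⟨trivial, hz.2⟩
  have h4 : cnt (fun z => True ∧ Flat T Y c d z) = codeg T Y c d := cnt_congr fun z => by simp
  unfold codeg2 at hc
  unfold codeg at *
  linarith

lemma codeg2_comm (a b c d : V) : codeg2 T Y a b c d = codeg2 T Y c d a b :=
  cnt_congr fun _ => and_comm

lemma codeg2_swap (a b c d : V) : codeg2 T Y a b c d = codeg2 T Y b a c d :=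
  cnt_congr fun _ => and_congr_left fun _ => ⟨Flat.swap12, Flat.swap12⟩

lemma codeg2_swap' (a b c d : V) : codeg2 T Y a b c d = codeg2 T Y a b d c :=
  cnt_congr fun _ => and_congr_right fun _ => ⟨Flat.swap12, Flat.swap12⟩

/-- If no pair of the edge lies in the restricted link of the third vertex, flatness confines the
third vertices of each pair to the complement of some Y x, so all three codegrees are at most n/3
and the weight is at least 9/n. Otherwise no pair shares many common neighbours with both other
pairs. Then at least two of the three pairs of pairs have small intersection, so two codegree sums
are at most about n, and `inv_numeric` applies. -/
lemma RobustLinks.le_invdeg (hR : RobustLinks T α μ β h Y) {a b c : V} (hf : Flat T Y a b c)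
    (hbad : ¬ (LinkTriple T Y a b c ∧
      (RichAt T Y a b c ∨ RichAt T Y b c a ∨ RichAt T Y c a b))) :
    5.8 / (Fintype.card V : ℝ) ≤ invdeg T Y a b c := by
  set n : ℝ := (Fintype.card V : ℝ) with hn
  have hn0 : 0 < n := hR.pos
  have p1 := codeg_pos hf
  have p2 : 0 < codeg T Y b c := codeg_pos hf.rot
  have p3 : 0 < codeg T Y a c := codeg_pos hf.swap23
  unfold invdeg
  by_cases hl : LinkTriple T Y a b c
  · have hr : ¬ (RichAt T Y a b c ∨ RichAt T Y b c a ∨ RichAt T Y c a b) :=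
      fun hh => hbad ⟨hl, hh⟩
    simp only [RichAt, not_or, not_and_or, not_le, ← hn] at hr
    obtain ⟨r1, r2, r3⟩ := hr
    rw [codeg2_comm b c c a, codeg2_swap c a] at r2
    rw [codeg2_swap b a] at r2
    rw [codeg2_swap' a b c a] at r2
    rw [codeg2_swap c a a b, codeg2_comm a c a b, codeg2_swap c b a b, codeg2_comm b c a b] at r3
    rw [codeg2_comm a c b c] at r1
    have ab_bc : codeg2 T Y a b b c < 1 / 300 * n →
      codeg T Y b c + codeg T Y a b ≤ (1 + 1 / 300) * n := fun hh => by
        have := codeg_add_le hh; linarith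
    have ac_bc : codeg2 T Y b c a c < 1 / 300 * n →
      codeg T Y b c + codeg T Y a c ≤ (1 + 1 / 300) * n := fun hh => codeg_add_le hh
    have ac_bc' : codeg2 T Y a c b c < 1 / 300 * n →
      codeg T Y b c + codeg T Y a c ≤ (1 + 1 / 300) * n := fun hh => by
        have := codeg_add_le hh; linarith
    have ab_ac : codeg2 T Y a b a c < 1 / 300 * n →
      codeg T Y a b + codeg T Y a c ≤ (1 + 1 / 300) * n := fun hh => codeg_add_le hh
    by_cases c1 : codeg T Y b c + codeg T Y a b ≤ (1 + 1 / 300) * n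
    · by_cases c2 : codeg T Y b c + codeg T Y a c ≤ (1 + 1 / 300) * n
      · exact inv_numeric p1 p2 p3 hn0 c1 c2
      · have c3 : codeg T Y a b + codeg T Y a c ≤ (1 + 1 / 300) * n := by tauto
        have := inv_numeric p2 p1 p3 hn0 (by linarith) c3
        linarith
    · have c2 : codeg T Y b c + codeg T Y a c ≤ (1 + 1 / 300) * n := by tauto
      have c3 : codeg T Y a b + codeg T Y a c ≤ (1 + 1 / 300) * n := by tauto
      have := inv_numeric p2 p3 p1 hn0 (by linarith) (by linarith)
      linarith
  · simp only [LinkTriple, lk, restr, not_or] at hl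
    have hsmall : ∀ {x y z : V}, Flat T Y x y z → ¬ (T.adj x y z ∧ y ∈ Y x ∧ z ∈ Y x) →
        codeg T Y x y ≤ n / 3 := by
      intro x y z hf' hne
      have hy : y ∉ Y x := fun hy => hne ⟨hf'.1, hy, hf'.2.1.1 hy⟩
      have h1 : codeg T Y x y ≤ cnt (fun w => w ∈ (Y x)ᶜ) :=
        cnt_mono fun w hw => mem_compl.2 fun hwY => hy (hw.2.1.2 hwY)
      rw [cnt_mem, card_compl_real] at h1
      have := (hR.part x).card
      rw [← hn] at h1 this
      linarith
    have hin : ∀ {d : ℝ}, 0 < d → d ≤ n / 3 → 3 / n ≤ 1 / d := fun {d} h0 h1 => by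
      rw [div_le_div_iff₀ hn0 h0]
      linarith
    have q1 := hin p1 (hsmall hf hl.1)
    have q2 := hin p2 (hsmall hf.rot hl.2.1)
    have q3 := hin p3 (hsmall hf.swap23 fun hh => hl.1 ⟨hf.1, hh.2.2, hh.2.1⟩)
    have : 5.8 / n ≤ 3 / n + 3 / n + 3 / n := by
      rw [← add_div, ← add_div]
      gcongr
      norm_num
    linarith

/-- Useless flat edges weigh at least 5.8/n each and 3n² in total, so there are at most (3/5.8)n³
ordered ones; 5/9 - 3/5.8 exceeds 1/30. -/
lemma RobustLinks.le_cnt_good (hR : RobustLinks T α μ β h Y) (hμ : 6 * μ ≤ α) :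
    1 / 30 * (Fintype.card V : ℝ) ^ 3 ≤
      cnt (fun z : V × V × V => Flat T Y z.1 z.2.1 z.2.2 ∧ (LinkTriple T Y z.1 z.2.1 z.2.2 ∧
      (RichAt T Y z.1 z.2.1 z.2.2 ∨ RichAt T Y z.2.1 z.2.2 z.1 ∨ RichAt T Y z.2.2 z.1 z.2.1))) := by
  set n : ℝ := (Fintype.card V : ℝ) with hn
  have hn0 : 0 < n := hR.pos
  set G : V → V → V → Prop := fun a b c => LinkTriple T Y a b c ∧
      (RichAt T Y a b c ∨ RichAt T Y b c a ∨ RichAt T Y c a b) with hG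
  have h1 := cnt_split (fun z : V × V × V => Flat T Y z.1 z.2.1 z.2.2)
    (fun z => G z.1 z.2.1 z.2.2)
  have h2 := hR.le_cnt_flat hμ
  have h3 : 5.8 / n * cnt (fun z : V × V × V => Flat T Y z.1 z.2.1 z.2.2 ∧
      ¬ G z.1 z.2.1 z.2.2) ≤ 3 * n ^ 2 := by
    refine le_trans ?_ (sum_invdeg_le (T := T) (Y := Y))
    rw [cnt3_eq_sum (fun a b c => Flat T Y a b c ∧ ¬ G a b c)]
    simp only [mul_sum]
    refine sum_le_sum fun a _ => sum_le_sum fun b _ => sum_le_sum fun c _ => ?_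
    have hi : 0 ≤ invdeg T Y a b c := by
      unfold invdeg
      have := codeg_nonneg (T := T) (Y := Y)
      exact add_nonneg (add_nonneg (one_div_nonneg.2 (this _ _)) (one_div_nonneg.2 (this _ _)))
        (one_div_nonneg.2 (this _ _))
    by_cases hf : Flat T Y a b c ∧ ¬ G a b c
    · rw [ind_of hf, ind_of hf.1, one_mul, mul_one]
      exact hR.le_invdeg hf.1 hf.2
    · rw [ind_of_not hf, mul_zero]
      exact mul_nonneg (ind_nonneg _) hi
  rw [div_mul_eq_mul_div, div_le_iff₀ hn0] at h3
  have : 0 < n ^ 3 := by positivity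
  have e : 3 * n ^ 2 * n = 3 * n ^ 3 := by ring
  rw [e] at h3
  linarith

/-- Few triples lie in a restricted link through a pair that is not connectable. -/
lemma cnt_not_conn_le {ζ : ℝ} (hζ : 0 ≤ ζ) (B : Finset V) :
    cnt (fun z : V × V × V => (z.2.2 ∉ B ∧ lk T Y z.2.2 z.1 z.2.1) ∧ ¬ Conn T Y B ζ z.1 z.2.1) ≤
      ζ * (Fintype.card V : ℝ) ^ 3 := by
  rw [cnt3_eq_sum (fun a b c => (c ∉ B ∧ lk T Y c a b) ∧ ¬ Conn T Y B ζ a b)]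
  have h1 : ∀ a b, ∑ c, ind ((c ∉ B ∧ lk T Y c a b) ∧ ¬ Conn T Y B ζ a b) ≤
      ζ * Fintype.card V := by
    intro a b
    rw [← cnt_eq_ind]
    by_cases hc : Conn T Y B ζ a b
    · simp only [hc, not_true, and_false, cnt_false]
      positivity
    · simp only [hc, not_false_eq_true, and_true]
      exact (not_le.1 hc).le
  calc _ ≤ ∑ _a : V, ∑ _b : V, ζ * (Fintype.card V : ℝ) :=
        sum_le_sum fun a _ => sum_le_sum fun b _ => h1 a b
    _ = _ := by simp [card_univ]; ring

variable (T)

/-- Two copies of `K₄⁻` sharing the edge `f 0, f 1, f 2`. -/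
def DoubleKite (f : Fin 5 → V) : Prop :=
  T.adj (f 0) (f 1) (f 2) ∧ T.adj (f 3) (f 1) (f 2) ∧ T.adj (f 3) (f 1) (f 0) ∧
    T.adj (f 4) (f 1) (f 2) ∧ T.adj (f 4) (f 0) (f 2)

variable {T}

/-- A good flat triple either has, in one of its three rotations, a pair in a restricted link that
is not connectable, or has a rich rotation with a connectable pair. The first kind amounts to at
most 3ζn³ ≤ n³/60 triples, so some rotation, and by symmetry the standard one, is rich for n³/180
triples. Richness then supplies n/300 choices for each of the two remaining vertices. -/
theorem RobustLinks.le_cnt_doubleKite (hR : RobustLinks T α μ β h Y) (hμ : 6 * μ ≤ α) {ζ : ℝ}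
    (hζ : 0 ≤ ζ) (hζ' : ζ ≤ 1 / 180) :
    1 / 180 * (1 / 300) ^ 2 * (Fintype.card V : ℝ) ^ 5 ≤
      cnt (fun f : Fin 5 → V => DoubleKite T f ∧ (Conn T Y ∅ ζ (f 0) (f 1) ∨
        Conn T Y ∅ ζ (f 1) (f 2) ∨ Conn T Y ∅ ζ (f 2) (f 0))) := by
  set n : ℝ := (Fintype.card V : ℝ) with hn
  have hn0 : 0 < n := hR.pos
  set K : V → V → V → Prop := fun a b c => Conn T Y ∅ ζ a b ∨ Conn T Y ∅ ζ b c ∨ Conn T Y ∅ ζ c a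
    with hK
  set N : V → V → V → Prop := fun a b c => (c ∉ (∅ : Finset V) ∧ lk T Y c a b) ∧
    ¬ Conn T Y ∅ ζ a b with hN
  set Q : V → V → V → Prop := fun a b c => Flat T Y a b c ∧ K a b c ∧ RichAt T Y a b c with hQ
  have hN1 : cnt (fun z : V × V × V => N z.1 z.2.1 z.2.2) ≤ ζ * n ^ 3 := cnt_not_conn_le hζ ∅
  have hN2 := hN1
  rw [cnt3_rot N] at hN2
  have hN3 := hN2
  rw [cnt3_rot (fun a b c => N b c a)] at hN3
  have hQ2 : cnt (fun z : V × V × V => Q z.1 z.2.1 z.2.2) =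
    cnt (fun z : V × V × V => Q z.2.1 z.2.2 z.1) := cnt3_rot Q
  have hQ3 : cnt (fun z : V × V × V => Q z.2.1 z.2.2 z.1) =
    cnt (fun z : V × V × V => Q z.2.2 z.1 z.2.1) := cnt3_rot fun a b c => Q b c a
  have hcov : cnt (fun z : V × V × V => Flat T Y z.1 z.2.1 z.2.2 ∧
      (LinkTriple T Y z.1 z.2.1 z.2.2 ∧ (RichAt T Y z.1 z.2.1 z.2.2 ∨
        RichAt T Y z.2.1 z.2.2 z.1 ∨ RichAt T Y z.2.2 z.1 z.2.1))) ≤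
      (cnt (fun z : V × V × V => N z.1 z.2.1 z.2.2) + (cnt (fun z : V × V × V => N z.2.1 z.2.2 z.1)
        + cnt (fun z : V × V × V => N z.2.2 z.1 z.2.1))) +
      (cnt (fun z : V × V × V => Q z.1 z.2.1 z.2.2) + (cnt (fun z : V × V × V => Q z.2.1 z.2.2 z.1)
        + cnt (fun z : V × V × V => Q z.2.2 z.1 z.2.1))) := by
    refine le_trans ?_ ((cnt_or_le _ _).trans (add_le_add
      ((cnt_or_le _ _).trans (add_le_add le_rfl (cnt_or_le _ _)))
      ((cnt_or_le _ _).trans (add_le_add le_rfl (cnt_or_le _ _)))))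
    refine cnt_mono fun z hz => ?_
    obtain ⟨hf, hl, hr⟩ := hz
    have hf2 := hf.rot
    have hf3 := hf.rot.rot
    simp only [hN, hQ, hK, notMem_empty, not_false_eq_true, true_and]
    simp only [LinkTriple] at hl
    tauto
  have hQc : 1 / 180 * n ^ 3 ≤ cnt (fun z : V × V × V => Q z.1 z.2.1 z.2.2) := by
    have h1 := hR.le_cnt_good hμ
    have : ζ * n ^ 3 ≤ 1 / 180 * n ^ 3 := by gcongr
    rw [← hn] at h1
    linarith
  have hinj : cnt (fun z : (V × V × V) × V × V => Q z.1.1 z.1.2.1 z.1.2.2 ∧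
      (Flat T Y z.1.1 z.1.2.1 z.2.1 ∧ Flat T Y z.1.2.1 z.1.2.2 z.2.1) ∧
      (Flat T Y z.1.1 z.1.2.2 z.2.2 ∧ Flat T Y z.1.2.1 z.1.2.2 z.2.2)) ≤
      cnt (fun f : Fin 5 → V => DoubleKite T f ∧ (Conn T Y ∅ ζ (f 0) (f 1) ∨
        Conn T Y ∅ ζ (f 1) (f 2) ∨ Conn T Y ∅ ζ (f 2) (f 0))) := by
    refine cnt_le_of_injOn (fun z => ![z.1.1, z.1.2.1, z.1.2.2, z.2.1, z.2.2]) ?_ ?_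
    · rintro ⟨⟨x, b, c⟩, a, d⟩ ⟨⟨h1, h2, _⟩, ⟨h3, h4⟩, h5, h6⟩
      exact ⟨⟨h1.1, h4.rot.rot.1, h3.rot.rot.swap23.1, h6.rot.rot.1, h5.rot.rot.1⟩, h2⟩
    · rintro ⟨⟨x, b, c⟩, a, d⟩ ⟨⟨x', b', c'⟩, a', d'⟩ _ _ he
      have e0 := congrFun he 0
      have e1 := congrFun he 1
      have e2 := congrFun he 2
      have e3 := congrFun he 3
      have e4 := congrFun he 4
      simp at e0 e1 e2 e3 e4
      simp [e0, e1, e2, e3, e4]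
  refine le_trans ?_ hinj
  rw [cnt_prod (fun (z : V × V × V) (w : V × V) => Q z.1 z.2.1 z.2.2 ∧
      (Flat T Y z.1 z.2.1 w.1 ∧ Flat T Y z.2.1 z.2.2 w.1) ∧
      (Flat T Y z.1 z.2.2 w.2 ∧ Flat T Y z.2.1 z.2.2 w.2))]
  calc 1 / 180 * (1 / 300) ^ 2 * n ^ 5
      = (1 / 300 * n) * (1 / 300 * n) * (1 / 180 * n ^ 3) := by ring
    _ ≤ (1 / 300 * n) * (1 / 300 * n) * cnt (fun z : V × V × V => Q z.1 z.2.1 z.2.2) := by gcongr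
    _ ≤ _ := by
      refine mul_cnt_le_sum _ (fun z => cnt_nonneg _) fun z hz => ?_
      have h1 : 1 / 300 * n ≤ codeg2 T Y z.1 z.2.1 z.2.1 z.2.2 := hz.2.2.1
      have h2 : 1 / 300 * n ≤ codeg2 T Y z.1 z.2.2 z.2.1 z.2.2 := hz.2.2.2
      have h3 := cnt_and_prod (fun w => Flat T Y z.1 z.2.1 w ∧ Flat T Y z.2.1 z.2.2 w)
        (fun w => Flat T Y z.1 z.2.2 w ∧ Flat T Y z.2.1 z.2.2 w)
      refine (mul_le_mul h1 h2 (by positivity) (cnt_nonneg _)).trans (h3.ge.trans ?_)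
      exact cnt_mono fun w hw => ⟨hz, hw⟩

end Rich

/-! ### Absorbers for typical vertices and for all vertices. -/

section Absorbers

variable {V : Type u} [Fintype V]

/-- The tight path `t` has connectable ends and can absorb the vertex `v`. -/
def Absorber (T : TripleSystem V) (Y : V → Finset V) (ζ : ℝ) (v : V) (t : List V) : Prop :=
  ∃ a b c d, HasEnds t a b c d ∧ T.Tight t ∧ Conn T Y ∅ ζ a b ∧ Conn T Y ∅ ζ c d ∧
    ∃ t', t'.Perm (v :: t) ∧ T.Tight t' ∧ HasEnds t' a b c d

variable {T : TripleSystem V} {Y : V → Finset V} {α μ β ζ : ℝ} {h : ℕ}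

/-- Only eleven of the twenty vertices of the fourfold blow-up are used; forgetting the other nine
costs at most a factor n⁹. -/
lemma exists_absorbers_of_dense {c : ℝ} (hc : 0 < c) :
    ∃ c' : ℝ, 0 < c' ∧ ∀ (V : Type u) [Fintype V], 0 < Fintype.card V →
      ∀ (p : (Fin 5 → V) → Prop) (q : List V → Prop) (e : Fin 11 → Fin 5 × Fin 4),
      Function.Injective e →
      (∀ Φ : Fin 5 → Fin 4 → V, (∀ f : Fin 5 → Fin 4, p fun a => Φ a (f a)) →
        q (List.ofFn fun j => Φ (e j).1 (e j).2)) →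
      c * (Fintype.card V : ℝ) ^ 5 ≤ cnt p → c' * (Fintype.card V : ℝ) ^ 11 ≤ lcnt 11 q := by
  obtain ⟨c', hc', h⟩ := exists_blowup.{u} 5 4 hc
  refine ⟨c', hc', fun V _ hV p q e he hpq hp => ?_⟩
  set n : ℝ := (Fintype.card V : ℝ) with hn
  have hn0 : 0 < n := by rw [hn]; exact_mod_cast hV
  have h1 := h V hV p hp
  rw [← cnt_equiv (Equiv.curry (Fin 5) (Fin 4) V)] at h1
  have h2 := cnt_restrict_le e he (p := fun Ψ : Fin 5 × Fin 4 → V =>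
    ∀ f : Fin 5 → Fin 4, p fun a => (Equiv.curry (Fin 5) (Fin 4) V) Ψ a (f a))
    (q := fun g : Fin 11 → V => q (List.ofFn g)) fun Ψ hΨ => hpq _ hΨ
  rw [← lcnt_eq_cnt] at h2
  simp only [Fintype.card_prod, Fintype.card_fin] at h2
  have h3 := h1.trans h2
  rw [← hn] at h3
  refine le_of_mul_le_mul_left (a := n ^ 9) ?_ (by positivity)
  calc n ^ 9 * (c' * n ^ 11) = c' * n ^ (5 * 4) := by ring
    _ ≤ _ := h3

omit [Fintype V] in
lemma DoubleKite.of_blowup {Φ : Fin 5 → Fin 4 → V}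
    (hΦ : ∀ f : Fin 5 → Fin 4, DoubleKite T fun a => Φ a (f a)) (i j k l m : Fin 4) :
    T.adj (Φ 0 i) (Φ 1 j) (Φ 2 k) ∧ T.adj (Φ 3 l) (Φ 1 j) (Φ 2 k) ∧ T.adj (Φ 3 l) (Φ 1 j) (Φ 0 i) ∧
      T.adj (Φ 4 m) (Φ 1 j) (Φ 2 k) ∧ T.adj (Φ 4 m) (Φ 0 i) (Φ 2 k) :=
  hΦ ![i, j, k, l, m]

lemma absorber_insert {x : V} {l m : List V} {p q r s : V} (h1 : T.Tight (l ++ m))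
    (h2 : T.Tight (l ++ x :: m)) (hc : Conn T Y ∅ ζ p q) (hc' : Conn T Y ∅ ζ r s)
    (he : ∃ l' m', l = p :: q :: l' ∧ m = m' ++ [r, s]) : Absorber T Y ζ x (l ++ m) := by
  obtain ⟨l', m', rfl, rfl⟩ := he
  exact ⟨p, q, r, s, ⟨l' ++ m', by simp⟩, h1, hc, hc', _, List.perm_middle, h2,
    ⟨l' ++ x :: m', by simp⟩⟩

/-- There are many pairs of a vertex and a ten-vertex path absorbing it. -/
theorem exists_many_absorber_pairs : ∃ c : ℝ, 0 < c ∧ ∀ (V : Type u) [Fintype V]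
    (T : TripleSystem V) (Y : V → Finset V) (α μ β ζ : ℝ) (h : ℕ), RobustLinks T α μ β h Y →
    6 * μ ≤ α → 0 ≤ ζ → ζ ≤ 1 / 180 →
    c * (Fintype.card V : ℝ) ^ 11 ≤
      lcnt 11 (fun l => ∃ x t, l = x :: t ∧ Absorber T Y ζ x t) := by
  obtain ⟨c', hc', H⟩ := exists_absorbers_of_dense.{u} (c := 1 / 180 * (1 / 300) ^ 2 / 3)
    (by norm_num)
  refine ⟨c', hc', fun V _ T Y α μ β ζ h hR hμ hζ hζ' => ?_⟩
  have hV : 0 < Fintype.card V := by have := hR.card2; omega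
  have hcard := hR.le_cnt_doubleKite hμ hζ hζ'
  have hor : cnt (fun f : Fin 5 → V => DoubleKite T f ∧ (Conn T Y ∅ ζ (f 0) (f 1) ∨
        Conn T Y ∅ ζ (f 1) (f 2) ∨ Conn T Y ∅ ζ (f 2) (f 0))) ≤
      cnt (fun f : Fin 5 → V => DoubleKite T f ∧ Conn T Y ∅ ζ (f 0) (f 1)) +
      (cnt (fun f : Fin 5 → V => DoubleKite T f ∧ Conn T Y ∅ ζ (f 1) (f 2)) +
      cnt (fun f : Fin 5 → V => DoubleKite T f ∧ Conn T Y ∅ ζ (f 2) (f 0))) := by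
    refine le_trans ?_ ((cnt_or_le _ _).trans (add_le_add le_rfl (cnt_or_le _ _)))
    exact cnt_mono fun f hf => by tauto
  have hcase : 1 / 180 * (1 / 300) ^ 2 / 3 * (Fintype.card V : ℝ) ^ 5 ≤
      cnt (fun f : Fin 5 → V => DoubleKite T f ∧ Conn T Y ∅ ζ (f 0) (f 1)) ∨
      1 / 180 * (1 / 300) ^ 2 / 3 * (Fintype.card V : ℝ) ^ 5 ≤
      cnt (fun f : Fin 5 → V => DoubleKite T f ∧ Conn T Y ∅ ζ (f 1) (f 2)) ∨
      1 / 180 * (1 / 300) ^ 2 / 3 * (Fintype.card V : ℝ) ^ 5 ≤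
      cnt (fun f : Fin 5 → V => DoubleKite T f ∧ Conn T Y ∅ ζ (f 2) (f 0)) := by
    by_contra! hcon
    obtain ⟨q1, q2, q3⟩ := hcon
    linarith
  rcases hcase with hp | hp | hp
  -- In kite labels the path reads 1 0 3 1 | 2 4 1 2 0 1, with a further copy of 0 inserted at the
  -- bar. In all three cases the bar sits inside 3 1 | 2 4: the triples 312, 124 give way to 310,
  -- 102, 024, and these five are exactly the triples of the double kite. The rest of the path only
  -- serves to make both ends copies of the connectable pair.
  · refine H V hV _ _ ![(0, 0), (1, 0), (0, 1), (3, 0), (1, 1), (2, 0), (4, 0), (1, 2), (2, 1),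
      (0, 2), (1, 3)] (by decide) ?_ hp
    intro Φ hΦ
    have hK := DoubleKite.of_blowup fun f => (hΦ f).1
    have hC : ∀ i j, Conn T Y ∅ ζ (Φ 0 i) (Φ 1 j) := fun i j => (hΦ ![i, j, 0, 0, 0]).2
    refine ⟨Φ 0 0, [Φ 1 0, Φ 0 1, Φ 3 0, Φ 1 1] ++ [Φ 2 0, Φ 4 0, Φ 1 2, Φ 2 1, Φ 0 2, Φ 1 3],
      rfl, absorber_insert (p := Φ 1 0) (q := Φ 0 1) (r := Φ 0 2) (s := Φ 1 3) ?_ ?_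
      (hC 1 0).symm (hC 2 3) ⟨_, [Φ 2 0, Φ 4 0, Φ 1 2, Φ 2 1], rfl, rfl⟩⟩
    · simp only [List.cons_append, List.nil_append, tight_cons3, tight_pair, and_true]
      exact ⟨rot (hK 1 0 0 0 0).2.2.1, rot' (hK 1 1 0 0 0).2.2.1, (hK 0 1 0 0 0).2.1,
        rot (hK 0 1 0 0 0).2.2.2.1, rot' (hK 0 2 0 0 0).2.2.2.1,
        (hK 0 2 1 0 0).2.2.2.1, rot (hK 2 2 1 0 0).1, rot' (hK 2 3 1 0 0).1⟩
    · simp only [List.cons_append, List.nil_append, tight_cons3, tight_pair, and_true]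
      exact ⟨rot (hK 1 0 0 0 0).2.2.1, rot' (hK 1 1 0 0 0).2.2.1, (hK 0 1 0 0 0).2.2.1,
        T.swap12 (hK 0 1 0 0 0).1, rot (hK 0 1 0 0 0).2.2.2.2,
        rot' (hK 0 2 0 0 0).2.2.2.1,
        (hK 0 2 1 0 0).2.2.2.1, rot (hK 2 2 1 0 0).1, rot' (hK 2 3 1 0 0).1⟩
  · refine H V hV _ _ ![(0, 0), (2, 0), (1, 0), (0, 1), (3, 0), (1, 1), (2, 1), (4, 0), (0, 2),
      (2, 2), (1, 2)] (by decide) ?_ hp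
    intro Φ hΦ
    have hK := DoubleKite.of_blowup fun f => (hΦ f).1
    have hC : ∀ i j, Conn T Y ∅ ζ (Φ 1 i) (Φ 2 j) := fun i j => (hΦ ![0, i, j, 0, 0]).2
    refine ⟨Φ 0 0, [Φ 2 0, Φ 1 0, Φ 0 1, Φ 3 0, Φ 1 1] ++ [Φ 2 1, Φ 4 0, Φ 0 2, Φ 2 2, Φ 1 2],
      rfl, absorber_insert (p := Φ 2 0) (q := Φ 1 0) (r := Φ 2 2) (s := Φ 1 2) ?_ ?_
      (hC 0 0).symm (hC 2 2).symm ⟨_, [Φ 2 1, Φ 4 0, Φ 0 2], rfl, rfl⟩⟩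
    · simp only [List.cons_append, List.nil_append, tight_cons3, tight_pair, and_true]
      exact ⟨rev (hK 1 0 0 0 0).1, rot (hK 1 0 0 0 0).2.2.1, rot' (hK 1 1 0 0 0).2.2.1,
        (hK 0 1 1 0 0).2.1, rot (hK 0 1 1 0 0).2.2.2.1, rot' (hK 2 0 1 0 0).2.2.2.2,
        (hK 2 0 2 0 0).2.2.2.2, T.swap23 (hK 2 2 2 0 0).1⟩
    · simp only [List.cons_append, List.nil_append, tight_cons3, tight_pair, and_true]
      exact ⟨rev (hK 1 0 0 0 0).1, rot (hK 1 0 0 0 0).2.2.1, rot' (hK 1 1 0 0 0).2.2.1,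
        (hK 0 1 0 0 0).2.2.1, T.swap12 (hK 0 1 1 0 0).1, rot (hK 0 1 1 0 0).2.2.2.2,
        rot' (hK 2 0 1 0 0).2.2.2.2,
        (hK 2 0 2 0 0).2.2.2.2, T.swap23 (hK 2 2 2 0 0).1⟩
  · refine H V hV _ _ ![(0, 0), (2, 0), (0, 1), (1, 0), (2, 1), (3, 0), (1, 1), (2, 2), (4, 0),
      (0, 2), (2, 3)] (by decide) ?_ hp
    intro Φ hΦ
    have hK := DoubleKite.of_blowup fun f => (hΦ f).1
    have hC : ∀ i j, Conn T Y ∅ ζ (Φ 2 i) (Φ 0 j) := fun i j => (hΦ ![j, 0, i, 0, 0]).2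
    refine ⟨Φ 0 0, [Φ 2 0, Φ 0 1, Φ 1 0, Φ 2 1, Φ 3 0, Φ 1 1] ++ [Φ 2 2, Φ 4 0, Φ 0 2, Φ 2 3],
      rfl, absorber_insert (p := Φ 2 0) (q := Φ 0 1) (r := Φ 0 2) (s := Φ 2 3) ?_ ?_
      (hC 0 1) (hC 3 2).symm ⟨_, [Φ 2 2, Φ 4 0], rfl, rfl⟩⟩
    · simp only [List.cons_append, List.nil_append, tight_cons3, tight_pair, and_true]
      exact ⟨rot' (hK 1 0 0 0 0).1, (hK 1 0 1 0 0).1, rot (hK 0 0 1 0 0).2.1,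
        rot' (hK 0 1 1 0 0).2.1, (hK 0 1 2 0 0).2.1, rot (hK 0 1 2 0 0).2.2.2.1,
        rot' (hK 2 0 2 0 0).2.2.2.2, (hK 2 0 3 0 0).2.2.2.2⟩
    · simp only [List.cons_append, List.nil_append, tight_cons3, tight_pair, and_true]
      exact ⟨rot' (hK 1 0 0 0 0).1, (hK 1 0 1 0 0).1, rot (hK 0 0 1 0 0).2.1,
        rot' (hK 0 1 1 0 0).2.1, (hK 0 1 2 0 0).2.2.1, T.swap12 (hK 0 1 2 0 0).1,
        rot (hK 0 1 2 0 0).2.2.2.2, rot' (hK 2 0 2 0 0).2.2.2.2, (hK 2 0 3 0 0).2.2.2.2⟩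

/-- The blow-up of an edge with two vertices in each part is a four-cycle, and three of its edges
form the walk. -/
lemma exists_many_three_walks {c : ℝ} (hc : 0 < c) :
    ∃ c' : ℝ, 0 < c' ∧ ∀ (V : Type u) [Fintype V], 0 < Fintype.card V →
      ∀ G : V → V → Prop, (∀ a b, G a b → G b a) →
      c * (Fintype.card V : ℝ) ^ 2 ≤ cnt (fun z : V × V => G z.1 z.2) →
      c' * (Fintype.card V : ℝ) ^ 4 ≤ cnt (fun z : V × V × V × V =>
        G z.1 z.2.1 ∧ G z.2.1 z.2.2.1 ∧ G z.2.2.1 z.2.2.2) := by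
  obtain ⟨c', hc', H⟩ := exists_blowup.{u} 2 2 hc
  refine ⟨c', hc', fun V _ hV G hG hcard => ?_⟩
  have h1 : cnt (fun z : V × V => G z.1 z.2) ≤ cnt (fun f : Fin 2 → V => G (f 0) (f 1)) := by
    refine cnt_le_of_injOn (fun z => ![z.1, z.2]) (fun z hz => hz) ?_
    rintro ⟨a, b⟩ ⟨a', b'⟩ _ _ he
    have e0 := congrFun he 0
    have e1 := congrFun he 1
    simp at e0 e1
    simp [e0, e1]
  refine (H V hV _ (hcard.trans h1)).trans ?_
  refine cnt_le_of_injOn (fun Φ => (Φ 1 1, Φ 0 0, Φ 1 0, Φ 0 1)) ?_ ?_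
  · intro Φ hΦ
    have h2 : ∀ i j, G (Φ 0 i) (Φ 1 j) := fun i j => hΦ ![i, j]
    exact ⟨hG _ _ (h2 0 1), h2 0 0, hG _ _ (h2 1 0)⟩
  · intro Φ Ψ _ _ he
    simp only [Prod.mk.injEq] at he
    funext i j
    fin_cases i <;> fin_cases j <;> simp [he]

lemma RobustLinks.cnt_bad_le (hR : RobustLinks T α μ β h Y) (hα : 0 < α) (hζ : 0 ≤ ζ) :
    cnt (fun x => α / 2 * (Fintype.card V : ℝ) ^ 2 ≤ cnt (fun z : V × V =>
      lk T Y x z.1 z.2 ∧ ¬ Conn T Y ∅ ζ z.1 z.2)) ≤ 2 * ζ / α * Fintype.card V := by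
  set n : ℝ := (Fintype.card V : ℝ) with hn
  have hn0 : 0 < n := hR.pos
  have h1 := cnt_not_conn_le (T := T) (Y := Y) hζ ∅
  rw [cnt3_rot (fun a b c => (c ∉ (∅ : Finset V) ∧ lk T Y c a b) ∧ ¬ Conn T Y ∅ ζ a b),
    cnt_prod (fun c (z : V × V) =>
      (c ∉ (∅ : Finset V) ∧ lk T Y c z.1 z.2) ∧ ¬ Conn T Y ∅ ζ z.1 z.2)] at h1
  simp only [notMem_empty, not_false_eq_true, true_and] at h1
  have h2 := mul_cnt_le_sum (fun x => cnt (fun z : V × V =>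
      lk T Y x z.1 z.2 ∧ ¬ Conn T Y ∅ ζ z.1 z.2)) (c := α / 2 * n ^ 2)
      (fun x => cnt_nonneg _) (fun x hx => hx)
  have h3 := h2.trans h1
  have e : 2 * ζ / α * n = 2 * ζ * n / α := by ring
  rw [e, le_div_iff₀ hα]
  refine le_of_mul_le_mul_left (a := n ^ 2) ?_ (by positivity)
  rw [← hn] at h3
  linarith

/-- Every vertex has many absorbers. -/
theorem exists_many_absorbers {α μ β : ℝ} {h : ℕ} (hα : 0 < α) (hβ : 0 < β) (hμ : 6 * μ ≤ α)
    (hμ0 : 0 < μ) :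
    ∃ ζ : ℝ, 0 < ζ ∧ ∃ η : ℝ, 0 < η ∧ ∀ (V : Type u) [Fintype V] (T : TripleSystem V)
      (Y : V → Finset V), RobustLinks T α μ β h Y → ∀ v,
      η * (Fintype.card V : ℝ) ^ (6 * h + 19) ≤ lcnt (6 * h + 19) (Absorber T Y ζ v) := by
  obtain ⟨c, hc, hpairs⟩ := exists_many_absorber_pairs.{u}
  obtain ⟨c₂, hc₂, hquad⟩ := exists_many_three_walks.{u} (c := α / 2) (by positivity)
  -- The constant c is uniform in all ζ ≤ 1/180, so ζ may be chosen after it. With ζ ≤ cα/4 at most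
  -- (c/2)n vertices x are bad, and half of the pairs of an absorber and its vertex remain.
  set ζ := min (1 / 180) (c * α / 4) with hζ
  have hζ0 : 0 < ζ := by positivity
  set θ := ζ ^ 2 * α / 4 * ((ζ ^ 2 * α / 4 * β / 4) ^ (h + 2)) ^ 2 with hθ
  have hθ0 : 0 < θ := by positivity
  refine ⟨ζ, hζ0, c / 2 * c₂ * θ, by positivity, fun V _ T Y hR v => ?_⟩
  set n : ℝ := (Fintype.card V : ℝ) with hn
  have hn0 : 0 < n := hR.pos
  have hV : 0 < Fintype.card V := by have := hR.card2; omega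
  set Bad : V → Prop := fun x => α / 2 * n ^ 2 ≤ cnt (fun z : V × V =>
      lk T Y x z.1 z.2 ∧ ¬ Conn T Y ∅ ζ z.1 z.2) with hBad
  have hbad : cnt Bad ≤ c / 2 * n := by
    refine (hR.cnt_bad_le hα hζ0.le).trans ?_
    have : 2 * ζ / α ≤ c / 2 := by
      rw [div_le_iff₀ hα]
      have : ζ ≤ c * α / 4 := min_le_right _ _
      linarith
    gcongr
  set f : V → ℝ := fun x => lcnt 10 (Absorber T Y ζ x) with hf
  have hsum : c * n ^ 11 ≤ ∑ x, f x := by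
    refine (hpairs V T Y α μ β ζ h hR hμ hζ0.le (min_le_left _ _)).trans ?_
    rw [lcnt_succ]
    refine sum_le_sum fun x _ => lcnt_mono fun l _ => ?_
    rintro ⟨x', t, he, ht⟩
    simp only [List.cons.injEq] at he
    obtain ⟨rfl, rfl⟩ := he
    exact ht
  have hsum2 : c / 2 * n ^ 11 ≤ ∑ x ∈ fil (fun x => ¬ Bad x), f x := by
    have h1 : ∑ x, f x ≤ ∑ x ∈ fil (fun x => ¬ Bad x), f x + ∑ x ∈ fil Bad, f x := by
      have : (univ : Finset V) = fil (fun x => ¬ Bad x) ∪ fil Bad := by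
        ext x; simp only [mem_univ, mem_union, mem_fil]; tauto
      conv_lhs => rw [this]
      rw [sum_union (disjoint_left.2 fun x h1 h2 => (mem_fil (p := fun x => ¬ Bad x)).1 h1 (mem_fil.1 h2))]
    have h2 : ∑ x ∈ fil Bad, f x ≤ c / 2 * n * n ^ 10 := by
      calc ∑ x ∈ fil Bad, f x ≤ ∑ x ∈ fil Bad, n ^ 10 := sum_le_sum fun x _ => lcnt_le _ _
        _ = cnt Bad * n ^ 10 := by rw [sum_const, nsmul_eq_mul, card_fil]
        _ ≤ _ := by gcongr
    have e : c / 2 * n * n ^ 10 = c / 2 * n ^ 11 := by ring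
    linarith
  set Q : V → V × V × V × V → Prop := fun x z =>
    (((lk T Y x z.1 z.2.1 ∧ lk T Y v z.1 z.2.1) ∧ Conn T Y ∅ ζ z.1 z.2.1)) ∧
    (((lk T Y x z.2.1 z.2.2.1 ∧ lk T Y v z.2.1 z.2.2.1) ∧ Conn T Y ∅ ζ z.2.1 z.2.2.1)) ∧
    (((lk T Y x z.2.2.1 z.2.2.2 ∧ lk T Y v z.2.2.1 z.2.2.2) ∧ Conn T Y ∅ ζ z.2.2.1 z.2.2.2)) with hQ
  have hQc : ∀ x, ¬ Bad x → c₂ * n ^ 4 ≤ cnt (Q x) := by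
    intro x hx
    refine hquad V hV (fun a b => (lk T Y x a b ∧ lk T Y v a b) ∧ Conn T Y ∅ ζ a b)
      (fun a b hab => ⟨⟨lk_symm hab.1.1, lk_symm hab.1.2⟩, hab.2.symm⟩) ?_
    have h1 := hR.common (by linarith) x v
    have h2 := cnt_sub_le (fun z : V × V => lk T Y x z.1 z.2 ∧ lk T Y v z.1 z.2)
      (fun z => lk T Y x z.1 z.2 ∧ ¬ Conn T Y ∅ ζ z.1 z.2)
    have h3 : cnt (fun z : V × V => (lk T Y x z.1 z.2 ∧ lk T Y v z.1 z.2) ∧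
        ¬ (lk T Y x z.1 z.2 ∧ ¬ Conn T Y ∅ ζ z.1 z.2)) ≤
        cnt (fun z : V × V => (lk T Y x z.1 z.2 ∧ lk T Y v z.1 z.2) ∧ Conn T Y ∅ ζ z.1 z.2) :=
      cnt_mono fun z hz => by tauto
    have h4 := not_le.1 hx
    rw [← hn] at h1
    linarith
  -- With Pq = (P, e, f, g, k) the absorber is e f x g k, a connection w, and the path P that
  -- absorbs x. It takes in v by placing v where x was and moving x into P. This is possible because
  -- ef, fg, gk lie in the links of both x and v.
  set L : V → List V × (V × V × V × V) → List V → List V := fun x Pq w =>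
    [Pq.2.1, Pq.2.2.1, x, Pq.2.2.2.1, Pq.2.2.2.2] ++ w ++ Pq.1 with hL
  have hW : ∀ x, ∀ Pq : List V × (V × V × V × V), Absorber T Y ζ x Pq.1 → Q x Pq.2 →
      θ * n ^ (6 * h + 4) ≤ lcnt (6 * h + 4) (fun w => Absorber T Y ζ v (L x Pq w)) := by
    rintro x ⟨P, e, f, g, k⟩ hP hq
    obtain ⟨p1, p2, p3, p4, hends, htP, hc1, hc2, P', hperm, htP', hends'⟩ := hP
    obtain ⟨q1, q2, q3⟩ := hq
    refine (hR.connect hβ hα (by linarith) hζ0 (B := ∅)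
      (by rw [card_empty, Nat.cast_zero]; positivity) q3.2 hc1).trans (lcnt_mono fun w _ hw => ?_)
    have hw' : T.Tight ([g, k] ++ w ++ [p1, p2]) := by simpa using hw.2
    have he : ∀ z, HasEnds [e, f, z, g, k] e f g k := fun z => ⟨[z], rfl⟩
    have ht : ∀ z, (lk T Y z e f ∧ lk T Y z f g ∧ lk T Y z g k) → T.Tight [e, f, z, g, k] := by
      intro z hz
      simp only [tight_cons3, tight_pair, and_true]
      exact ⟨rot hz.1.1, T.swap12 hz.2.1.1, hz.2.2.1⟩
    refine ⟨e, f, p3, p4, (he x).join w hends,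
      (tight_join (he x) hends).2 ⟨ht x ⟨q1.1.1, q2.1.1, q3.1.1⟩, hw', htP⟩, q1.2, hc2,
      [e, f, v, g, k] ++ w ++ P', ?_, (tight_join (he v) hends').2
        ⟨ht v ⟨q1.1.2, q2.1.2, q3.1.2⟩, hw', htP'⟩, (he v).join w hends'⟩
    have h1 : ([e, f, v, g, k] ++ w ++ P').Perm ([e, f, v, g, k] ++ w ++ (x :: P)) :=
      hperm.append_left _
    refine h1.trans ?_
    rw [List.perm_iff_count]
    intro z
    simp only [hL, List.count_append, List.count_cons, List.count_nil]
    ring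
  set S := (fil fun x => ¬ Bad x).sigma fun x =>
    ((lfil 10 (Absorber T Y ζ x)) ×ˢ (fil (Q x))).sigma fun Pq =>
      lfil (6 * h + 4) (fun w => Absorber T Y ζ v (L x Pq w)) with hS
  have hlow : c / 2 * c₂ * θ * n ^ (6 * h + 19) ≤ (S.card : ℝ) := by
    rw [hS, card_sigma]
    push_cast
    calc c / 2 * c₂ * θ * n ^ (6 * h + 19)
        = (c / 2 * n ^ 11) * (c₂ * n ^ 4 * (θ * n ^ (6 * h + 4))) := by ring
      _ ≤ (∑ x ∈ fil (fun x => ¬ Bad x), f x) * (c₂ * n ^ 4 * (θ * n ^ (6 * h + 4))) := by gcongr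
      _ = ∑ x ∈ fil (fun x => ¬ Bad x), f x * (c₂ * n ^ 4 * (θ * n ^ (6 * h + 4))) := sum_mul _ _ _
      _ ≤ _ := by
        refine sum_le_sum fun x hx => ?_
        rw [card_sigma]
        push_cast
        calc f x * (c₂ * n ^ 4 * (θ * n ^ (6 * h + 4)))
            ≤ f x * (cnt (Q x) * (θ * n ^ (6 * h + 4))) := by
              have := hQc x ((mem_fil (p := fun x => ¬ Bad x)).1 hx)
              have : 0 ≤ f x := lcnt_nonneg _ _
              gcongr
          _ = ∑ Pq ∈ (lfil 10 (Absorber T Y ζ x)) ×ˢ (fil (Q x)), θ * n ^ (6 * h + 4) := by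
              rw [sum_const, card_product, nsmul_eq_mul]
              push_cast
              rw [card_fil, card_lfil]
              ring
          _ ≤ _ := by
              refine sum_le_sum fun Pq hPq => ?_
              rw [mem_product, mem_lfil, mem_fil] at hPq
              exact hW x Pq hPq.1.2 hPq.2
  refine hlow.trans ?_
  rw [← card_lfil]
  refine Nat.cast_le.2 (card_le_card_of_injOn (fun z => L z.1 z.2.1 z.2.2) ?_ ?_)
  · rintro ⟨x, ⟨⟨P, e, f, g, k⟩, w⟩⟩ hz
    simp only [hS, coe_sigma, Set.mem_sigma_iff, mem_coe, mem_product, mem_lfil, mem_fil] at hz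
    simp only [mem_coe, mem_lfil]
    refine ⟨?_, hz.2.2.2⟩
    simp only [hL, List.length_append, List.length_cons, List.length_nil, hz.2.1.1.1, hz.2.2.1]
    ring
  · rintro ⟨x, ⟨⟨P, e, f, g, k⟩, w⟩⟩ hz ⟨x', ⟨⟨P', e', f', g', k'⟩, w'⟩⟩ hz' he
    simp only [hS, coe_sigma, Set.mem_sigma_iff, mem_coe, mem_product, mem_lfil, mem_fil] at hz hz'
    simp only [hL, List.cons_append, List.nil_append, List.cons.injEq] at he
    obtain ⟨rfl, rfl, rfl, rfl, rfl, he⟩ := he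
    obtain ⟨rfl, rfl⟩ := List.append_inj he (hz.2.2.1.trans hz'.2.2.1.symm)
    rfl

end Absorbers

/-! ### Greedy selection of small disjoint families. -/

section Selection

variable {V : Type u} [Fintype V]

/-- The number of members of the family `F` which are good. -/
noncomputable def hits (F : List (List V)) (p : List V → Prop) : ℕ := F.countP fun l => p l

omit [Fintype V] in
lemma hits_cons (F : List (List V)) (p : List V → Prop) (l : List V) :
    hits (l :: F) p = hits F p + if p l then 1 else 0 := by
  simp [hits, List.countP_cons]

/-- Average the weighted number of served requests over all nᵏ lists: some list does at least as
well as the mean. -/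
lemma exists_good_list {ι : Type u} [Fintype ι] {k : ℕ} {θ : ℝ} {good : ι → List V → Prop}
    {w : ι → ℝ} (hV : 0 < Fintype.card V) (hw : ∀ r, 0 ≤ w r)
    (hg : ∀ r, θ * (Fintype.card V : ℝ) ^ k ≤ lcnt k (good r)) :
    ∃ l : List V, l.length = k ∧ θ * ∑ r, w r ≤ ∑ r, w r * ind (good r l) := by
  set n : ℝ := (Fintype.card V : ℝ) with hn
  have hn0 : 0 < n := by rw [hn]; exact_mod_cast hV
  have hcard : ((listsIn (univ : Finset V) k).card : ℝ) = n ^ k := by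
    rw [card_listsIn, card_univ]; push_cast; rfl
  have hne : (listsIn (univ : Finset V) k).Nonempty := by
    rw [← card_pos]
    have : (0 : ℝ) < n ^ k := by positivity
    rw [← hcard] at this
    exact_mod_cast this
  have h1 : ∑ l ∈ listsIn (univ : Finset V) k, θ * ∑ r, w r ≤
      ∑ l ∈ listsIn (univ : Finset V) k, ∑ r, w r * ind (good r l) := by
    rw [sum_const, nsmul_eq_mul, hcard, sum_comm]
    calc n ^ k * (θ * ∑ r, w r) = ∑ r, w r * (θ * n ^ k) := by
          rw [← sum_mul]; ring
      _ ≤ ∑ r, w r * lcnt k (good r) := by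
          gcongr with r
          · exact hw r
          · exact hg r
      _ = _ := by
          refine sum_congr rfl fun r _ => ?_
          rw [lcnt_eq_ind, mul_sum]
  obtain ⟨l, hl, h⟩ := exists_le_of_sum_le hne h1
  exact ⟨l, mem_lists_univ.1 hl, h⟩

omit [Fintype V] in
lemma length_flatten_le {F : List (List V)} {k : ℕ} (h : ∀ l ∈ F, l.length = k) :
    F.flatten.length = k * F.length := by
  induction F with
  | nil => simp
  | cons l F ih =>
    rw [List.flatten_cons, List.length_append, ih fun m hm => h m (by simp [hm]), h l (by simp),
      List.length_cons]
    ring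

lemma good_available {k : ℕ} {θ : ℝ} {good : List V → Prop} {S : Finset V} (hk : 1 ≤ k)
    (hg : θ * (Fintype.card V : ℝ) ^ k ≤ lcnt k good)
    (hS : k * (S.card : ℝ) + k ^ 2 ≤ θ / 2 * Fintype.card V) :
    θ / 2 * (Fintype.card V : ℝ) ^ k ≤ lcnt k (fun l => good l ∧ l.Nodup ∧ ∀ v ∈ l, v ∉ S) := by
  set n : ℝ := (Fintype.card V : ℝ) with hn
  have h1 := lcnt_sub_le k good fun l => (∃ v ∈ l, v ∈ S) ∨ ¬ l.Nodup
  have h2 := lcnt_or_le k (fun l : List V => ∃ v ∈ l, v ∈ S) fun l => ¬ l.Nodup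
  have h3 := lcnt_meet_le k S
  have h4 := lcnt_not_nodup_le (V := V) k
  have h5 : lcnt k (fun l => good l ∧ ¬ ((∃ v ∈ l, v ∈ S) ∨ ¬ l.Nodup)) ≤
      lcnt k (fun l => good l ∧ l.Nodup ∧ ∀ v ∈ l, v ∉ S) :=
    lcnt_mono fun l _ hl => by push Not at hl; exact ⟨hl.1, hl.2.2, hl.2.1⟩
  have h6 : k * (S.card : ℝ) * n ^ (k - 1) + k ^ 2 * n ^ (k - 1) ≤ θ / 2 * n ^ k := by
    obtain ⟨k, rfl⟩ := Nat.exists_eq_add_of_le' hk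
    simp only [add_tsub_cancel_right]
    have : (0 : ℝ) ≤ n ^ k := by positivity
    calc _ = ((k + 1 : ℕ) * (S.card : ℝ) + (k + 1 : ℕ) ^ 2) * n ^ k := by ring
        _ ≤ θ / 2 * n * n ^ k := by gcongr
        _ = _ := by ring
  have e : θ / 2 * n ^ k = θ * n ^ k - θ / 2 * n ^ k := by ring
  rw [← hn] at h3 h4
  linarith

/-- **Selection lemma.** A small disjoint family hitting every request many times. -/
theorem exists_selection {k : ℕ} {θ γ : ℝ} (hk : 1 ≤ k) (hθ : 0 < θ) (hγ : 0 < γ) :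
    ∃ c : ℝ, 0 < c ∧ ∃ n₀ : ℕ, ∀ (V : Type u) [Fintype V], n₀ ≤ Fintype.card V →
      ∀ (ι : Type u) [Fintype ι] (good : ι → List V → Prop),
      (Fintype.card ι : ℝ) ≤ (Fintype.card V : ℝ) ^ 4 →
      (∀ r, θ * (Fintype.card V : ℝ) ^ k ≤ lcnt k (good r)) →
      ∃ F : List (List V), (∀ l ∈ F, l.length = k ∧ ∃ r, good r l) ∧ F.flatten.Nodup ∧
        (F.length : ℝ) ≤ γ * Fintype.card V ∧
        ∀ r, c * Fintype.card V ≤ (hits F (good r) : ℝ) := by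
  wlog hθ1 : θ ≤ 1 generalizing θ
  · obtain ⟨c, hc, n₀, h⟩ := this one_pos le_rfl
    refine ⟨c, hc, n₀, fun V _ hV ι _ good hι hg => h V hV ι good hι fun r => le_trans ?_ (hg r)⟩
    gcongr
    linarith
  have hk0 : (1 : ℝ) ≤ k := by exact_mod_cast hk
  -- While at most δn lists have been taken, the used vertices and the repetitions spoil at most
  -- half of the good lists of any request.
  set δ := min γ (θ / (4 * k ^ 2)) with hδ
  have hδ0 : 0 < δ := by positivity
  have hev : ∀ᶠ n : ℕ in Filter.atTop, 4 * (k : ℝ) ^ 2 / θ ≤ n ∧ 1 ≤ n ∧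
      4 * Real.log n + 1 ≤ θ * δ / 8 * n := by
    have h1 : ∀ᶠ x : ℝ in Filter.atTop, ‖Real.log x‖ ≤ θ * δ / 64 * ‖x‖ :=
      Real.isLittleO_log_id_atTop.def (by positivity)
    filter_upwards [tendsto_natCast_atTop_atTop.eventually h1, Filter.eventually_ge_atTop 1,
      tendsto_natCast_atTop_atTop.eventually (Filter.eventually_ge_atTop (4 * (k : ℝ) ^ 2 / θ)),
      tendsto_natCast_atTop_atTop.eventually (Filter.eventually_ge_atTop (16 / (θ * δ)))]
      with n h1 h2 h3 h4
    refine ⟨h3, h2, ?_⟩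
    rw [div_le_iff₀ (by positivity)] at h4
    have h5 := (le_abs_self _).trans h1
    rw [Real.norm_of_nonneg (Nat.cast_nonneg n)] at h5
    linarith
  obtain ⟨n₀, hn₀⟩ := Filter.eventually_atTop.1 hev
  refine ⟨θ * δ / 8, by positivity, n₀, fun V _ hV ι _ good hι hg => ?_⟩
  set n : ℝ := (Fintype.card V : ℝ) with hn
  obtain ⟨hn1, hn2, hn3⟩ := hn₀ _ hV
  rw [← hn] at hn1 hn3
  have hn0 : 0 < n := by rw [hn]; exact_mod_cast hn2
  rcases isEmpty_or_nonempty ι with hι0 | hι0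
  · exact ⟨[], by simp, by simp, by simp; positivity, fun r => isEmptyElim r⟩
  -- A request hit j times has weight 2⁻ʲ. The list chosen next serves at least a share θ/2 of the
  -- total weight and halves the weight of what it serves, so the total falls by the factor 1 - θ/4.
  have key : ∀ N : ℕ, (N : ℝ) ≤ δ * n → ∃ F : List (List V),
      (∀ l ∈ F, l.length = k ∧ ∃ r, good r l) ∧ F.flatten.Nodup ∧ F.length = N ∧
      ∑ r, (1 / 2 : ℝ) ^ hits F (good r) ≤ (1 - θ / 4) ^ N * Fintype.card ι := by
    intro N
    induction N with
    | zero => exact fun _ => ⟨[], by simp, by simp, by simp, by simp [hits]⟩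
    | succ N ih =>
      intro hN
      push_cast at hN
      obtain ⟨F, hF1, hF2, hF3, hF4⟩ := ih (by linarith)
      have hS : k * (F.flatten.toFinset.card : ℝ) + k ^ 2 ≤ θ / 2 * n := by
        have h1 : (F.flatten.toFinset.card : ℝ) ≤ k * N := by
          rw [← hF3]
          exact_mod_cast (List.toFinset_card_le _).trans
            (length_flatten_le fun l hl => (hF1 l hl).1).le
        rw [div_le_iff₀ hθ] at hn1
        have h2 : δ ≤ θ / (4 * k ^ 2) := min_le_right _ _
        rw [le_div_iff₀ (by positivity)] at h2
        have h3 : k ^ 2 * (N : ℝ) ≤ k ^ 2 * (δ * n) := by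
          refine mul_le_mul_of_nonneg_left ?_ (by positivity)
          linarith
        have h4 : δ * (4 * k ^ 2) * n ≤ θ * n := by gcongr
        have h5 : k * (F.flatten.toFinset.card : ℝ) ≤ k * (k * N) := by gcongr
        nlinarith
      obtain ⟨l, hl, hsum⟩ := exists_good_list (w := fun r => (1 / 2 : ℝ) ^ hits F (good r))
        (by omega) (fun r => by positivity) fun r => good_available hk (hg r) hS
      have hpos : 0 < ∑ r, (1 / 2 : ℝ) ^ hits F (good r) :=
        sum_pos (fun r _ => by positivity) univ_nonempty
      -- The list carries positive weight, so it serves some request; this also yields that it has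
      -- no repetition and avoids the used vertices.
      have hex : ∃ r, good r l ∧ l.Nodup ∧ ∀ v ∈ l, v ∉ F.flatten.toFinset := by
        by_contra! hcon
        have h0 : ∑ r, (1 / 2 : ℝ) ^ hits F (good r) *
            ind (good r l ∧ l.Nodup ∧ ∀ v ∈ l, v ∉ F.flatten.toFinset) = 0 := by
          refine sum_eq_zero fun r _ => ?_
          rw [ind_of_not, mul_zero]
          intro hh
          obtain ⟨v, hv1, hv2⟩ := hcon r hh.1 hh.2.1
          exact hh.2.2 v hv1 hv2
        rw [h0] at hsum
        have : 0 < θ / 2 * ∑ r, (1 / 2 : ℝ) ^ hits F (good r) := by positivity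
        linarith
      obtain ⟨r, hr, hnd, hav⟩ := hex
      refine ⟨l :: F, ?_, ?_, by simp [hF3], ?_⟩
      · intro m hm
        rcases List.mem_cons.1 hm with rfl | hm
        · exact ⟨hl, r, hr⟩
        · exact hF1 m hm
      · rw [List.flatten_cons, List.nodup_append]
        exact ⟨hnd, hF2, fun a ha b hb e => hav a ha (by rw [List.mem_toFinset, e]; exact hb)⟩
      · have h1 : ∀ r, (1 / 2 : ℝ) ^ hits (l :: F) (good r) ≤ (1 / 2 : ℝ) ^ hits F (good r) -
            1 / 2 * ((1 / 2 : ℝ) ^ hits F (good r) *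
            ind (good r l ∧ l.Nodup ∧ ∀ v ∈ l, v ∉ F.flatten.toFinset)) := by
          intro r
          rw [hits_cons]
          by_cases hr : good r l
          · have : ind (good r l ∧ l.Nodup ∧ ∀ v ∈ l, v ∉ F.flatten.toFinset) = 1 := by
              simp only [ind, hr, hnd, true_and]
              exact if_pos hav
            rw [this, if_pos hr, pow_succ]
            linarith
          · rw [if_neg hr, ind_of_not (fun hh => hr hh.1)]
            simp
        refine (sum_le_sum fun r _ => h1 r).trans ?_
        rw [sum_sub_distrib, ← mul_sum]
        have h2 : (1 - θ / 4) * ∑ r, (1 / 2 : ℝ) ^ hits F (good r) ≤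
            (1 - θ / 4) * ((1 - θ / 4) ^ N * Fintype.card ι) :=
          mul_le_mul_of_nonneg_left hF4 (by linarith)
        rw [pow_succ]
        linarith
  obtain ⟨F, hF1, hF2, hF3, hF4⟩ := key ⌊δ * n⌋₊ (Nat.floor_le (by positivity))
  refine ⟨F, hF1, hF2, ?_, fun r => ?_⟩
  · rw [hF3]
    refine (Nat.floor_le (by positivity)).trans ?_
    have : δ ≤ γ := min_le_left _ _
    gcongr
  · set N := ⌊δ * n⌋₊
    have h1 : (1 / 2 : ℝ) ^ hits F (good r) ≤ (1 - θ / 4) ^ N * n ^ 4 := by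
      refine (single_le_sum (f := fun r => (1 / 2 : ℝ) ^ hits F (good r))
        (fun r _ => by positivity) (mem_univ r)).trans (hF4.trans ?_)
      have : 0 ≤ 1 - θ / 4 := by linarith
      gcongr
    -- Since 1/e ≤ 1/2, the single weight of r is at least exp(-hits). Comparison with the total
    -- weight gives hits ≥ θN/4 - 4 log n, where the 4 is the exponent in the bound on the number of
    -- requests.
    have h2 : Real.exp (-(hits F (good r) : ℝ)) ≤ (1 / 2 : ℝ) ^ hits F (good r) := by
      have : Real.exp (-1) ≤ 1 / 2 := by
        rw [Real.exp_neg, inv_le_comm₀ (Real.exp_pos _) (by norm_num)]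
        have := Real.add_one_le_exp (1 : ℝ)
        norm_num at *
        linarith
      calc Real.exp (-(hits F (good r) : ℝ)) = Real.exp (-1) ^ hits F (good r) := by
            rw [← Real.exp_nat_mul]; ring_nf
        _ ≤ _ := by gcongr
    have h3 : (1 - θ / 4) ^ N ≤ Real.exp (-(θ / 4 * N)) := by
      calc (1 - θ / 4) ^ N ≤ Real.exp (-(θ / 4)) ^ N := by
            have := Real.add_one_le_exp (-(θ / 4))
            have h0 : 0 ≤ 1 - θ / 4 := by linarith
            gcongr
            linarith
        _ = _ := by rw [← Real.exp_nat_mul]; ring_nf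
    have h4 : n ^ 4 = Real.exp (4 * Real.log n) := by
      rw [mul_comm, Real.exp_mul, Real.exp_log hn0]
      norm_cast
    have h5 : Real.exp (-(hits F (good r) : ℝ)) ≤ Real.exp (-(θ / 4 * N) + 4 * Real.log n) := by
      rw [Real.exp_add, ← h4]
      refine h2.trans (h1.trans ?_)
      gcongr
    rw [Real.exp_le_exp] at h5
    have h6 : δ * n < N + 1 := Nat.lt_floor_add_one _
    have h7 : θ / 4 * (δ * n) ≤ θ / 4 * (N + 1) := by gcongr
    linarith

end Selection

/-! ### The absorbing path. -/

section AbsorbingPath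

variable {V : Type u}

lemma flatMap_update_perm {F : List (List V)} (hF : F.Nodup) {e : List V → List V} {t : List V}
    (ht : t ∈ F) (he : e t = []) (v : V) :
    (F.flatMap (Function.update e t [v])).Perm (v :: F.flatMap e) := by
  obtain ⟨F₁, F₂, rfl⟩ := List.append_of_mem ht
  rw [List.nodup_append, List.nodup_cons] at hF
  have h1 : ∀ s ∈ F₁, Function.update e t [v] s = e s := fun s hs =>
    Function.update_of_ne (fun h => hF.2.2 s hs t (by simp) h) _ _
  have h2 : ∀ s ∈ F₂, Function.update e t [v] s = e s := fun s hs =>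
    Function.update_of_ne (fun h : s = t => hF.2.1.1 (h ▸ hs)) _ _
  simp only [List.flatMap_append, List.flatMap_cons, Function.update_self, he, List.nil_append]
  rw [List.flatMap_congr h1, List.flatMap_congr h2]
  simp

/-- Greedy assignment of the entries of `S` to members of `F`. -/
lemma exists_assignment {F : List (List V)} (hF : F.Nodup) {p : V → List V → Prop} (S : List V)
    (hS : ∀ v ∈ S, S.length ≤ hits F (p v)) :
    ∃ e : List V → List V, (∀ t, e t = [] ∨ ∃ v, e t = [v] ∧ p v t) ∧ (F.flatMap e).Perm S := by
  induction S with
  | nil => exact ⟨fun _ => [], fun t => Or.inl rfl, by simp⟩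
  | cons v S ih =>
    obtain ⟨e, he1, he2⟩ := ih fun w hw => by
      have := hS w (by simp [hw])
      simp only [List.length_cons] at this
      omega
    have hlen : F.countP (fun t => e t ≠ []) = S.length := by
      rw [← he2.length_eq, List.length_flatMap]
      have : ∀ t, (e t).length = if e t ≠ [] then 1 else 0 := by
        intro t
        rcases he1 t with h | ⟨w, h, _⟩ <;> simp [h]
      clear he2 hS ih hF
      induction F with
      | nil => simp
      | cons t F ih => 
        rw [List.countP_cons, ih, List.map_cons, List.sum_cons, this t]
        simp only [decide_eq_true_eq]
        omega
    have hex : ∃ t ∈ F, p v t ∧ e t = [] := by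
      by_contra! hcon
      have h1 : hits F (p v) ≤ F.countP (fun t => e t ≠ []) :=
        List.countP_mono_left fun t ht h => by
          simp only [decide_eq_true_eq] at *
          exact hcon t ht h
      have h2 := hS v (by simp)
      simp only [List.length_cons] at h2
      omega
    obtain ⟨t, ht, hp, het⟩ := hex
    refine ⟨Function.update e t [v], fun s => ?_, (flatMap_update_perm hF ht het v).trans
      (he2.cons v)⟩
    by_cases hs : s = t
    · subst hs
      exact Or.inr ⟨v, by simp, hp⟩
    · rw [Function.update_of_ne hs]
      exact he1 s

variable [Fintype V] {T : TripleSystem V} {Y : V → Finset V} {α μ β ζ : ℝ} {h : ℕ}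

/-- The path `t` can be replaced by a path with the same ends on the vertices of `t ++ s`. -/
def Absorbs (T : TripleSystem V) (t s : List V) : Prop :=
  ∀ a b c d, HasEnds t a b c d → ∃ t', t'.Perm (t ++ s) ∧ T.Tight t' ∧ HasEnds t' a b c d

/-- A tight path with connectable ends. -/
def ConnPath (T : TripleSystem V) (Y : V → Finset V) (B : Finset V) (ζ : ℝ) (t : List V)
    (a b c d : V) : Prop :=
  HasEnds t a b c d ∧ T.Tight t ∧ Conn T Y B ζ a b ∧ Conn T Y B ζ c d

omit [Fintype V] in
lemma TripleSystem.HasEnds.unique {l : List V} {a b c d a' b' c' d' : V} (h1 : HasEnds l a b c d)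
    (h2 : HasEnds l a' b' c' d') : a = a' ∧ b = b' ∧ c = c' ∧ d = d' := by
  obtain ⟨m, rfl⟩ := h1
  obtain ⟨m', h⟩ := h2
  simp only [List.cons.injEq] at h
  have h3 := List.append_inj_right' h.2.2 (by simp)
  simp only [List.cons.injEq] at h3
  exact ⟨h.1, h.2.1, h3.1, h3.2.1⟩

lemma Absorber.absorbs {v : V} {t : List V} (ht : Absorber T Y ζ v t) : Absorbs T t [v] := by
  obtain ⟨a, b, c, d, h1, _, _, _, t', h2, h3, h4⟩ := ht
  intro a' b' c' d' h'
  obtain ⟨rfl, rfl, rfl, rfl⟩ := h1.unique h'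
  exact ⟨t', h2.trans (List.perm_append_singleton _ _).symm, h3, h4⟩

/-- A connecting path avoiding a small set of used vertices. -/
lemma RobustLinks.exists_connection (hR : RobustLinks T α μ β h Y) (hβ : 0 < β) (hα : 0 < α)
    (hμ : 4 * μ ≤ α) (hζ : 0 < ζ) {θ : ℝ}
    (hθ : θ = ζ ^ 2 * α / 4 * ((ζ ^ 2 * α / 4 * β / 4) ^ (h + 2)) ^ 2) {S : Finset V}
    (hS : ((6 * h + 4 : ℕ) : ℝ) * S.card + ((6 * h + 4 : ℕ) : ℝ) ^ 2 ≤ θ / 2 * Fintype.card V)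
    {x y z w : V} (hxy : Conn T Y ∅ ζ x y) (hzw : Conn T Y ∅ ζ z w) :
    ∃ l : List V, l.length = 6 * h + 4 ∧ T.Tight ([x, y] ++ l ++ [z, w]) ∧ l.Nodup ∧
      ∀ v ∈ l, v ∉ S := by
  have hn0 := hR.pos
  have h1 := hR.connect hβ hα hμ hζ (B := ∅)
    (by rw [card_empty, Nat.cast_zero]; positivity) hxy hzw
  rw [← hθ] at h1
  have h2 := good_available (by omega) h1 hS
  have hθ0 : 0 < θ := by rw [hθ]; positivity
  have h3 := lt_of_lt_of_le (show 0 < θ / 2 * (Fintype.card V : ℝ) ^ (6 * h + 4) by positivity) h2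
  rw [← card_lfil] at h3
  obtain ⟨l, hl⟩ := card_pos.1 (Nat.cast_pos.1 h3)
  rw [mem_lfil] at hl
  exact ⟨l, hl.1, by simpa using hl.2.1.2, hl.2.2⟩

/-- Joining a family of disjoint paths to a single path, keeping all absorbing possibilities. -/
lemma RobustLinks.exists_joined (hR : RobustLinks T α μ β h Y) (hβ : 0 < β) (hα : 0 < α)
    (hμ : 4 * μ ≤ α) (hζ : 0 < ζ) {θ : ℝ}
    (hθ : θ = ζ ^ 2 * α / 4 * ((ζ ^ 2 * α / 4 * β / 4) ^ (h + 2)) ^ 2) {k : ℕ} {U : Finset V}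
    (F : List (List V)) (hF : F ≠ []) (hnd : F.flatten.Nodup) (hU : ∀ v ∈ F.flatten, v ∈ U)
    (hlen : ∀ t ∈ F, t.length = k) (hpath : ∀ t ∈ F, ∃ a b c d, ConnPath T Y ∅ ζ t a b c d)
    (hsmall : ((6 * h + 4 : ℕ) : ℝ) * (U.card + ((k + (6 * h + 4) : ℕ) : ℝ) * F.length) +
      ((6 * h + 4 : ℕ) : ℝ) ^ 2 ≤ θ / 2 * Fintype.card V) :
    ∃ P a b c d, ConnPath T Y ∅ ζ P a b c d ∧ P.Nodup ∧
      P.length ≤ (k + (6 * h + 4)) * F.length ∧ (∀ v ∈ P, v ∈ F.flatten ∨ v ∉ U) ∧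
      (∀ v ∈ F.flatten, v ∈ P) ∧
      ∀ e : List V → List V, (∀ t ∈ F, Absorbs T t (e t)) → Absorbs T P (F.flatMap e) := by
  induction F with
  | nil => exact absurd rfl hF
  | cons t F ih =>
    rcases eq_or_ne F [] with rfl | hF'
    · obtain ⟨a, b, c, d, hp⟩ := hpath t (by simp)
      refine ⟨t, a, b, c, d, hp, by simpa using hnd, ?_, fun v hv => Or.inl (by simpa using hv),
        by simp, fun e he => by simpa using he t (by simp)⟩
      have := hlen t (by simp)
      simp only [List.length_cons, List.length_nil]
      omega
    · rw [List.flatten_cons, List.nodup_append] at hnd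
      obtain ⟨P, a, b, c, d, ⟨hP1, hP2, hP3, hP4⟩, hP5, hP6, hP7, hP8, hP9⟩ := ih hF' hnd.2.1
        (fun v hv => hU v (by rw [List.flatten_cons, List.mem_append]; exact Or.inr hv))
        (fun s hs => hlen s (by simp [hs]))
        (fun s hs => hpath s (by simp [hs])) (by
          refine le_trans ?_ hsmall
          gcongr
          simp)
      obtain ⟨a', b', c', d', ht1, ht2, ht3, ht4⟩ := hpath t (by simp)
      -- The connection must avoid U, which contains all members of the family, as well as
      -- everything already joined.
      obtain ⟨w, hw1, hw2, hw3, hw4⟩ := hR.exists_connection hβ hα hμ hζ hθ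
        (S := U ∪ P.toFinset) (by
          refine le_trans ?_ hsmall
          have h1 : ((U ∪ P.toFinset).card : ℝ) ≤
              U.card + ((k + (6 * h + 4) : ℕ) : ℝ) * (t :: F).length := by
            have h2 := card_union_le U P.toFinset
            have h3 := List.toFinset_card_le P
            have h4 : (k + (6 * h + 4)) * F.length ≤ (k + (6 * h + 4)) * (t :: F).length := by
              gcongr
              simp
            exact_mod_cast (by omega)
          gcongr) ht4 hP3
      have htU : ∀ v ∈ t, v ∈ U := fun v hv => hU v (by simp [hv])
      refine ⟨t ++ w ++ P, a', b', c, d, ⟨ht1.join w hP1, (tight_join ht1 hP1).2 ⟨ht2, hw2, hP2⟩,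
        ht3, hP4⟩, ?_, ?_, ?_, ?_, ?_⟩
      · rw [List.nodup_append, List.nodup_append]
        refine ⟨⟨hnd.1, hw3, fun u hu v hv e => hw4 v hv ?_⟩, hP5, fun u hu v hv e => ?_⟩
        · rw [mem_union]; exact Or.inl (e ▸ htU u hu)
        · subst e
          rcases List.mem_append.1 hu with hu | hu
          · rcases hP7 u hv with h1 | h1
            · exact hnd.2.2 u hu u h1 rfl
            · exact h1 (htU u hu)
          · exact hw4 u hu (by simp [hv])
      · simp only [List.length_append, List.length_cons, hw1, hlen t (by simp)]
        nlinarith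
      · intro v hv
        rw [List.flatten_cons, List.mem_append]
        rcases List.mem_append.1 hv with hv | hv
        · rcases List.mem_append.1 hv with hv | hv
          · exact Or.inl (Or.inl hv)
          · exact Or.inr fun hU' => hw4 v hv (by simp [hU'])
        · rcases hP7 v hv with h1 | h1
          · exact Or.inl (Or.inr h1)
          · exact Or.inr h1
      · intro v hv
        rw [List.flatten_cons, List.mem_append] at hv
        rcases hv with hv | hv
        · simp [hv]
        · simp [hP8 v hv]
      · intro e he x y z z' hxy
        obtain ⟨rfl, rfl, rfl, rfl⟩ := (ht1.join w hP1).unique hxy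
        obtain ⟨t', q1, q2, q3⟩ := he t (by simp) _ _ _ _ ht1
        obtain ⟨P', r1, r2, r3⟩ := hP9 e (fun s hs => he s (by simp [hs])) _ _ _ _ hP1
        refine ⟨t' ++ w ++ P', ?_, (tight_join q3 r3).2 ⟨q2, hw2, r2⟩, q3.join w r3⟩
        refine ((q1.append_right w).append r1).trans ?_
        rw [List.perm_iff_count]
        intro v
        simp only [List.count_append, List.flatMap_cons]
        ring

/-- A short path with connectable ends which absorbs every small set of vertices. -/
theorem exists_absorbing_path {α μ β : ℝ} {h : ℕ} (hα : 0 < α) (hβ : 0 < β) (hμ : 6 * μ ≤ α)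
    (hμ0 : 0 < μ) :
    ∃ ζ : ℝ, 0 < ζ ∧ ∀ γ : ℝ, 0 < γ → ∃ c : ℝ, 0 < c ∧ ∃ n₀ : ℕ, ∀ (V : Type u) [Fintype V]
      (T : TripleSystem V) (Y : V → Finset V), n₀ ≤ Fintype.card V → RobustLinks T α μ β h Y →
      ∃ P a b c' d, ConnPath T Y ∅ ζ P a b c' d ∧ P.Nodup ∧ (P.length : ℝ) ≤ γ * Fintype.card V ∧
        ∀ S : List V, (S.length : ℝ) ≤ c * Fintype.card V → Absorbs T P S := by
  obtain ⟨ζ, hζ, η, hη, habs⟩ := exists_many_absorbers.{u} (h := h) hα hβ hμ hμ0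
  refine ⟨ζ, hζ, fun γ hγ => ?_⟩
  set θ := ζ ^ 2 * α / 4 * ((ζ ^ 2 * α / 4 * β / 4) ^ (h + 2)) ^ 2 with hθ
  have hθ0 : 0 < θ := by positivity
  -- The length of one absorber plus one connection.
  set K : ℝ := ((6 * h + 19 + (6 * h + 4) : ℕ) : ℝ) with hK
  have hK0 : 1 ≤ K := by rw [hK]; exact_mod_cast (by omega)
  -- The first bound keeps the joined path below γn vertices; the second keeps the set to be avoided
  -- small enough for `RobustLinks.exists_connection` at every joining step.
  set γ' := min (γ / K) (θ / (8 * K ^ 2)) with hγ'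
  obtain ⟨c, hc, n₀, hsel⟩ := exists_selection.{u} (k := 6 * h + 19) (θ := η) (γ := γ') (by omega)
    hη (by positivity)
  refine ⟨c, hc, max (max n₀ 1) ⌈4 * K ^ 2 / θ⌉₊, fun V _ T Y hV hR => ?_⟩
  set n : ℝ := (Fintype.card V : ℝ) with hn
  have hn0 : 0 < n := hR.pos
  have hn1 : 1 ≤ n := by
    rw [hn]
    exact_mod_cast (le_max_right _ _).trans ((le_max_left _ _).trans hV)
  have hn2 : 4 * K ^ 2 / θ ≤ n := by
    refine (Nat.le_ceil _).trans ?_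
    rw [hn]
    exact_mod_cast (le_max_right _ _).trans hV
  obtain ⟨F, hF1, hF2, hF3, hF4⟩ := hsel V ((le_max_left _ _).trans ((le_max_left _ _).trans hV)) V
    (fun v => Absorber T Y ζ v) (by rw [← hn]; exact le_self_pow₀ hn1 (by norm_num))
    (habs V T Y hR)
  rw [← hn] at hF3 hF4
  have hFnd : F.Nodup := by
    rw [List.nodup_flatten] at hF2
    refine hF2.2.imp_of_mem fun {s t} hs ht hst e => ?_
    subst e
    have := (hF1 s hs).1
    obtain ⟨x, hx⟩ := List.exists_mem_of_length_pos (l := s) (by omega)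
    exact hst hx hx
  have hFne : F ≠ [] := by
    rintro rfl
    obtain ⟨v⟩ : Nonempty V := Fintype.card_pos_iff.1 (by have := hR.card2; omega)
    have := hF4 v
    simp only [hits, List.countP_nil, Nat.cast_zero] at this
    have : 0 < c * n := by positivity
    linarith
  have hsmall : ((6 * h + 4 : ℕ) : ℝ) * (F.flatten.toFinset.card +
      ((6 * h + 19 + (6 * h + 4) : ℕ) : ℝ) * F.length) + ((6 * h + 4 : ℕ) : ℝ) ^ 2 ≤ θ / 2 * n := by
    have h1 : (F.flatten.toFinset.card : ℝ) ≤ K * F.length := by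
      have h2 := List.toFinset_card_le F.flatten
      rw [length_flatten_le fun l hl => (hF1 l hl).1] at h2
      have h3 : (6 * h + 19) * F.length ≤ (6 * h + 19 + (6 * h + 4)) * F.length :=
        Nat.mul_le_mul_right _ (by omega)
      rw [hK]
      exact_mod_cast h2.trans h3
    have h4 : ((6 * h + 4 : ℕ) : ℝ) ≤ K := by rw [hK]; exact_mod_cast (by omega)
    have h5 : (F.length : ℝ) ≤ θ / (8 * K ^ 2) * n :=
      hF3.trans (mul_le_mul_of_nonneg_right (min_le_right _ _) hn0.le)
    have h6 : K * (K * F.length + K * F.length) ≤ θ / 4 * n := by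
      calc K * (K * F.length + K * F.length) = 2 * K ^ 2 * F.length := by ring
        _ ≤ 2 * K ^ 2 * (θ / (8 * K ^ 2) * n) := by gcongr
        _ = _ := by field_simp; ring
    have h7 : K ^ 2 ≤ θ / 4 * n := by
      rw [div_le_iff₀ hθ0] at hn2
      linarith
    calc _ ≤ K * (K * F.length + K * F.length) + K ^ 2 := by
          rw [← hK]; gcongr
      _ ≤ _ := by linarith
  obtain ⟨P, a, b, c', d, hP1, hP2, hP3, -, -, hP4⟩ := hR.exists_joined hβ hα (by linarith) hζ hθ
    (k := 6 * h + 19) (U := F.flatten.toFinset) F hFne hF2 (fun v hv => by simpa using hv)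
    (fun t ht => (hF1 t ht).1) (fun t ht => by
      obtain ⟨v, a, b, c, d, h1, h2, h3, h4, -⟩ := (hF1 t ht).2
      exact ⟨a, b, c, d, h1, h2, h3, h4⟩) hsmall
  refine ⟨P, a, b, c', d, hP1, hP2, ?_, fun S hS => ?_⟩
  · have h1 : (P.length : ℝ) ≤ K * F.length := by rw [hK]; exact_mod_cast hP3
    calc (P.length : ℝ) ≤ K * F.length := h1
      _ ≤ K * (γ / K * n) := by
        gcongr
        exact hF3.trans (mul_le_mul_of_nonneg_right (min_le_left _ _) hn0.le)
      _ = γ * n := by field_simp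
  · obtain ⟨e, he1, he2⟩ := exists_assignment hFnd (p := Absorber T Y ζ) S fun v _ => by
      have := hS.trans (hF4 v)
      exact_mod_cast this
    intro x y z w hxy
    obtain ⟨P', q1, q2, q3⟩ := hP4 e (fun t ht => by
      rcases he1 t with h1 | ⟨v, h1, h2⟩
      · rw [h1]
        intro a b c d hab
        obtain ⟨v, a', b', c', d', g1, g2, -⟩ := (hF1 t ht).2
        exact ⟨t, by simp, g2, hab⟩
      · rw [h1]; exact h2.absorbs) x y z w hxy
    exact ⟨P', q1.trans (he2.append_left P), q2, q3⟩

end AbsorbingPath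

/-! ### Large matchings in dense graphs. -/

section Matching

variable {J : Type*} [Fintype J]

/-- The permutation `g` exchanges the ends of the edges of a matching in `G`. -/
def IsMatching (G : J → J → Prop) (g : Equiv.Perm J) : Prop :=
  (∀ x, g (g x) = x) ∧ ∀ x, g x ≠ x → G x (g x)

/-- The number of vertices moved by `g`. -/
noncomputable def moved (g : Equiv.Perm J) : ℕ := (fil fun x => g x ≠ x).card

variable {G : J → J → Prop} {g : Equiv.Perm J}

lemma IsMatching.add (hg : IsMatching G g) (hG : ∀ a b, G a b → G b a) {x y : J} (hx : g x = x)
    (hy : g y = y) (hxy : x ≠ y) (h : G x y) :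
    ∃ g', IsMatching G g' ∧ moved g' = moved g + 2 ∧ g' x = y ∧ g' y = x ∧
      ∀ z, z ≠ x → z ≠ y → g' z = g z := by
  have h1 : (Equiv.swap x y * g) x = y := by simp [hx]
  have h2 : (Equiv.swap x y * g) y = x := by simp [hy]
  have h3 : ∀ z, z ≠ x → z ≠ y → (Equiv.swap x y * g) z = g z := by
    intro z hzx hzy
    rw [Equiv.Perm.mul_apply, Equiv.swap_apply_of_ne_of_ne]
    · intro e; exact hzx (g.injective (e.trans hx.symm))
    · intro e; exact hzy (g.injective (e.trans hy.symm))
  refine ⟨Equiv.swap x y * g, ⟨fun z => ?_, fun z hz => ?_⟩, ?_, h1, h2, h3⟩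
  · by_cases hzx : z = x
    · rw [hzx, h1, h2]
    by_cases hzy : z = y
    · rw [hzy, h2, h1]
    rw [h3 z hzx hzy, h3, hg.1]
    · intro e; exact hzx (g.injective (e.trans hx.symm))
    · intro e; exact hzy (g.injective (e.trans hy.symm))
  · by_cases hzx : z = x
    · rw [hzx, h1]; exact h
    by_cases hzy : z = y
    · rw [hzy, h2]; exact hG _ _ h
    rw [h3 z hzx hzy] at hz ⊢
    exact hg.2 z hz
  · have e : (fil fun z => (Equiv.swap x y * g) z ≠ z) = insert x (insert y (fil fun z => g z ≠ z)) := by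
      ext z
      rw [mem_insert, mem_insert, mem_fil, mem_fil]
      by_cases hzx : z = x
      · subst hzx; rw [h1]; simp [hxy.symm]
      by_cases hzy : z = y
      · subst hzy; rw [h2]; simp [hxy]
      rw [h3 z hzx hzy]
      simp [hzx, hzy]
    unfold moved
    rw [e, card_insert_of_notMem, card_insert_of_notMem]
    · rw [mem_fil]; simp [hy]
    · rw [mem_insert, mem_fil]; simp [hx, hxy]

lemma IsMatching.remove (hg : IsMatching G g) {x : J} (hx : g x ≠ x) :
    ∃ g', IsMatching G g' ∧ moved g = moved g' + 2 ∧ g' x = x ∧ g' (g x) = g x ∧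
      ∀ z, z ≠ x → z ≠ g x → g' z = g z := by
  have h1 : (Equiv.swap x (g x) * g) x = x := by simp
  have h2 : (Equiv.swap x (g x) * g) (g x) = g x := by simp [hg.1]
  have h3 : ∀ z, z ≠ x → z ≠ g x → (Equiv.swap x (g x) * g) z = g z := by
    intro z hzx hzy
    rw [Equiv.Perm.mul_apply, Equiv.swap_apply_of_ne_of_ne]
    · intro e; exact hzy (by rw [← e, hg.1])
    · intro e; exact hzx (g.injective e)
  refine ⟨Equiv.swap x (g x) * g, ⟨fun z => ?_, fun z hz => ?_⟩, ?_, h1, h2, h3⟩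
  · by_cases hzx : z = x
    · rw [hzx, h1, h1]
    by_cases hzy : z = g x
    · rw [hzy, h2, h2]
    rw [h3 z hzx hzy, h3, hg.1]
    · intro e; exact hzy (by rw [← e, hg.1])
    · intro e; exact hzx (g.injective e)
  · by_cases hzx : z = x
    · rw [hzx, h1] at hz; exact absurd rfl hz
    by_cases hzy : z = g x
    · rw [hzy, h2] at hz; exact absurd rfl hz
    rw [h3 z hzx hzy] at hz ⊢
    exact hg.2 z hz
  · have e : (fil fun z => g z ≠ z) =
        insert x (insert (g x) (fil fun z => (Equiv.swap x (g x) * g) z ≠ z)) := by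
      ext z
      rw [mem_insert, mem_insert, mem_fil, mem_fil]
      by_cases hzx : z = x
      · subst hzx; simp [hx]
      by_cases hzy : z = g x
      · subst hzy; simp [hg.1, hx.symm]
      rw [h3 z hzx hzy]
      simp [hzx, hzy]
    unfold moved
    rw [e, card_insert_of_notMem, card_insert_of_notMem]
    · rw [mem_fil, h2]; simp
    · rw [mem_insert, mem_fil, h1]; simp [hx.symm]

/-- The structure of a maximum matching bounds the number of edges. -/
lemma exists_matching_bound (hG : ∀ a b, G a b → G b a) (hirr : ∀ a, ¬ G a a) {S : Finset J}
    (hS : ∀ a b, G a b → a ∈ S) :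
    ∃ g, IsMatching G g ∧ ∃ x : ℝ, 0 ≤ x ∧ x ≤ moved g / 2 ∧ moved g ≤ S.card ∧
      cnt (fun z : J × J => G z.1 z.2) ≤
        (moved g : ℝ) ^ 2 - x ^ 2 + 2 * x * (S.card - moved g) + 2 * moved g := by
  obtain ⟨g, hgm, hmax⟩ := exists_max_image (fil (IsMatching G))
    moved ⟨1, mem_fil.2 ⟨fun x => rfl, fun x h => absurd rfl h⟩⟩
  have hg : IsMatching G g := mem_fil.1 hgm
  have hmax' : ∀ g', IsMatching G g' → moved g' ≤ moved g := fun g' h => hmax g' (mem_fil.2 h)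
  clear hgm hmax
  set d : J → ℝ := fun x => cnt fun y => g y = y ∧ G x y with hd
  have hd1 : ∀ x, ¬ 2 ≤ d x → d x ≤ 1 := by
    intro x hx
    simp only [hd, cnt] at *
    norm_cast at *
    omega
  have hnb : ∀ x r, 2 ≤ d x → ∃ p, g p = p ∧ G x p ∧ p ≠ r := by
    intro x r hx
    have h1 : cnt (fun y => y = r) < d x := by
      refine lt_of_le_of_lt ?_ (lt_of_lt_of_le one_lt_two hx)
      have := cnt_mem ({r} : Finset J)
      simp only [mem_singleton, card_singleton, Nat.cast_one] at this
      exact this.le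
    obtain ⟨p, hp, hpr⟩ := exists_of_cnt_lt h1
    exact ⟨p, hp.1, hp.2, hpr⟩
  have hindep : ∀ x y, g x = x → g y = y → ¬ G x y := by
    intro x y hx hy h
    obtain ⟨g', h1, h2, -⟩ := hg.add hG hx hy (fun e => hirr y (e ▸ h)) h
    have := hmax' g' h1
    omega
  -- Matched vertices with at least two unmatched neighbours. They serve as inner vertices of
  -- augmenting paths, and having two neighbours allows the two ends of such a path to be chosen
  -- distinct.
  set A := fil (fun x => g x ≠ x ∧ 2 ≤ d x) with hA
  have hmemA : ∀ x, x ∈ A ↔ g x ≠ x ∧ 2 ≤ d x := fun x => mem_fil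
  have hne : ∀ {x p}, g x ≠ x → g p = p → x ≠ p := fun hx hp e => hx (e ▸ hp)
  -- Otherwise p, x, g x, q is an augmenting path.
  have hAg : ∀ x ∈ A, g x ∉ A := by
    intro x hx hgx
    rw [hmemA] at hx hgx
    obtain ⟨p, hp1, hp2, -⟩ := hnb x x hx.2
    obtain ⟨q, hq1, hq2, hqp⟩ := hnb (g x) p hgx.2
    have e1 : x ≠ p := hne hx.1 hp1
    have e2 : x ≠ q := hne hx.1 hq1
    have e3 : g x ≠ p := hne hgx.1 hp1
    have e4 : g x ≠ q := hne hgx.1 hq1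
    obtain ⟨g1, a1, a2, a3, a4, a5⟩ := hg.remove hx.1
    obtain ⟨g2, b1, b2, b3, b4, b5⟩ := a1.add hG (y := p) a3
      (by rw [a5 p e1.symm e3.symm, hp1]) e1 hp2
    obtain ⟨g3, c1, c2, -⟩ := b1.add hG (x := g x) (y := q) (by rw [b5 _ hx.1 e3, a4])
      (by rw [b5 q e2.symm hqp, a5 q e2.symm e4.symm, hq1]) e4 hq2
    have := hmax' g3 c1
    omega
  -- Otherwise p, x, g x, g y, y, q is an augmenting path.
  have hAA : ∀ x ∈ A, ∀ y ∈ A, x ≠ y → ¬ G (g x) (g y) := by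
    intro x hx y hy hxy h
    have hyx : y ≠ g x := fun e => hAg x hx (e ▸ hy)
    have hxy' : x ≠ g y := fun e => hAg y hy (e ▸ hx)
    have hgg : g x ≠ g y := fun e => hxy (g.injective e)
    rw [hmemA] at hx hy
    have hgx : g (g x) ≠ g x := fun e => hx.1 (g.injective e)
    have hgy : g (g y) ≠ g y := fun e => hy.1 (g.injective e)
    obtain ⟨p, hp1, hp2, -⟩ := hnb x x hx.2
    obtain ⟨q, hq1, hq2, hqp⟩ := hnb y p hy.2
    have e1 : x ≠ p := hne hx.1 hp1
    have e2 : x ≠ q := hne hx.1 hq1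
    have e3 : g x ≠ p := hne hgx hp1
    have e4 : g x ≠ q := hne hgx hq1
    have f1 : y ≠ p := hne hy.1 hp1
    have f2 : y ≠ q := hne hy.1 hq1
    have f3 : g y ≠ p := hne hgy hp1
    have f4 : g y ≠ q := hne hgy hq1
    obtain ⟨g1, a1, a2, a3, a4, a5⟩ := hg.remove hx.1
    have hg1y : g1 y = g y := a5 y hxy.symm hyx
    obtain ⟨g2, b1, b2, b3, b4, b5⟩ := a1.remove (x := y) (by rw [hg1y]; exact hy.1)
    rw [hg1y] at b4 b5
    obtain ⟨g3, c1, c2, c3, c4, c5⟩ := b1.add hG (x := x) (y := p) (by rw [b5 x hxy hxy', a3])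
      (by rw [b5 p f1.symm f3.symm, a5 p e1.symm e3.symm, hp1]) e1 hp2
    obtain ⟨g4, k1, k2, k3, k4, k5⟩ := c1.add hG (x := y) (y := q) (by rw [c5 y hxy.symm f1, b3])
      (by rw [c5 q e2.symm hqp, b5 q f2.symm f4.symm, a5 q e2.symm e4.symm, hq1]) f2 hq2
    obtain ⟨g5, l1, l2, -⟩ := k1.add hG (x := g x) (y := g y)
      (by rw [k5 _ hyx.symm e4, c5 _ hx.1 e3, b5 _ hyx.symm hgg, a4])
      (by rw [k5 _ hy.1 f4, c5 _ hxy'.symm f3, b4]) hgg h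
    have := hmax' g5 l1
    omega
  have hm : (moved g : ℝ) = cnt (fun x => g x ≠ x) := rfl
  have hgA : cnt (fun x => g x ∈ A) = A.card := by
    rw [cnt_equiv g (fun x => x ∈ A), cnt_mem]
  have hAm : (A.card : ℝ) ≤ moved g / 2 := by
    have h1 := cnt_split (fun x => g x ≠ x) (fun x => x ∈ A)
    have h2 : (A.card : ℝ) ≤ cnt (fun x => g x ≠ x ∧ x ∈ A) := by
      rw [← cnt_mem]; exact cnt_mono fun x hx => ⟨((hmemA x).1 hx).1, hx⟩
    have h3 : (A.card : ℝ) ≤ cnt (fun x => g x ≠ x ∧ x ∉ A) := by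
      rw [← hgA]
      refine cnt_mono fun x hx => ⟨fun e => ?_, fun h => hAg x h hx⟩
      exact ((hmemA _).1 hx).1 (by rw [e, e])
    linarith
  have hw : cnt (fun y => g y = y ∧ y ∈ S) = S.card - moved g := by
    have h1 := cnt_split (fun y => y ∈ S) (fun y => g y = y)
    have h2 : cnt (fun x => g x ≠ x) = cnt (fun x => x ∈ S ∧ ¬ g x = x) :=
      cnt_congr fun x => ⟨fun h => ⟨hS _ _ (hg.2 x h), h⟩, fun h => h.2⟩
    have h3 : cnt (fun y => g y = y ∧ y ∈ S) = cnt (fun y => y ∈ S ∧ g y = y) :=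
      cnt_congr fun x => and_comm
    rw [cnt_mem] at h1
    rw [hm, h2, h3]
    linarith
  have hwn := cnt_nonneg (fun y => g y = y ∧ y ∈ S)
  refine ⟨g, hg, A.card, by positivity, hAm, ?_, ?_⟩
  · rw [hw] at hwn
    exact_mod_cast (by linarith : (moved g : ℝ) ≤ S.card)
  -- The partners of the vertices of A span no edge, which removes |A|² ordered pairs of matched
  -- vertices.
  have hin : cnt (fun z : J × J => (g z.1 ≠ z.1 ∧ g z.2 ≠ z.2) ∧ G z.1 z.2) ≤
      (moved g : ℝ) ^ 2 - (A.card : ℝ) ^ 2 := by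
    have h1 := cnt_split (fun z : J × J => g z.1 ≠ z.1 ∧ g z.2 ≠ z.2)
      (fun z => g z.1 ∈ A ∧ g z.2 ∈ A)
    rw [cnt_and_prod (fun x => g x ≠ x) (fun x => g x ≠ x), ← hm] at h1
    have h2 : cnt (fun z : J × J => g z.1 ∈ A ∧ g z.2 ∈ A) ≤
        cnt (fun z : J × J => (g z.1 ≠ z.1 ∧ g z.2 ≠ z.2) ∧ g z.1 ∈ A ∧ g z.2 ∈ A) := by
      have h0 : ∀ x, g x ∈ A → g x ≠ x := fun x hx e => ((hmemA _).1 hx).1 (by rw [e, e])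
      exact cnt_mono fun z hz => ⟨⟨h0 _ hz.1, h0 _ hz.2⟩, hz⟩
    rw [cnt_and_prod (fun x => g x ∈ A) (fun x => g x ∈ A), hgA] at h2
    have h3 : cnt (fun z : J × J => (g z.1 ≠ z.1 ∧ g z.2 ≠ z.2) ∧ G z.1 z.2) ≤
        cnt (fun z : J × J => (g z.1 ≠ z.1 ∧ g z.2 ≠ z.2) ∧ ¬ (g z.1 ∈ A ∧ g z.2 ∈ A)) := by
      refine cnt_mono fun z hz => ⟨hz.1, fun hh => ?_⟩
      refine hAA _ hh.1 _ hh.2 (fun e => ?_) (by rw [hg.1, hg.1]; exact hz.2)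
      exact hirr z.2 (by have := hz.2; rwa [g.injective e] at this)
    linarith
  have hout : cnt (fun z : J × J => g z.1 ≠ z.1 ∧ g z.2 = z.2 ∧ G z.1 z.2) ≤
      A.card * (S.card - moved g) + moved g := by
    rw [cnt_prod (fun a b => g a ≠ a ∧ g b = b ∧ G a b)]
    have h1 : ∀ a, cnt (fun b => g a ≠ a ∧ g b = b ∧ G a b) ≤
        ind (a ∈ A) * (S.card - moved g) + ind (g a ≠ a) := by
      intro a
      by_cases ha : g a = a
      · simp only [ha, ne_eq, not_true, false_and, cnt_false]
        rw [← hw]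
        have : (0:ℝ) ≤ ind (a ∈ A) := ind_nonneg _
        simp only [ind, if_false, add_zero] at *
        positivity
      · have e : cnt (fun b => g a ≠ a ∧ g b = b ∧ G a b) = d a :=
          cnt_congr fun b => by simp [ha]
        rw [e]
        by_cases hA' : a ∈ A
        · have h2 : d a ≤ cnt (fun y => g y = y ∧ y ∈ S) :=
            cnt_mono fun y hy => ⟨hy.1, hS _ _ (hG _ _ hy.2)⟩
          simp only [ind, hA', if_true, ne_eq, ha, not_false_eq_true]
          linarith
        · have h2 := hd1 a fun h => hA' ((hmemA a).2 ⟨ha, h⟩)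
          simpa [ind, hA', ha] using h2
    refine (sum_le_sum fun a _ => h1 a).trans (le_of_eq ?_)
    rw [sum_add_distrib, ← sum_mul, ← cnt_eq_ind, ← cnt_eq_ind, cnt_mem, hm]
  have hout' : cnt (fun z : J × J => g z.2 ≠ z.2 ∧ g z.1 = z.1 ∧ G z.1 z.2) ≤
      A.card * (S.card - moved g) + moved g := by
    refine le_trans (le_trans (cnt_mono fun z hz => ?_) (cnt_equiv (Equiv.prodComm J J)
      (fun z : J × J => g z.1 ≠ z.1 ∧ g z.2 = z.2 ∧ G z.1 z.2)).le) hout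
    exact ⟨hz.1, hz.2.1, hG _ _ hz.2.2⟩
  have hall : cnt (fun z : J × J => G z.1 z.2) ≤
      cnt (fun z : J × J => (g z.1 ≠ z.1 ∧ g z.2 ≠ z.2) ∧ G z.1 z.2) +
      (cnt (fun z : J × J => g z.1 ≠ z.1 ∧ g z.2 = z.2 ∧ G z.1 z.2) +
      cnt (fun z : J × J => g z.2 ≠ z.2 ∧ g z.1 = z.1 ∧ G z.1 z.2)) := by
    refine le_trans ?_ ((cnt_or_le _ _).trans (add_le_add le_rfl (cnt_or_le _ _)))
    refine cnt_mono fun z hz => ?_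
    have := hindep z.1 z.2
    tauto
  linarith

/-- Everything is scaled by the number of vertices: a is the matched share, x the share of A, r that
of the support S, and e the edge density. For r > 2/3 the square is completed in x with a near 2/3,
which leaves e at most about 4/9 + (r - 2/3)². Since (1 - r)² + (r - 2/3)² ≤ 1/9 there, the total
cannot exceed 5/9 by α unless a is larger. For r ≤ 2/3 the bound e ≤ r² suffices. -/
lemma matching_numeric {a x r r₀ e δ α : ℝ} (h1 : e ≤ a ^ 2 - x ^ 2 + 2 * x * (r - a) + δ)
    (h2 : e ≤ r ^ 2) (hx : 0 ≤ x) (hxa : x ≤ a / 2) (har : a ≤ r) (hr : r ≤ 1) (hr0 : 2 / 3 ≤ r₀)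
    (hΛ : 5 / 9 + α ≤ e + (1 - r₀) ^ 2 - 2 * (1 - r₀) * (r - r₀)) (hα : 0 < α)
    (hδ : δ ≤ α / 4) : 2 / 3 + α / 16 ≤ a := by
  by_contra! hcon
  have ha : 0 ≤ a := by linarith
  rcases le_or_gt r (2 / 3) with hr2 | hr2
  · have q1 : r ^ 2 ≤ 2 / 3 * r := by nlinarith
    have q2 : (2 / 3 - 2 * (1 - r₀)) * r ≤ (2 / 3 - 2 * (1 - r₀)) * (2 / 3) :=
      mul_le_mul_of_nonneg_left hr2 (by linarith)
    have q3 : 0 ≤ (r₀ - 2 / 3) ^ 2 := sq_nonneg _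
    nlinarith
  -- The hypothesis contains the tangent of (1 - r)² at r₀, which lies below the parabola.
  · have q1 : (1 - r₀) ^ 2 - 2 * (1 - r₀) * (r - r₀) ≤ (1 - r) ^ 2 := by
      have : 0 ≤ (r - r₀) ^ 2 := sq_nonneg _
      linarith
    have q2 : (1 - r) ^ 2 + (r - 2 / 3) ^ 2 ≤ 1 / 9 := by nlinarith
    have q3 : -x ^ 2 + 2 * x * (r - 2 / 3) ≤ (r - 2 / 3) ^ 2 := by
      have : 0 ≤ (x - (r - 2 / 3)) ^ 2 := sq_nonneg _
      linarith
    have q4 : a ^ 2 - 2 * x * a ≤ 4 / 9 - 2 * x * (2 / 3) + α / 4 := by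
      have e1 : a ^ 2 - 4 / 9 - 2 * x * (a - 2 / 3) = (a - 2 / 3) * (a + 2 / 3 - 2 * x) := by ring
      have e2 : (a - 2 / 3) * (a + 2 / 3 - 2 * x) ≤ α / 16 * 2 := by
        rcases le_or_gt a (2 / 3) with h | h
        · have : (a - 2 / 3) * (a + 2 / 3 - 2 * x) ≤ 0 :=
            mul_nonpos_of_nonpos_of_nonneg (by linarith) (by linarith)
          linarith
        · exact mul_le_mul (by linarith) (by linarith) (by linarith) (by linarith)
      linarith
    linarith

/-- The density hypothesis is linear in the number of edges and in |S|, with (1 - |S|/|J|)² replaced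
by its tangent at r₀. Linearity lets it be averaged over random choices of blocks. -/
lemma exists_large_matching (hG : ∀ a b, G a b → G b a) (hirr : ∀ a, ¬ G a a) {S : Finset J}
    (hS : ∀ a b, G a b → a ∈ S) {r₀ α : ℝ} (hr0 : 2 / 3 ≤ r₀) (hα : 0 < α)
    (hJ : 8 / α ≤ Fintype.card J)
    (hΛ : (5 / 9 + α) * (Fintype.card J : ℝ) ^ 2 ≤ cnt (fun z : J × J => G z.1 z.2) +
      (1 - r₀) ^ 2 * (Fintype.card J : ℝ) ^ 2 -
      2 * (1 - r₀) * (S.card * Fintype.card J - r₀ * (Fintype.card J : ℝ) ^ 2)) :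
    ∃ g, IsMatching G g ∧ (2 / 3 + α / 16) * Fintype.card J ≤ moved g := by
  obtain ⟨g, hg, x, hx0, hx1, hms, he⟩ := exists_matching_bound hG hirr hS
  refine ⟨g, hg, ?_⟩
  set K : ℝ := (Fintype.card J : ℝ) with hK
  have hK0 : 0 < K := lt_of_lt_of_le (by positivity) hJ
  have hSK : (S.card : ℝ) ≤ K := by rw [hK]; exact_mod_cast card_le_univ _
  have hms' : (moved g : ℝ) ≤ S.card := by exact_mod_cast hms
  have hcnt : cnt (fun z : J × J => G z.1 z.2) ≤ (S.card : ℝ) ^ 2 := by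
    rw [sq, ← cnt_mem, ← cnt_and_prod (fun x => x ∈ S) (fun x => x ∈ S)]
    exact cnt_mono fun z hz => ⟨hS _ _ hz, hS _ _ (hG _ _ hz)⟩
  rw [← le_div_iff₀ hK0]
  refine matching_numeric (x := x / K) (r := S.card / K) (r₀ := r₀)
    (e := cnt (fun z : J × J => G z.1 z.2) / K ^ 2) (δ := 2 * moved g / K ^ 2) ?_ ?_ (by positivity)
    ?_ (by gcongr) ((div_le_one hK0).2 hSK) hr0 ?_ hα ?_
  · rw [div_le_iff₀ (by positivity)]
    refine he.trans (le_of_eq ?_)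
    field_simp
  · rw [div_pow]; gcongr
  · rw [div_div, mul_comm, ← div_div]; gcongr
  · have e : cnt (fun z : J × J => G z.1 z.2) / K ^ 2 + (1 - r₀) ^ 2 -
        2 * (1 - r₀) * (S.card / K - r₀) = (cnt (fun z : J × J => G z.1 z.2) +
        (1 - r₀) ^ 2 * K ^ 2 - 2 * (1 - r₀) * (S.card * K - r₀ * K ^ 2)) / K ^ 2 := by
      field_simp
    rw [e, le_div_iff₀ (by positivity)]
    exact hΛ
  · rw [div_le_iff₀ (by positivity)]
    rw [div_le_iff₀ hα] at hJ
    calc 2 * (moved g : ℝ) ≤ 2 * K := by linarith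
      _ = 8 / 4 * K := by ring
      _ ≤ (K * α) / 4 * K := by gcongr
      _ = _ := by ring

end Matching

/-! ### Marginals of a uniformly random tuple of blocks. -/

section RandomBlocks

variable {m : ℕ} {X : Type u} [Fintype X]

/-- Exchanging coordinates i, i' of f with an external pair is an involution, so two distinct
coordinates of a random f are uniform and independent. -/
lemma cnt_apply_pair {i i' : Fin m} (hi : i ≠ i') (P : X → X → Prop) :
    cnt (fun f : Fin m → X => P (f i) (f i')) * (Fintype.card X : ℝ) ^ 2 =
      (Fintype.card X : ℝ) ^ m * cnt (fun z : X × X => P z.1 z.2) := by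
  set e : (Fin m → X) × (X × X) → (Fin m → X) × (X × X) := fun z =>
    (Function.update (Function.update z.1 i z.2.1) i' z.2.2, (z.1 i, z.1 i')) with he
  have hinv : Function.Involutive e := by
    rintro ⟨f, p, q⟩
    simp only [he, Prod.mk.injEq, Function.update_self, and_true]
    refine ⟨?_, ?_⟩
    · funext k
      by_cases h1 : k = i'
      · subst h1; simp
      · by_cases h2 : k = i
        · subst h2; simp [h1]
        · simp [h1, h2]
    · rw [Function.update_of_ne hi, Function.update_self]
  have h1 : cnt (fun z : (Fin m → X) × (X × X) => P (z.1 i) (z.1 i') ∧ True) =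
      cnt (fun z : (Fin m → X) × (X × X) => True ∧ P z.2.1 z.2.2) := by
    rw [← cnt_equiv hinv.toPerm]
    refine cnt_congr fun z => ?_
    simp only [Function.Involutive.coe_toPerm, he, Function.update_self, and_true, true_and]
    rw [Function.update_of_ne hi, Function.update_self]
  rw [cnt_and_prod (fun f : Fin m → X => P (f i) (f i')) (fun _ : X × X => True),
    cnt_and_prod (fun _ : Fin m → X => True) (fun z : X × X => P z.1 z.2), cnt_true, cnt_true,
    Fintype.card_prod, Fintype.card_fun, Fintype.card_fin] at h1
  push_cast at h1
  rw [sq]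
  exact h1

lemma cnt_apply (i : Fin m) (P : X → Prop) :
    cnt (fun f : Fin m → X => P (f i)) * (Fintype.card X : ℝ) =
      (Fintype.card X : ℝ) ^ m * cnt P := by
  set e : (Fin m → X) × X → (Fin m → X) × X := fun z =>
    (Function.update z.1 i z.2, z.1 i) with he
  have hinv : Function.Involutive e := by
    rintro ⟨f, p⟩
    simp [he]
  have h1 : cnt (fun z : (Fin m → X) × X => P (z.1 i) ∧ True) =
      cnt (fun z : (Fin m → X) × X => True ∧ P z.2) := by
    rw [← cnt_equiv hinv.toPerm]
    refine cnt_congr fun z => ?_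
    simp [Function.Involutive.coe_toPerm, he]
  rw [cnt_and_prod (fun f : Fin m → X => P (f i)) (fun _ : X => True),
    cnt_and_prod (fun _ : Fin m → X => True) P, cnt_true, cnt_true,
    Fintype.card_fun, Fintype.card_fin] at h1
  push_cast at h1
  exact h1

end RandomBlocks

/-! ### Links restricted to random collections of blocks. -/

section Societies

variable {V : Type u} {m M N : ℕ}

/-- The graph induced by `R` on the union of the blocks chosen by `f`, without edges inside a
block. -/
def society (R : V → V → Prop) (b : Fin N → Fin M → V) (f : Fin m → Fin N)
    (x y : Fin m × Fin M) : Prop :=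
  x.1 ≠ y.1 ∧ R (b (f x.1) x.2) (b (f y.1) y.2)

variable {R : V → V → Prop} {b : Fin N → Fin M → V}

/-- Double counting: each of the m² - m ordered pairs of distinct block positions sees, on average
over f, the overall density of R. Leaving out edges inside a block makes the two block choices
independent. -/
lemma sum_cnt_society :
    ∑ f : Fin m → Fin N, cnt (fun z : (Fin m × Fin M) × (Fin m × Fin M) => society R b f z.1 z.2) *
        (N : ℝ) ^ 2 =
      (N : ℝ) ^ m * (((m : ℝ) ^ 2 - m) *
        cnt (fun z : (Fin N × Fin M) × (Fin N × Fin M) => R (b z.1.1 z.1.2) (b z.2.1 z.2.2))) := by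
  rw [← sum_mul, sum_cnt_comm, sum_mul]
  set c : Fin M × Fin M → ℝ := fun w => cnt (fun z : Fin N × Fin N => R (b z.1 w.1) (b z.2 w.2))
    with hc
  have h1 : ∀ z : (Fin m × Fin M) × (Fin m × Fin M),
      cnt (fun f : Fin m → Fin N => society R b f z.1 z.2) * (N : ℝ) ^ 2 =
        (N : ℝ) ^ m * (ind (z.1.1 ≠ z.2.1) * c (z.1.2, z.2.2)) := by
    rintro ⟨⟨i, j⟩, ⟨i', j'⟩⟩
    by_cases hi : i = i'
    · simp [society, hi, cnt_false, ind]
    · have := cnt_apply_pair hi (fun p q : Fin N => R (b p j) (b q j'))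
      rw [Fintype.card_fin] at this
      simp only [society, ne_eq, hi, not_false_eq_true, true_and, ind, if_true, one_mul, hc]
      exact this
  rw [sum_congr rfl fun z _ => h1 z, ← mul_sum]
  congr 1
  have h2 : cnt (fun z : (Fin N × Fin M) × (Fin N × Fin M) =>
      R (b z.1.1 z.1.2) (b z.2.1 z.2.2)) = ∑ w, c w := by
    rw [hc, ← cnt_prod (fun (w : Fin M × Fin M) (z : Fin N × Fin N) => R (b z.1 w.1) (b z.2 w.2)),
      ← cnt_equiv ((Equiv.prodComm _ _).trans (Equiv.prodProdProdComm (Fin N) (Fin N) (Fin M) (Fin M)))]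
    rfl
  have h3 : ∑ z : (Fin m × Fin M) × (Fin m × Fin M), ind (z.1.1 ≠ z.2.1) * c (z.1.2, z.2.2) =
      ∑ z : (Fin m × Fin m) × (Fin M × Fin M), ind (z.1.1 ≠ z.1.2) * c z.2 :=
    Fintype.sum_equiv (Equiv.prodProdProdComm _ _ _ _) _ _ fun z => rfl
  rw [h2, h3, Fintype.sum_prod_type]
  simp only [← mul_sum, ← sum_mul]
  congr 1
  have h4 := cnt_split (fun _ : Fin m × Fin m => True) (fun z => z.1 ≠ z.2)
  have h5 : cnt (fun z : Fin m × Fin m => True ∧ ¬ z.1 ≠ z.2) = m := by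
    rw [cnt_congr (q := fun z : Fin m × Fin m => z.1 = z.2) fun z => by simp,
      cnt_prod (fun a b : Fin m => a = b)]
    have : ∀ a : Fin m, cnt (fun b => a = b) = 1 := fun a => by
      have := cnt_mem ({a} : Finset (Fin m))
      simp only [mem_singleton, card_singleton, Nat.cast_one] at this
      rw [← this]
      exact cnt_congr fun x => eq_comm
    simp [this]
  rw [← cnt_eq_ind]
  rw [h5, cnt_true, Fintype.card_prod, Fintype.card_fin] at h4
  simp only [true_and] at h4
  push_cast at h4
  linarith

lemma sum_card_society (hb : Function.Injective fun z : Fin N × Fin M => b z.1 z.2)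
    (Y : Finset V) :
    ∑ f : Fin m → Fin N, cnt (fun x : Fin m × Fin M => b (f x.1) x.2 ∈ Y) * (N : ℝ) ≤
      (N : ℝ) ^ m * (m * Y.card) := by
  rw [← sum_mul, sum_cnt_comm, sum_mul]
  have h1 : ∀ x : Fin m × Fin M, cnt (fun f : Fin m → Fin N => b (f x.1) x.2 ∈ Y) * (N : ℝ) =
      (N : ℝ) ^ m * cnt (fun p => b p x.2 ∈ Y) := by
    intro x
    have := cnt_apply x.1 (fun p : Fin N => b p x.2 ∈ Y)
    rwa [Fintype.card_fin] at this
  rw [sum_congr rfl fun z _ => h1 z, ← mul_sum, Fintype.sum_prod_type]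
  dsimp only
  rw [sum_const, card_univ, Fintype.card_fin, nsmul_eq_mul, sum_cnt_comm,
    ← cnt_prod (fun (p : Fin N) (j : Fin M) => b p j ∈ Y)]
  have h2 : cnt (fun z : Fin N × Fin M => b z.1 z.2 ∈ Y) ≤ Y.card := by
    unfold cnt
    exact_mod_cast card_le_card_of_injOn (fun z : Fin N × Fin M => b z.1 z.2)
      (fun z hz => by simpa using hz)
      hb.injOn
  gcongr

/-- S₁ and S₂ are the sums of the edge numbers and support sizes over all P choices of blocks. The
losses from equal positions (1/m) and from vertices outside the blocks (κ) each cost at most a/4 of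
the surplus 2a. -/
lemma society_numeric {E r₀ K P S₁ S₂ a κ m : ℝ} (hP : 0 ≤ P) (hr1 : r₀ ≤ 1)
    (hE : E + (1 - r₀) ^ 2 ≥ 5 / 9 + 2 * a) (hE1 : E ≤ 1) (hκ : κ ≤ a / 4) (hκ0 : 0 ≤ κ)
    (hm0 : 0 < m) (hm : 4 ≤ a * m)
    (h1 : P * ((1 - 1 / m) * K ^ 2 * E) ≤ S₁) (h2 : S₂ ≤ P * (K * r₀ * (1 + κ))) (hK : 0 ≤ K) :
    (5 / 9 + 3 / 2 * a) * K ^ 2 * P ≤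
      S₁ + (1 - r₀) ^ 2 * K ^ 2 * P - 2 * (1 - r₀) * (S₂ * K - r₀ * K ^ 2 * P) := by
  have hPK : 0 ≤ P * K ^ 2 := by positivity
  have e1 : (E - a / 4) * (P * K ^ 2) ≤ S₁ := by
    refine le_trans ?_ h1
    have : 1 / m * E ≤ a / 4 := by
      have h : 1 / m ≤ a / 4 := by rw [div_le_iff₀ hm0]; linarith
      calc 1 / m * E ≤ 1 / m * 1 := by gcongr
        _ ≤ _ := by linarith
    calc (E - a / 4) * (P * K ^ 2) ≤ (E - 1 / m * E) * (P * K ^ 2) := by gcongr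
      _ = _ := by ring
  have e2 : 2 * (1 - r₀) * (S₂ * K - r₀ * K ^ 2 * P) ≤ a / 4 * (P * K ^ 2) := by
    have h3 : S₂ * K ≤ P * (K * r₀ * (1 + κ)) * K := by gcongr
    have h4 : 2 * (1 - r₀) * (S₂ * K - r₀ * K ^ 2 * P) ≤
        2 * (1 - r₀) * (P * (K * r₀ * (1 + κ)) * K - r₀ * K ^ 2 * P) := by
      have : 0 ≤ 1 - r₀ := by linarith
      gcongr
    have h5 : 2 * (1 - r₀) * (P * (K * r₀ * (1 + κ)) * K - r₀ * K ^ 2 * P) =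
        (2 * ((1 - r₀) * r₀)) * κ * (P * K ^ 2) := by ring
    have h6 : 2 * ((1 - r₀) * r₀) ≤ 1 := by nlinarith [sq_nonneg (2 * r₀ - 1)]
    have h7 : (2 * ((1 - r₀) * r₀)) * κ ≤ a / 4 := by
      calc (2 * ((1 - r₀) * r₀)) * κ ≤ 1 * κ := by gcongr
        _ ≤ _ := by linarith
    rw [h5] at h4
    exact h4.trans (by gcongr)
  have e3 : (5 / 9 + 2 * a) * (P * K ^ 2) ≤ (E + (1 - r₀) ^ 2) * (P * K ^ 2) := by gcongr
  linarith

/-- Many choices of blocks induce a graph with a large matching. -/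
lemma exists_many_matchings {n r₀ a κ ρ : ℝ} (hN : 0 < N) (hM : 0 < M)
    (hb : Function.Injective fun z : Fin N × Fin M => b z.1 z.2) (hR : ∀ x y, R x y → R y x)
    {Y : Finset V} (hY : ∀ x y, R x y → x ∈ Y) (hYn : (Y.card : ℝ) ≤ r₀ * n)
    (hr0 : 2 / 3 ≤ r₀) (hr1 : r₀ ≤ 1) (ha : 0 < a) (hκ : κ ≤ a / 4) (hκ0 : 0 ≤ κ)
    (hm : 4 ≤ a * m) (hMa : 8 / a ≤ M) (hn : (N : ℝ) * M ≤ n) (hn' : n ≤ (1 + κ) * (N * M))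
    (hρ : 5 / 9 + 2 * a ≤ ρ + (1 - r₀) ^ 2)
    (hE : ρ * n ^ 2 ≤
      cnt (fun z : (Fin N × Fin M) × (Fin N × Fin M) => R (b z.1.1 z.1.2) (b z.2.1 z.2.2))) :
    a / 8 * (N : ℝ) ^ m ≤ cnt (fun f : Fin m → Fin N => ∃ g, IsMatching (society R b f) g ∧
      (2 / 3 + a / 16) * (m * M) ≤ (moved g : ℝ)) := by
  set K : ℝ := m * M with hK
  set P : ℝ := (N : ℝ) ^ m with hP
  have hN0 : (0 : ℝ) < N := by exact_mod_cast hN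
  have hM0 : (0 : ℝ) < M := by exact_mod_cast hM
  have hm0 : (0 : ℝ) < m := (mul_pos_iff_of_pos_left ha).1 (by linarith)
  have hm1 : (1 : ℝ) ≤ m := by
    have : 0 < m := by exact_mod_cast hm0
    exact_mod_cast this
  have hP0 : 0 < P := by positivity
  have hK0 : 0 < K := by positivity
  have hn0 : 0 < n := lt_of_lt_of_le (by positivity) hn
  have hcard : (Fintype.card (Fin m × Fin M) : ℝ) = K := by simp [hK]
  set e : (Fin m → Fin N) → ℝ := fun f =>
    cnt (fun z : (Fin m × Fin M) × (Fin m × Fin M) => society R b f z.1 z.2) with he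
  set s : (Fin m → Fin N) → ℝ := fun f => cnt (fun x : Fin m × Fin M => b (f x.1) x.2 ∈ Y) with hs
  -- The quantity to which `exists_large_matching` applies; it is linear in e and s, so its mean
  -- follows from their means. Its mean density exceeds 5/9 + a by a/2 and it is at most 4K², so a
  -- proportion a/8 of the choices reaches 5/9 + a.
  set Λ : (Fin m → Fin N) → ℝ := fun f =>
    e f + (1 - r₀) ^ 2 * K ^ 2 - 2 * (1 - r₀) * (s f * K - r₀ * K ^ 2) with hΛ
  have hρ1 : ρ ≤ 1 := by
    have h1 := hE.trans (cnt_le_card _)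
    simp only [Fintype.card_prod, Fintype.card_fin] at h1
    push_cast at h1
    have h2 : (N : ℝ) * M * (N * M) ≤ n * n := by gcongr
    have h3 : ρ * n ^ 2 ≤ 1 * n ^ 2 := by linarith
    exact le_of_mul_le_mul_right h3 (by positivity)
  have hρ0 : 0 ≤ ρ := by
    have : (1 - r₀) ^ 2 ≤ (1 / 3) ^ 2 := pow_le_pow_left₀ (by linarith) (by linarith) 2
    linarith
  have hS1 : P * ((1 - 1 / m) * K ^ 2 * ρ) ≤ ∑ f, e f := by
    have h1 := sum_cnt_society (m := m) (R := R) (b := b)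
    rw [← sum_mul] at h1
    refine le_of_mul_le_mul_right ?_ (show 0 < (N : ℝ) ^ 2 by positivity)
    have h0 : 0 ≤ (m : ℝ) ^ 2 - m := by
      have : 0 ≤ (m : ℝ) * (m - 1) := mul_nonneg hm0.le (by linarith)
      linarith
    calc P * ((1 - 1 / m) * K ^ 2 * ρ) * (N : ℝ) ^ 2
        = P * (((m : ℝ) ^ 2 - m) * (ρ * (N * M) ^ 2)) := by rw [hK]; field_simp
      _ ≤ P * (((m : ℝ) ^ 2 - m) * (ρ * n ^ 2)) := by gcongr
      _ ≤ P * (((m : ℝ) ^ 2 - m) * _) := by gcongr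
      _ = _ := h1.symm
  have hS2 : ∑ f, s f ≤ P * (K * r₀ * (1 + κ)) := by
    have h1 := sum_card_society (m := m) hb Y
    rw [← sum_mul] at h1
    refine le_of_mul_le_mul_right ?_ hN0
    refine h1.trans ?_
    calc (N : ℝ) ^ m * (m * Y.card) ≤ P * (m * (r₀ * ((1 + κ) * (N * M)))) := by
          rw [hP]
          gcongr
          exact hYn.trans (by gcongr)
      _ = _ := by rw [hK]; ring
  have hsum := society_numeric (r₀ := r₀) (K := K) hP0.le hr1 hρ hρ1 hκ hκ0 hm0
    hm hS1 hS2 hK0.le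
  have hΛsum : ∑ f, Λ f = ∑ f, e f + (1 - r₀) ^ 2 * K ^ 2 * P -
      2 * (1 - r₀) * ((∑ f, s f) * K - r₀ * K ^ 2 * P) := by
    simp only [hΛ, sum_sub_distrib, sum_add_distrib, ← mul_sum, ← sum_mul, sum_const, card_univ,
      Fintype.card_fun, Fintype.card_fin, nsmul_eq_mul]
    push_cast
    rw [← hP]
    ring
  rw [← hΛsum] at hsum
  have hΛle : ∀ f, Λ f ≤ 4 * K ^ 2 := by
    intro f
    have h1 : e f ≤ K ^ 2 := by
      refine (cnt_le_card _).trans (le_of_eq ?_)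
      rw [Fintype.card_prod, Nat.cast_mul, hcard]; ring
    have h2 : 0 ≤ s f := cnt_nonneg _
    have h3 : 0 ≤ (1 - r₀) * (s f * K) := mul_nonneg (by linarith) (by positivity)
    have h4 : (1 - r₀) ^ 2 ≤ 1 := pow_le_one₀ (by linarith) (by linarith)
    have h5 : (1 - r₀) * r₀ ≤ 1 := mul_le_one₀ (by linarith) (by linarith) hr1
    have h6 : (1 - r₀) ^ 2 * K ^ 2 ≤ 1 * K ^ 2 := by gcongr
    have h7 : (1 - r₀) * r₀ * K ^ 2 ≤ 1 * K ^ 2 := by gcongr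
    simp only [hΛ]
    linarith
  have hcnt := sum_le_cnt Λ (c := (5 / 9 + a) * K ^ 2) (by positivity) hΛle
  rw [Fintype.card_fun, Fintype.card_fin, Fintype.card_fin, Nat.cast_pow, ← hP] at hcnt
  have hlow : a / 8 * P ≤ cnt (fun f => (5 / 9 + a) * K ^ 2 ≤ Λ f) := by
    refine le_of_mul_le_mul_left ?_ (show 0 < 4 * K ^ 2 by positivity)
    linarith
  refine hlow.trans (cnt_mono fun f hf => ?_)
  have h1 := exists_large_matching (G := society R b f)
    (fun x y h => ⟨h.1.symm, hR _ _ h.2⟩) (fun x h => h.1 rfl)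
    (S := fil fun x : Fin m × Fin M => b (f x.1) x.2 ∈ Y)
    (fun x y h => mem_fil.2 (hY _ _ h.2)) hr0 ha (by
      rw [hcard]
      exact hMa.trans (le_mul_of_one_le_left hM0.le hm1)) (by
      rw [hcard, card_fil]
      exact hf)
  rwa [hcard] at h1

end Societies

/-! ### Tight paths from matching edges in links. -/

section Zigzag

variable {V : Type u}

/-- The sequence `X i, Y i, U i, X (i + 1), Y (i + 1), U (i + 1), …, X (i + k), Y (i + k)`. -/
def zigzag (X Y U : ℕ → V) : ℕ → ℕ → List V
  | i, 0 => [X i, Y i]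
  | i, k + 1 => X i :: Y i :: U i :: zigzag X Y U (i + 1) k

variable {X Y U : ℕ → V}

lemma length_zigzag (i k : ℕ) : (zigzag X Y U i k).length = 3 * k + 2 := by
  induction k generalizing i with
  | zero => rfl
  | succ k ih => simp only [zigzag, List.length_cons, ih]; ring

lemma mem_zigzag {i k : ℕ} {v : V} (hv : v ∈ zigzag X Y U i k) :
    ∃ a, i ≤ a ∧ a ≤ i + k ∧ (v = X a ∨ v = Y a ∨ v = U a) := by
  induction k generalizing i with
  | zero =>
    simp only [zigzag, List.mem_cons, List.not_mem_nil, or_false] at hv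
    exact ⟨i, le_rfl, le_rfl, by tauto⟩
  | succ k ih =>
    simp only [zigzag, List.mem_cons] at hv
    rcases hv with hv | hv | hv | hv
    · exact ⟨i, le_rfl, by omega, by tauto⟩
    · exact ⟨i, le_rfl, by omega, by tauto⟩
    · exact ⟨i, le_rfl, by omega, by tauto⟩
    · obtain ⟨a, h1, h2, h3⟩ := ih hv
      exact ⟨a, by omega, by omega, h3⟩

lemma zigzag_eq (i k : ℕ) : ∃ l, zigzag X Y U i k = X i :: Y i :: l := by
  cases k <;> exact ⟨_, rfl⟩

lemma zigzag_eq_append (i k : ℕ) : ∃ l, zigzag X Y U i k = l ++ [X (i + k), Y (i + k)] := by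
  induction k generalizing i with
  | zero => exact ⟨[], rfl⟩
  | succ k ih =>
    obtain ⟨l, hl⟩ := ih (i + 1)
    refine ⟨X i :: Y i :: U i :: l, ?_⟩
    rw [zigzag, hl, show i + 1 + k = i + (k + 1) by ring]
    rfl

lemma hasEnds_zigzag (i k : ℕ) :
    HasEnds (zigzag X Y U i (k + 1)) (X i) (Y i) (X (i + (k + 1))) (Y (i + (k + 1))) := by
  obtain ⟨l, hl⟩ := zigzag_eq_append (X := X) (Y := Y) (U := U) (i + 1) k
  refine ⟨U i :: l, ?_⟩
  rw [zigzag, hl, show i + 1 + k = i + (k + 1) by ring]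
  rfl

/-- Any three consecutive entries consist of one X, one Y and one U, so a complete tripartite
pattern of edges suffices. -/
lemma tight_zigzag {T : TripleSystem V} {K : ℕ} (h : ∀ a b c, a ≤ K → b ≤ K → c ≤ K →
    T.adj (U c) (X a) (Y b)) (i k : ℕ) (hik : i + k ≤ K) : T.Tight (zigzag X Y U i k) := by
  induction k generalizing i with
  | zero => simp [zigzag]
  | succ k ih =>
    have h1 := ih (i + 1) (by omega)
    obtain ⟨l, hl⟩ := zigzag_eq (X := X) (Y := Y) (U := U) (i + 1) k
    rw [zigzag, hl]
    rw [hl] at h1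
    simp only [tight_cons3]
    exact ⟨rot (h i i i (by omega) (by omega) (by omega)),
      rot' (T.swap23 (rot' (T.swap23 (rot' (h (i + 1) i i (by omega) (by omega) (by omega)))))),
      h (i + 1) (i + 1) i (by omega) (by omega) (by omega), h1⟩

lemma nodup_zigzag {K : ℕ} (hX : ∀ a b, a ≤ K → b ≤ K → X a = X b → a = b)
    (hY : ∀ a b, a ≤ K → b ≤ K → Y a = Y b → a = b) (hU : ∀ a b, a ≤ K → b ≤ K → U a = U b → a = b)
    (hXY : ∀ a b, a ≤ K → b ≤ K → X a ≠ Y b) (hXU : ∀ a b, a ≤ K → b ≤ K → X a ≠ U b)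
    (hYU : ∀ a b, a ≤ K → b ≤ K → Y a ≠ U b) (i k : ℕ) (hik : i + k ≤ K) :
    (zigzag X Y U i k).Nodup := by
  induction k generalizing i with
  | zero => simpa [zigzag] using hXY i i (by omega) (by omega)
  | succ k ih =>
    rw [zigzag, List.nodup_cons, List.nodup_cons, List.nodup_cons]
    refine ⟨fun h => ?_, fun h => ?_, fun h => ?_, ih (i + 1) (by omega)⟩
    · simp only [List.mem_cons] at h
      rcases h with h | h | h
      · exact hXY _ _ (by omega) (by omega) h
      · exact hXU _ _ (by omega) (by omega) h
      · obtain ⟨a, h1, h2, h3 | h3 | h3⟩ := mem_zigzag h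
        · have := hX _ _ (by omega) (by omega) h3; omega
        · exact hXY _ _ (by omega) (by omega) h3
        · exact hXU _ _ (by omega) (by omega) h3
    · simp only [List.mem_cons] at h
      rcases h with h | h
      · exact hYU _ _ (by omega) (by omega) h
      · obtain ⟨a, h1, h2, h3 | h3 | h3⟩ := mem_zigzag h
        · exact hXY _ _ (by omega) (by omega) h3.symm
        · have := hY _ _ (by omega) (by omega) h3; omega
        · exact hYU _ _ (by omega) (by omega) h3
    · obtain ⟨a, h1, h2, h3 | h3 | h3⟩ := mem_zigzag h
      · exact hXU _ _ (by omega) (by omega) h3.symm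
      · exact hYU _ _ (by omega) (by omega) h3.symm
      · have := hU _ _ (by omega) (by omega) h3; omega

/-- A blow-up of a matching of links contains one path for each edge of the matching. -/
lemma exists_paths_of_matching [Fintype V] {T : TripleSystem V} {Y : V → Finset V} {B : Finset V}
    {ζ : ℝ} {J : Type*} [Fintype J] {g : Equiv.Perm J} (hg : ∀ x, g (g x) = x) {k : ℕ}
    {ν ω : J → ℕ → V} (hν : ∀ x y a b, a ≤ k + 1 → b ≤ k + 1 → ν x a = ν y b → x = y ∧ a = b)
    (hω : ∀ x y a b, a ≤ k + 1 → b ≤ k + 1 → ω x a = ω y b → x = y ∧ a = b)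
    (hνω : ∀ x y a b, a ≤ k + 1 → b ≤ k + 1 → ν x a ≠ ω y b)
    (hadj : ∀ x, g x ≠ x → ∀ a b c, a ≤ k + 1 → b ≤ k + 1 → c ≤ k + 1 →
      T.adj (ω x c) (ν x a) (ν (g x) b) ∧ Conn T Y B ζ (ν x a) (ν (g x) b)) :
    ∃ P : List (List V), (∀ t ∈ P, t.length = 3 * (k + 1) + 2 ∧
        ∃ a b c d, ConnPath T Y B ζ t a b c d) ∧ P.flatten.Nodup ∧ moved g ≤ 2 * P.length ∧
      ∀ v ∈ P.flatten, ∃ x a, a ≤ k + 1 ∧ (v = ν x a ∨ v = ω x a) := by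
  set e := Fintype.equivFin J
  -- Each matching edge is represented by its endpoint of smaller index, so that it yields a single
  -- path.
  set E : Finset J := fil fun x => e x < e (g x) with hE
  have hne : ∀ x ∈ E, g x ≠ x := fun x hx h => by
    rw [hE, mem_fil, h] at hx
    exact lt_irrefl _ hx
  refine ⟨E.toList.map fun x => zigzag (ν x) (ν (g x)) (ω x) 0 (k + 1), ?_, ?_, ?_, ?_⟩
  · intro t ht
    obtain ⟨x, hx, rfl⟩ := List.mem_map.1 ht
    rw [mem_toList] at hx
    have h := hadj x (hne x hx)
    exact ⟨length_zigzag _ _, _, _, _, _, hasEnds_zigzag 0 k,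
      tight_zigzag (K := k + 1) (fun a b c ha hb hc => (h a b c ha hb hc).1) 0 (k + 1) (by omega),
      (h 0 0 0 (by omega) (by omega) (by omega)).2,
      (h (0 + (k + 1)) (0 + (k + 1)) 0 (by omega) (by omega) (by omega)).2⟩
  · rw [List.nodup_flatten]
    constructor
    · intro t ht
      obtain ⟨x, hx, rfl⟩ := List.mem_map.1 ht
      rw [mem_toList] at hx
      have hgx := hne x hx
      exact nodup_zigzag (K := k + 1) (fun a b ha hb h => (hν _ _ _ _ ha hb h).2)
        (fun a b ha hb h => (hν _ _ _ _ ha hb h).2) (fun a b ha hb h => (hω _ _ _ _ ha hb h).2)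
        (fun a b ha hb h => hgx (hν _ _ _ _ ha hb h).1.symm) (fun a b ha hb => hνω _ _ _ _ ha hb)
        (fun a b ha hb => hνω _ _ _ _ ha hb) 0 (k + 1) (by omega)
    · rw [List.pairwise_map]
      refine E.nodup_toList.imp_of_mem fun {x y} hx hy hxy v hvx hvy => ?_
      rw [mem_toList] at hx hy
      have h1 : x ≠ g y := by
        rintro rfl
        rw [hE, mem_fil] at hx hy
        rw [hg] at hx
        exact lt_asymm hx hy
      have h2 : g x ≠ y := fun h => h1 (by rw [← h, hg])
      have h3 : g x ≠ g y := fun h => hxy (g.injective h)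
      obtain ⟨a, -, ha, hva⟩ := mem_zigzag hvx
      obtain ⟨b, -, hb, hvb⟩ := mem_zigzag hvy
      rw [zero_add] at ha hb
      rcases hva with hva | hva | hva <;> rcases hvb with hvb | hvb | hvb <;> rw [hva] at hvb
      · exact hxy (hν _ _ _ _ ha hb hvb).1
      · exact h1 (hν _ _ _ _ ha hb hvb).1
      · exact hνω _ _ _ _ ha hb hvb
      · exact h2 (hν _ _ _ _ ha hb hvb).1
      · exact h3 (hν _ _ _ _ ha hb hvb).1
      · exact hνω _ _ _ _ ha hb hvb
      · exact hνω _ _ _ _ hb ha hvb.symm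
      · exact hνω _ _ _ _ hb ha hvb.symm
      · exact hxy (hω _ _ _ _ ha hb hvb).1
  · rw [List.length_map, length_toList]
    unfold moved
    have h1 : (fil fun x => g x ≠ x) ⊆ E ∪ E.image g := by
      intro x hx
      rw [mem_fil] at hx
      rw [mem_union, mem_image, hE, mem_fil]
      rcases lt_or_gt_of_ne (fun h => hx (e.injective h).symm : e x ≠ e (g x)) with h | h
      · exact Or.inl h
      · exact Or.inr ⟨g x, by rw [mem_fil, hg]; exact h, hg x⟩
    have h2 := (card_le_card h1).trans (card_union_le _ _)
    have h3 := card_image_le (s := E) (f := g)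
    omega
  · intro v hv
    obtain ⟨t, ht, hvt⟩ := List.mem_flatten.1 hv
    obtain ⟨x, hx, rfl⟩ := List.mem_map.1 ht
    obtain ⟨a, -, ha, h⟩ := mem_zigzag hvt
    rw [zero_add] at ha
    rcases h with h | h | h
    · exact ⟨x, a, ha, Or.inl h⟩
    · exact ⟨g x, a, ha, Or.inl h⟩
    · exact ⟨x, a, ha, Or.inr h⟩

end Zigzag

/-! ### Disjoint families, blocks and injective blow-ups. -/

section Families

variable {V : Type u}

lemma eq_of_mem_of_nodup_flatten {F : List (List V)} (h : F.flatten.Nodup) {s t : List V}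
    (hs : s ∈ F) (ht : t ∈ F) {v : V} (hvs : v ∈ s) (hvt : v ∈ t) : s = t := by
  induction F with
  | nil => simp at hs
  | cons r F ih =>
    rw [List.flatten_cons, List.nodup_append] at h
    have hd : ∀ s ∈ F, v ∈ r → v ∉ s := fun s hs hr hv =>
      h.2.2 v hr v (List.mem_flatten.2 ⟨s, hs, hv⟩) rfl
    rcases List.mem_cons.1 hs with hs' | hs' <;> rcases List.mem_cons.1 ht with ht' | ht'
    · rw [hs', ht']
    · exact absurd hvt (hd t ht' (hs' ▸ hvs))
    · exact absurd hvs (hd s hs' (ht' ▸ hvt))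
    · exact ih h.2.1 hs' ht'

lemma nodup_of_nodup_flatten {F : List (List V)} (h : F.flatten.Nodup) (hF : ∀ t ∈ F, t ≠ []) :
    F.Nodup := by
  rw [List.nodup_flatten] at h
  refine h.2.imp_of_mem fun {s t} hs ht hst e => ?_
  subst e
  obtain ⟨x, hx⟩ := List.exists_mem_of_ne_nil s (hF s hs)
  exact hst hx hx

lemma exists_chop (M N : ℕ) (S : Finset V) (h : N * M ≤ S.card) :
    ∃ F : List (List V), F.length = N ∧ (∀ t ∈ F, t.length = M) ∧ F.flatten.Nodup ∧
      ∀ v ∈ F.flatten, v ∈ S := by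
  induction N generalizing S with
  | zero => exact ⟨[], rfl, by simp, by simp, by simp⟩
  | succ N ih =>
    obtain ⟨A, hA, hAc⟩ := Finset.exists_subset_card_eq (n := M) (s := S) (by nlinarith)
    obtain ⟨F, h1, h2, h3, h4⟩ := ih (S \ A) (by rw [card_sdiff_of_subset hA, hAc]; rw [add_mul] at h; omega)
    refine ⟨A.toList :: F, by simp [h1], ?_, ?_, ?_⟩
    · intro t ht
      rcases List.mem_cons.1 ht with rfl | ht
      · simp [hAc]
      · exact h2 t ht
    · rw [List.flatten_cons, List.nodup_append]
      refine ⟨A.nodup_toList, h3, fun a ha b hb e => ?_⟩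
      rw [mem_toList] at ha
      exact (mem_sdiff.1 (h4 b hb)).2 (e ▸ ha)
    · intro v hv
      rw [List.flatten_cons, List.mem_append, mem_toList] at hv
      rcases hv with hv | hv
      · exact hA hv
      · exact (mem_sdiff.1 (h4 v hv)).1

lemma flatten_blocks_injective {F : List (List V)} {M : ℕ} (h : F.flatten.Nodup)
    (hM : ∀ t ∈ F, t.length = M) : Function.Injective fun z : Fin F.length × Fin M =>
      (F.get z.1)[(z.2 : ℕ)]'(by rw [hM _ (List.get_mem F z.1)]; exact z.2.2) := by
  rintro ⟨i, j⟩ ⟨i', j'⟩ e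
  dsimp only at e
  have hnd := h
  rw [List.nodup_flatten] at hnd
  have hi : i = i' := by
    by_contra hne
    have h1 := List.pairwise_iff_getElem.1 hnd.2
    have m1 : (F.get i)[(j : ℕ)]'(by rw [hM _ (List.get_mem F i)]; exact j.2) ∈ F.get i :=
      List.getElem_mem _
    have m2 : (F.get i)[(j : ℕ)]'(by rw [hM _ (List.get_mem F i)]; exact j.2) ∈ F.get i' := by
      rw [e]; exact List.getElem_mem _
    rcases lt_or_gt_of_ne (fun h => hne (Fin.ext h) : (i : ℕ) ≠ i') with hlt | hlt
    · exact h1 i i' i.2 i'.2 hlt m1 m2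
    · exact h1 i' i i'.2 i.2 hlt m2 m1
  subst hi
  have := (List.Nodup.getElem_inj_iff (hnd.1 _ (List.get_mem F i))).1 e
  exact Prod.ext rfl (Fin.ext this)

lemma cnt_not_injective_le (k t : ℕ) (X : Type u) [Fintype X] :
    cnt (fun Φ : Fin k → Fin t → X => ¬ Function.Injective fun z : Fin k × Fin t => Φ z.1 z.2) ≤
      ((k * t : ℕ) : ℝ) ^ 2 * (Fintype.card X : ℝ) ^ (k * t - 1) := by
  have h1 := lcnt_not_nodup_le (V := X) (k * t)
  rw [lcnt_eq_cnt] at h1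
  refine le_trans ?_ h1
  rw [← cnt_equiv ((Equiv.arrowCongr finProdFinEquiv.symm (Equiv.refl X)).trans
    (Equiv.curry (Fin k) (Fin t) X))]
  refine cnt_mono fun g hg hnd => hg ?_
  rw [List.nodup_ofFn] at hnd
  exact hnd.comp finProdFinEquiv.injective

/-- A dense relation contains an injective blow-up. -/
lemma exists_injective_blowup (k t : ℕ) (hkt : 0 < k * t) {c : ℝ} (hc : 0 < c) :
    ∃ N₀ : ℕ, ∀ N : ℕ, N₀ ≤ N → ∀ A : (Fin k → Fin N) → Prop, c * (N : ℝ) ^ k ≤ cnt A →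
      ∃ Φ : Fin k → Fin t → Fin N,
        (Function.Injective fun z : Fin k × Fin t => Φ z.1 z.2) ∧
        ∀ f : Fin k → Fin t, A fun a => Φ a (f a) := by
  obtain ⟨c', hc', h⟩ := exists_blowup.{0} k t hc
  refine ⟨⌊((k * t : ℕ) : ℝ) ^ 2 / c'⌋₊ + 1, fun N hN A hA => ?_⟩
  have hN1 : ((k * t : ℕ) : ℝ) ^ 2 < c' * N := by
    rw [← div_lt_iff₀' hc']
    refine (Nat.lt_floor_add_one _).trans_le ?_
    exact_mod_cast hN
  have hN0 : 0 < N := by omega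
  have h1 := h (Fin N) (by simpa using hN0) A (by simpa using hA)
  have h2 := cnt_not_injective_le k t (Fin N)
  rw [Fintype.card_fin] at h1 h2
  have h3 : ((k * t : ℕ) : ℝ) ^ 2 * (N : ℝ) ^ (k * t - 1) < c' * (N : ℝ) ^ (k * t) := by
    have e : (N : ℝ) ^ (k * t) = N * (N : ℝ) ^ (k * t - 1) := by
      rw [← pow_succ', Nat.sub_add_cancel hkt]
    rw [e, ← mul_assoc]
    have : (0 : ℝ) < N := by exact_mod_cast hN0
    exact mul_lt_mul_of_pos_right hN1 (by positivity)
  obtain ⟨Φ, hΦ1, hΦ2⟩ := exists_of_cnt_lt (h2.trans_lt (h3.trans_le h1))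
  exact ⟨Φ, not_not.1 hΦ2, hΦ1⟩

variable [Fintype V]

lemma cnt_le_cnt_blocks {N M : ℕ} {b : Fin N → Fin M → V} (hN : 0 < N) (hM : 0 < M)
    (hb : Function.Injective fun z : Fin N × Fin M => b z.1 z.2) (R : V → V → Prop) :
    cnt (fun z : V × V => R z.1 z.2) ≤
      cnt (fun z : (Fin N × Fin M) × (Fin N × Fin M) => R (b z.1.1 z.1.2) (b z.2.1 z.2.2)) +
        2 * ((Fintype.card V : ℝ) - N * M) * Fintype.card V := by
  have : Nonempty (Fin N × Fin M) := ⟨(⟨0, hN⟩, ⟨0, hM⟩)⟩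
  set B : Fin N × Fin M → V := fun z => b z.1 z.2 with hB
  set Z : Finset V := univ.image B with hZ
  have hZc : (Z.card : ℝ) = N * M := by
    rw [hZ, card_image_of_injective _ hb, card_univ, Fintype.card_prod, Fintype.card_fin,
      Fintype.card_fin]
    push_cast; rfl
  have hinv : ∀ x ∈ Z, B (Function.invFun B x) = x := fun x hx => by
    obtain ⟨z, -, hz⟩ := mem_image.1 hx
    exact Function.invFun_eq ⟨z, hz⟩
  have hout : cnt (fun x => x ∉ Z) = (Fintype.card V : ℝ) - N * M := by
    rw [← hZc, ← card_compl_real, ← cnt_mem]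
    exact cnt_congr fun x => mem_compl.symm
  have h1 : cnt (fun z : V × V => R z.1 z.2) ≤ cnt (fun z : V × V =>
      (z.1 ∈ Z ∧ z.2 ∈ Z) ∧ R z.1 z.2) + (cnt (fun z : V × V => z.1 ∉ Z ∧ True) +
      cnt (fun z : V × V => True ∧ z.2 ∉ Z)) := by
    refine le_trans ?_ ((cnt_or_le _ _).trans (add_le_add le_rfl (cnt_or_le _ _)))
    exact cnt_mono fun z hz => by tauto
  rw [cnt_and_prod (fun x => x ∉ Z) (fun _ => True), cnt_and_prod (fun _ => True) (fun x => x ∉ Z),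
    cnt_true, hout] at h1
  have h2 : cnt (fun z : V × V => (z.1 ∈ Z ∧ z.2 ∈ Z) ∧ R z.1 z.2) ≤
      cnt (fun z : (Fin N × Fin M) × (Fin N × Fin M) => R (B z.1) (B z.2)) := by
    refine cnt_le_of_injOn (fun z => (Function.invFun B z.1, Function.invFun B z.2)) ?_ ?_
    · rintro ⟨x, y⟩ ⟨⟨hx, hy⟩, hxy⟩
      dsimp only at *
      rwa [hinv x hx, hinv y hy]
    · rintro ⟨x, y⟩ ⟨x', y'⟩ ⟨⟨hx, hy⟩, -⟩ ⟨⟨hx', hy'⟩, -⟩ he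
      simp only [Prod.mk.injEq] at he hx hy hx' hy'
      rw [Prod.mk.injEq, ← hinv x hx, ← hinv y hy, ← hinv x' hx', ← hinv y' hy', he.1, he.2]
      exact ⟨rfl, rfl⟩
  linarith

variable {T : TripleSystem V} {Y : V → Finset V} {α μ β ζ : ℝ} {h : ℕ}

/-- Few vertices have many pairs in their restricted link which are not connectable. -/
lemma cnt_many_not_conn_le (hζ : 0 ≤ ζ) {a : ℝ} (ha : 0 < a) (B : Finset V)
    (hV : 0 < Fintype.card V) :
    cnt (fun u => u ∉ B ∧ a * (Fintype.card V : ℝ) ^ 2 ≤ cnt (fun z : V × V =>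
      lk T Y u z.1 z.2 ∧ ¬ Conn T Y B ζ z.1 z.2)) ≤ ζ / a * Fintype.card V := by
  set n : ℝ := (Fintype.card V : ℝ) with hn
  have hn0 : 0 < n := by rw [hn]; exact_mod_cast hV
  have h1 := cnt_not_conn_le (T := T) (Y := Y) hζ B
  rw [cnt3_rot (fun a b c => (c ∉ B ∧ lk T Y c a b) ∧ ¬ Conn T Y B ζ a b),
    cnt_prod (fun c (z : V × V) => (c ∉ B ∧ lk T Y c z.1 z.2) ∧ ¬ Conn T Y B ζ z.1 z.2)] at h1
  have h2 := mul_cnt_le_sum (fun x => cnt (fun z : V × V =>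
      (x ∉ B ∧ lk T Y x z.1 z.2) ∧ ¬ Conn T Y B ζ z.1 z.2)) (c := a * n ^ 2)
      (p := fun u => u ∉ B ∧ a * n ^ 2 ≤ cnt (fun z : V × V =>
        lk T Y u z.1 z.2 ∧ ¬ Conn T Y B ζ z.1 z.2))
      (fun x => cnt_nonneg _) (fun x hx => hx.2.trans (cnt_mono fun z hz => ⟨⟨hx.1, hz.1⟩, hz.2⟩))
  have h3 := h2.trans h1
  have e : ζ / a * n = ζ * n / a := by ring
  rw [e, le_div_iff₀ ha]
  refine le_of_mul_le_mul_left (a := n ^ 2) ?_ (by positivity)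
  rw [← hn] at h3
  linarith

/-- A family of disjoint tight paths on `M` vertices with connectable ends, avoiding `U`. -/
structure PathFamily (T : TripleSystem V) (Y : V → Finset V) (B U : Finset V) (ζ : ℝ) (M : ℕ)
    (F : List (List V)) : Prop where
  path : ∀ t ∈ F, t.length = M ∧ ∃ a b c d, ConnPath T Y B ζ t a b c d
  nodup : F.flatten.Nodup
  avoid : ∀ v ∈ F.flatten, v ∉ U

/-- Replacing the members of a path family which meet `P` by the members of `P`. -/
lemma PathFamily.replace {B U : Finset V} {M : ℕ} {F P : List (List V)} (hM : 0 < M)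
    (hF : PathFamily T Y B U ζ M F) (hP : PathFamily T Y B U ζ M P) (I : Finset (List V))
    (hI : ∀ t ∈ F, ∀ v ∈ t, v ∈ P.flatten → t ∈ I) (hIP : I.card < P.length) :
    ∃ F', PathFamily T Y B U ζ M F' ∧ F.length < F'.length := by
  set p : List V → Bool := fun t => decide (∀ v ∈ t, v ∉ P.flatten) with hp
  refine ⟨F.filter p ++ P, ⟨?_, ?_, ?_⟩, ?_⟩
  · intro t ht
    rcases List.mem_append.1 ht with ht | ht
    · exact hF.path t (List.mem_filter.1 ht).1
    · exact hP.path t ht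
  · rw [List.flatten_append, List.nodup_append]
    refine ⟨hF.nodup.sublist List.filter_sublist.flatten, hP.nodup, fun a ha b hb e => ?_⟩
    obtain ⟨t, ht, hat⟩ := List.mem_flatten.1 ha
    have := (List.mem_filter.1 ht).2
    simp only [hp, decide_eq_true_eq] at this
    exact this a hat (e ▸ hb)
  · intro v hv
    rw [List.flatten_append, List.mem_append] at hv
    rcases hv with hv | hv
    · exact hF.avoid v (List.filter_sublist.flatten.subset hv)
    · exact hP.avoid v hv
  · have h1 := List.length_eq_length_filter_add (l := F) p
    have hFnd : F.Nodup := nodup_of_nodup_flatten hF.nodup fun t ht e => by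
      have := (hF.path t ht).1
      rw [e, List.length_nil] at this
      omega
    have h2 : (F.filter (!p ·)).length ≤ I.card := by
      rw [← List.toFinset_card_of_nodup (hFnd.filter _)]
      refine card_le_card fun t ht => ?_
      rw [List.mem_toFinset, List.mem_filter] at ht
      obtain ⟨ht1, ht2⟩ := ht
      simp only [hp, Bool.not_eq_true', decide_eq_false_iff_not, not_forall, not_not] at ht2
      obtain ⟨v, hv, hvP⟩ := ht2
      exact hI t ht1 v hv hvP
    rw [List.length_append]
    omega

end Families

/-! ### Covering almost all vertices by paths. -/

section Cover

/-- Pigeonhole over the finite set G of witnesses, whose size does not depend on N. For matchings on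
m·M labelled vertices it makes one matching serve a positive proportion of all pairs of a link
vertex and a block tuple. -/
lemma exists_common_witness {N m : ℕ} {G : Type*} [Fintype G] [Nonempty G]
    (P : G → Fin N → (Fin m → Fin N) → Prop) {c : ℝ}
    (h : ∀ q, c * (N : ℝ) ^ m ≤ cnt (fun f => ∃ g, P g q f)) :
    ∃ g, c / Fintype.card G * (N : ℝ) ^ (m + 1) ≤
      cnt (fun f : Fin (m + 1) → Fin N => P g (f 0) (fun i => f i.succ)) := by
  have hG : (0 : ℝ) < Fintype.card G := by exact_mod_cast Fintype.card_pos
  have h1 : c * (N : ℝ) ^ (m + 1) ≤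
      ∑ g, cnt (fun f : Fin (m + 1) → Fin N => P g (f 0) (fun i => f i.succ)) := by
    refine le_trans ?_ (cnt_exists_le _)
    rw [← cnt_equiv (Fin.consEquiv fun _ => Fin N)]
    have e : ∀ z : Fin N × (Fin m → Fin N), (∃ s, P s ((Fin.consEquiv fun _ => Fin N) z 0)
        fun i => (Fin.consEquiv fun _ => Fin N) z i.succ) ↔ ∃ s, P s z.1 z.2 := fun z => by
      simp [Fin.consEquiv]
    rw [cnt_congr e, cnt_prod (fun (q : Fin N) (f : Fin m → Fin N) => ∃ g, P g q f)]
    calc c * (N : ℝ) ^ (m + 1) = ∑ _q : Fin N, c * (N : ℝ) ^ m := by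
          rw [sum_const, card_univ, Fintype.card_fin, nsmul_eq_mul]; ring
      _ ≤ _ := sum_le_sum fun q _ => h q
  have h2 : ∑ _g : G, c / Fintype.card G * (N : ℝ) ^ (m + 1) ≤
      ∑ g, cnt (fun f : Fin (m + 1) → Fin N => P g (f 0) (fun i => f i.succ)) := by
    refine le_trans (le_of_eq ?_) h1
    rw [sum_const, card_univ, nsmul_eq_mul]
    field_simp
  obtain ⟨g, -, hg⟩ := exists_le_of_sum_le univ_nonempty h2
  exact ⟨g, hg⟩

variable {V : Type u} [Fintype V] {T : TripleSystem V} {Y : V → Finset V} {α μ β ζ : ℝ} {h : ℕ}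

/-- The connectable pairs in the restricted link of `u`. -/
def connLink (T : TripleSystem V) (Y : V → Finset V) (B : Finset V) (ζ : ℝ) (u x y : V) : Prop :=
  lk T Y u x y ∧ Conn T Y B ζ x y

lemma RobustLinks.many_matchings (hR : RobustLinks T α μ β h Y) {a : ℝ} (ha : a = α / 8)
    (ha0 : 0 < a) (ha1 : a ≤ 1) (hμ : 6 * μ ≤ α) {B : Finset V} {m N M : ℕ} {b : Fin N → Fin M → V}
    (hN : 0 < N) (hM : 0 < M) (hb : Function.Injective fun z : Fin N × Fin M => b z.1 z.2)
    (hm : 4 ≤ a * m) (hMa : 8 / a ≤ M) {u : V}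
    (hu : cnt (fun z : V × V => lk T Y u z.1 z.2 ∧ ¬ Conn T Y B ζ z.1 z.2) ≤
      a * (Fintype.card V : ℝ) ^ 2)
    (hcov : (Fintype.card V : ℝ) - N * M ≤ a / 8 * Fintype.card V) :
    a / 8 * (N : ℝ) ^ m ≤ cnt (fun f : Fin m → Fin N => ∃ g,
      IsMatching (society (connLink T Y B ζ u) b f) g ∧
      (2 / 3 + a / 16) * (m * M) ≤ (moved g : ℝ)) := by
  set n : ℝ := (Fintype.card V : ℝ) with hn
  have hn0 : 0 < n := hR.pos
  have hYn : ((Y u).card : ℝ) ≤ n := by rw [hn]; exact_mod_cast card_le_univ _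
  set r₀ : ℝ := (Y u).card / n with hr₀
  have hr : r₀ * n = (Y u).card := by rw [hr₀]; field_simp
  -- The density ρ is what remains of the link of u after removing edges that leave Y u (2μ), pairs
  -- that are not connectable (a), pairs meeting vertices outside the blocks (a/4), and all pairs in
  -- the complement of Y u ((1 - r₀)²). As α = 8a, a surplus of 2a survives.
  refine exists_many_matchings (n := n) (r₀ := r₀) (κ := a / 4)
    (ρ := 5 / 9 + α - 2 * μ - a - a / 4 - (1 - r₀) ^ 2) hN hM hb
    (fun x y hxy => ⟨lk_symm hxy.1, hxy.2.symm⟩) (fun x y hxy => hxy.1.2.1) hr.symm.le ?_ ?_ ha0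
    le_rfl (by positivity) hm hMa ?_ ?_ (by linarith) ?_
  · rw [hr₀, le_div_iff₀ hn0]
    exact (hR.part u).card
  · exact (div_le_one hn0).2 hYn
  · have h1 : Fintype.card (Fin N × Fin M) ≤ Fintype.card V := Fintype.card_le_of_injective _ hb
    rw [Fintype.card_prod, Fintype.card_fin, Fintype.card_fin] at h1
    rw [hn]
    exact_mod_cast h1
  · have h1 : (1 - a / 8) * n ≤ N * M := by linarith
    have h2 : (1 + a / 4) * ((1 - a / 8) * n) ≤ (1 + a / 4) * (N * M) := by gcongr
    have h3 : 0 ≤ a * (1 - a / 4) * n := mul_nonneg (mul_nonneg ha0.le (by linarith)) hn0.le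
    nlinarith
  · have h1 := cnt_le_cnt_blocks hN hM hb (connLink T Y B ζ u)
    have h2 := hR.le_ec u
    rw [ec_eq_cnt] at h2
    have h3 := cnt_sub_le (fun z : V × V => lk T Y u z.1 z.2)
      (fun z => lk T Y u z.1 z.2 ∧ ¬ Conn T Y B ζ z.1 z.2)
    have h4 : cnt (fun z : V × V => (z.1 ∈ Y u ∧ z.2 ∈ Y u) ∧ T.adj u z.1 z.2) =
        cnt (fun z : V × V => lk T Y u z.1 z.2) :=
      cnt_congr fun z => by simp only [lk, restr]; tauto
    have h5 : cnt (fun z : V × V => lk T Y u z.1 z.2 ∧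
        ¬ (lk T Y u z.1 z.2 ∧ ¬ Conn T Y B ζ z.1 z.2)) ≤
        cnt (fun z : V × V => connLink T Y B ζ u z.1 z.2) :=
      cnt_mono fun z hz => by simp only [connLink]; tauto
    rw [← hn] at h1 h2
    have h6 : 2 * (n - N * M) * n ≤ 2 * (a / 8 * n) * n := by gcongr
    have h7 : (n - (Y u).card) ^ 2 = (1 - r₀) ^ 2 * n ^ 2 := by rw [← hr]; ring
    nlinarith

/-- If many vertices are uncovered, then a path family can be enlarged. -/
lemma RobustLinks.exists_larger_family (hR : RobustLinks T α μ β h Y) {a : ℝ} (ha : a = α / 8)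
    (ha0 : 0 < a) (ha1 : a ≤ 1) (hμ : 6 * μ ≤ α) {ε : ℝ} (hε : 0 < ε) (hζ : ζ = ε * a / 2)
    {m k M N₀ : ℕ} (hm : 4 ≤ a * m) (hM : M = 3 * (k + 1) + 2) (hk : 200 / a ≤ k)
    (hkε : 8 / ε ≤ k)
    (hblow : ∀ N : ℕ, N₀ ≤ N → ∀ A : (Fin (m + 1) → Fin N) → Prop,
      a / 8 / Fintype.card (Equiv.Perm (Fin m × Fin M)) * (N : ℝ) ^ (m + 1) ≤ cnt A →
      ∃ Φ : Fin (m + 1) → Fin (m * M * (k + 2)) → Fin N,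
        (Function.Injective fun z : Fin (m + 1) × Fin (m * M * (k + 2)) => Φ z.1 z.2) ∧
        ∀ f : Fin (m + 1) → Fin (m * M * (k + 2)), A fun a => Φ a (f a))
    (hn1 : 2 * ((N₀ : ℝ) + 1) * M ≤ Fintype.card V)
    (hn2 : 100 / a * (M + 1) ≤ Fintype.card V) (hn3 : 8 / ε ≤ Fintype.card V)
    {B U : Finset V} (hBU : B ⊆ U) (hU : (U.card : ℝ) ≤ a / 16 * Fintype.card V)
    {F : List (List V)} (hF : PathFamily T Y B U ζ M F)
    (hunc : ε * Fintype.card V < cnt (fun v => v ∉ U ∧ v ∉ F.flatten)) :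
    ∃ F', PathFamily T Y B U ζ M F' ∧ F.length < F'.length := by
  set n : ℝ := (Fintype.card V : ℝ) with hn
  have hn0 : 0 < n := hR.pos
  have hV : 0 < Fintype.card V := by have := hR.card2; omega
  have hM0 : 0 < M := by omega
  have hMR : (0 : ℝ) < M := by exact_mod_cast hM0
  have hkM : (k : ℝ) ≤ M := by exact_mod_cast (by omega : k ≤ M)
  have hm0 : 0 < m := by
    have : (0 : ℝ) < m := (mul_pos_iff_of_pos_left ha0).1 (by linarith)
    exact_mod_cast this
  -- the reserved vertices
  set Bad : V → Prop := fun u => u ∉ B ∧ a * n ^ 2 ≤ cnt (fun z : V × V =>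
      lk T Y u z.1 z.2 ∧ ¬ Conn T Y B ζ z.1 z.2) with hBad
  have hbad : cnt Bad ≤ ε / 2 * n := by
    have h1 := cnt_many_not_conn_le (T := T) (Y := Y) (ζ := ζ) (by rw [hζ]; positivity) ha0 B hV
    have e : ζ / a = ε / 2 := by rw [hζ]; field_simp
    rw [e] at h1
    exact h1
  set W : Finset V := fil fun v => v ∉ U ∧ v ∉ F.flatten with hW
  have hgood : ε / 2 * n < ((fil fun v => (v ∉ U ∧ v ∉ F.flatten) ∧ ¬ Bad v).card : ℝ) := by
    have h1 := cnt_sub_le (fun v => v ∉ U ∧ v ∉ F.flatten) Bad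
    rw [card_fil]
    linarith
  -- The blow-up lemma uses one index set for all coordinates, so there must be at least as many
  -- reserved link vertices as blocks, and there are at most n/M blocks.
  set L := Fintype.card V / M + 1 with hL
  have hLn : (L : ℝ) ≤ n / M + 1 := by
    rw [hL]; push_cast
    gcongr
    rw [hn]
    exact Nat.cast_div_le
  have hnM : n / M ≤ ε / 8 * n := by
    rw [div_le_iff₀ hε] at hkε
    rw [div_le_iff₀ hMR]
    have : 8 ≤ M * ε := hkε.trans (by gcongr)
    nlinarith
  have hLgood : L ≤ (fil fun v => (v ∉ U ∧ v ∉ F.flatten) ∧ ¬ Bad v).card := by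
    rw [div_le_iff₀ hε] at hn3
    have : (L : ℝ) ≤ ((fil fun v => (v ∉ U ∧ v ∉ F.flatten) ∧ ¬ Bad v).card : ℝ) := by linarith
    exact_mod_cast this
  obtain ⟨W₀, hW₀, hW₀c⟩ := Finset.exists_subset_card_eq hLgood
  have hW₀' : ∀ v ∈ W₀, (v ∉ U ∧ v ∉ F.flatten) ∧ ¬ Bad v := fun v hv =>
    (mem_fil (p := fun v => (v ∉ U ∧ v ∉ F.flatten) ∧ ¬ Bad v)).1 (hW₀ hv)
  have hW₀W : W₀ ⊆ W := fun v hv => mem_fil.2 (hW₀' v hv).1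
  -- the blocks
  obtain ⟨F₂, hF₂l, hF₂M, hF₂nd, hF₂W⟩ := exists_chop M ((W \ W₀).card / M) (W \ W₀)
    (Nat.div_mul_le_self _ _)
  have hF₂W' : ∀ v ∈ F₂.flatten, (v ∉ U ∧ v ∉ F.flatten) ∧ v ∉ W₀ := fun v hv =>
    ⟨(mem_fil (p := fun v => v ∉ U ∧ v ∉ F.flatten)).1 (mem_sdiff.1 (hF₂W v hv)).1,
      (mem_sdiff.1 (hF₂W v hv)).2⟩
  set Bl := F ++ F₂ with hBl
  have hBlM : ∀ t ∈ Bl, t.length = M := fun t ht => by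
    rcases List.mem_append.1 ht with ht | ht
    · exact (hF.path t ht).1
    · exact hF₂M t ht
  have hBlnd : Bl.flatten.Nodup := by
    rw [hBl, List.flatten_append, List.nodup_append]
    exact ⟨hF.nodup, hF₂nd, fun x hx y hy e => (hF₂W' y hy).1.2 (e ▸ hx)⟩
  have hBlU : ∀ v ∈ Bl.flatten, v ∉ U ∧ v ∉ W₀ := fun v hv => by
    rw [hBl, List.flatten_append, List.mem_append] at hv
    rcases hv with hv | hv
    · exact ⟨hF.avoid v hv, fun hw => (hW₀' v hw).1.2 hv⟩
    · exact ⟨(hF₂W' v hv).1.1, (hF₂W' v hv).2⟩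
  set N := Bl.length with hN
  set b : Fin N → Fin M → V := fun i j =>
    (Bl.get i)[(j : ℕ)]'(by rw [hBlM _ (List.get_mem Bl i)]; exact j.2) with hb
  have hbmem : ∀ i j, b i j ∈ Bl.get i := fun i j => List.getElem_mem _
  have hbfl : ∀ i j, b i j ∈ Bl.flatten := fun i j =>
    List.mem_flatten.2 ⟨_, List.get_mem Bl i, hbmem i j⟩
  have hbinj : Function.Injective fun z : Fin N × Fin M => b z.1 z.2 :=
    flatten_blocks_injective hBlnd hBlM
  have hNM : N * M ≤ Fintype.card V := by
    have h1 : Fintype.card (Fin N × Fin M) ≤ Fintype.card V := Fintype.card_le_of_injective _ hbinj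
    rwa [Fintype.card_prod, Fintype.card_fin, Fintype.card_fin] at h1
  have hNL : N ≤ L := by
    have := (Nat.le_div_iff_mul_le hM0).2 hNM
    omega
  have hcov : n - N * M ≤ a / 8 * n := by
    have h1 : Fintype.card V ≤ U.card + F.flatten.length + W.card := by
      have : (univ : Finset V) ⊆ U ∪ F.flatten.toFinset ∪ W := fun v _ => by
        rw [mem_union, mem_union, List.mem_toFinset, hW, mem_fil]
        tauto
      have h2 := card_le_card this
      have h3 := card_union_le (U ∪ F.flatten.toFinset) W
      have h4 := card_union_le U F.flatten.toFinset
      have h5 := List.toFinset_card_le F.flatten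
      rw [card_univ] at h2
      omega
    rw [length_flatten_le fun t ht => (hF.path t ht).1] at h1
    have h2 : (W \ W₀).card = W.card - L := by rw [card_sdiff_of_subset hW₀W, hW₀c]
    have h3 := Nat.div_add_mod (W \ W₀).card M
    have h4 := Nat.mod_lt (W \ W₀).card hM0
    have h5 : N = F.length + (W \ W₀).card / M := by rw [hN, hBl, List.length_append, hF₂l]
    have h6 : Fintype.card V ≤ U.card + N * M + L + M := by
      have : N * M = M * F.length + M * ((W \ W₀).card / M) := by rw [h5]; ring
      omega
    have h7 : n ≤ U.card + N * M + L + M := by rw [hn]; exact_mod_cast h6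
    have h8 : n / M ≤ a / 200 * n := by
      rw [div_le_iff₀ ha0] at hk
      rw [div_le_iff₀ hMR]
      have : 200 ≤ M * a := hk.trans (by gcongr)
      nlinarith
    have h9 : (M : ℝ) + 1 ≤ a / 100 * n := by
      have : a / 100 * (100 / a * (M + 1)) ≤ a / 100 * n := by gcongr
      calc (M : ℝ) + 1 = a / 100 * (100 / a * (M + 1)) := by field_simp
        _ ≤ _ := this
    linarith
  have hNlow : n / 2 ≤ N * M := by
    have : a / 8 * n ≤ 1 / 8 * n := by gcongr
    linarith
  have hNN₀ : N₀ + 1 ≤ N := by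
    have h1 : ((N₀ : ℝ) + 1) * M ≤ N * M := by linarith
    have h2 := le_of_mul_le_mul_right h1 hMR
    exact_mod_cast h2
  have hN0 : 0 < N := by omega
  -- the choice of the link vertices
  obtain ⟨w, hwinj, hwW⟩ : ∃ w : Fin N → V, Function.Injective w ∧ ∀ q, w q ∈ W₀ := by
    refine ⟨fun q => (W₀.equivFin.symm ⟨q, by rw [hW₀c]; omega⟩ : V), fun q q' e => ?_,
      fun q => Subtype.prop _⟩
    have := W₀.equivFin.symm.injective (Subtype.ext e)
    simpa [Fin.ext_iff] using this
  have hMa : 8 / a ≤ M := by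
    refine le_trans ?_ (hk.trans hkM)
    gcongr
    norm_num
  -- Coordinate 0 indexes a link vertex and the other m coordinates index blocks; the same matching
  -- g works for a positive proportion of these tuples.
  obtain ⟨g, hg⟩ := exists_common_witness (c := a / 8) (fun (g : Equiv.Perm (Fin m × Fin M)) q f =>
      IsMatching (society (connLink T Y B ζ (w q)) b f) g ∧
      (2 / 3 + a / 16) * (m * M) ≤ (moved g : ℝ)) fun q => by
    have h1 := hW₀' (w q) (hwW q)
    have h2 : cnt (fun z : V × V => lk T Y (w q) z.1 z.2 ∧ ¬ Conn T Y B ζ z.1 z.2) ≤ a * n ^ 2 := by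
      by_contra! hcon
      exact h1.2 ⟨fun hB => h1.1.1 (hBU hB), hcon.le⟩
    exact hR.many_matchings ha ha0 ha1 hμ hN0 hM0 hbinj hm hMa h2 hcov
  obtain ⟨Φ, hΦinj, hΦ⟩ := hblow N (by omega) _ hg
  have ht0 : 0 < m * M * (k + 2) := by positivity
  -- Reduction modulo the size only makes the indexing total. The size m·M·(k + 2) gives every
  -- vertex x of the society its own interval of k + 2 link vertices.
  set em : ℕ → Fin (m * M * (k + 2)) := fun i => ⟨i % (m * M * (k + 2)), Nat.mod_lt _ ht0⟩ with hem
  have hem_inj : ∀ i j, i < m * M * (k + 2) → j < m * M * (k + 2) → em i = em j → i = j := by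
    intro i j hi hj e
    simp only [hem, Fin.mk.injEq] at e
    rwa [Nat.mod_eq_of_lt hi, Nat.mod_eq_of_lt hj] at e
  have hgm := (hΦ fun _ => em 0).2
  have hk2 : k + 2 ≤ m * M * (k + 2) := Nat.le_mul_of_pos_left _ (by positivity)
  have hidx : ∀ (x : Fin m × Fin M) (i : ℕ), i ≤ k + 1 →
      (finProdFinEquiv x : ℕ) * (k + 2) + i < m * M * (k + 2) := by
    intro x i hi
    have h1 : (finProdFinEquiv x : ℕ) + 1 ≤ m * M := (finProdFinEquiv x).2
    have h2 := Nat.mul_le_mul_right (k + 2) h1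
    rw [Nat.add_mul] at h2
    omega
  obtain ⟨P, hP1, hP2, hP3, hP4⟩ := exists_paths_of_matching (T := T) (Y := Y) (B := B) (ζ := ζ)
    (g := g) (hΦ fun _ => em 0).1.1 (k := k)
    (ν := fun x i => b (Φ x.1.succ (em i)) x.2)
    (ω := fun x i => w (Φ 0 (em ((finProdFinEquiv x : ℕ) * (k + 2) + i)))) (by
      rintro ⟨x1, x2⟩ ⟨y1, y2⟩ i j hi hj e
      have h1 := hbinj (a₁ := (_, _)) (a₂ := (_, _)) e
      rw [Prod.mk.injEq] at h1
      have h2 := hΦinj (a₁ := (_, _)) (a₂ := (_, _)) h1.1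
      rw [Prod.mk.injEq] at h2
      exact ⟨Prod.ext (Fin.succ_injective _ h2.1) h1.2,
        hem_inj i j (by omega) (by omega) h2.2⟩) (by
      intro x y i j hi hj e
      have h1 := hΦinj (a₁ := (0, _)) (a₂ := (0, _)) (hwinj e)
      rw [Prod.mk.injEq] at h1
      have h2 := hem_inj _ _ (hidx x i hi) (hidx y j hj) h1.2
      have h3 : (finProdFinEquiv x : ℕ) = finProdFinEquiv y := by
        have q1 := congrArg (· / (k + 2)) h2
        rwa [mul_comm, Nat.mul_add_div (by omega), Nat.div_eq_of_lt (by omega), mul_comm _ (k + 2),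
          Nat.mul_add_div (by omega), Nat.div_eq_of_lt (by omega), add_zero, add_zero] at q1
      rw [h3] at h2
      exact ⟨finProdFinEquiv.injective (Fin.ext h3), by omega⟩) (by
      intro x y i j hi hj e
      exact (hBlU _ (hbfl _ _)).2 (e ▸ hwW _)) (by
      intro x hx i j c hi hj hc
      -- Copy i of the block of x and copy j of the block of g x can be prescribed independently
      -- because matching edges of a society join different blocks.
      have h1 := (hΦ (Fin.cons (em ((finProdFinEquiv x : ℕ) * (k + 2) + c))
        fun p => if p = x.1 then em i else em j)).1
      have h2 := h1.2 x hx
      simp only [society, Fin.cons_zero, Fin.cons_succ, if_true] at h2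
      rw [if_neg h2.1.symm] at h2
      exact ⟨h2.2.1.1, h2.2.2⟩)
  set I : Finset (List V) := (univ : Finset (Fin m × Fin (k + 2))).image
    fun p => Bl.get (Φ p.1.succ (em p.2)) with hI
  have hPF : PathFamily T Y B U ζ M P := by
    refine ⟨fun t ht => ⟨by rw [(hP1 t ht).1, hM], (hP1 t ht).2⟩, hP2, fun v hv => ?_⟩
    obtain ⟨x, i, hi, h1 | h1⟩ := hP4 v hv
    · rw [h1]; exact (hBlU _ (hbfl _ _)).1
    · rw [h1]; exact (hW₀' _ (hwW _)).1.1
  refine hF.replace hM0 hPF I ?_ ?_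
  · intro t ht v hvt hvP
    obtain ⟨x, i, hi, h1 | h1⟩ := hP4 v hvP
    · rw [hI, mem_image]
      refine ⟨(x.1, ⟨i, by omega⟩), mem_univ _, ?_⟩
      exact eq_of_mem_of_nodup_flatten hBlnd (List.get_mem Bl _)
        (List.mem_append.2 (Or.inl ht)) (v := v) (h1 ▸ hbmem _ _) hvt
    · refine absurd (List.mem_flatten.2 ⟨t, ht, hvt⟩) ?_
      rw [h1]
      exact (hW₀' _ (hwW _)).1.2
  · have h1 : I.card ≤ m * (k + 2) := by
      refine card_image_le.trans (le_of_eq ?_)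
      rw [card_univ, Fintype.card_prod, Fintype.card_fin, Fintype.card_fin]
    -- The new paths number at least moved/2, and the blocks they touch at most m(k + 2). Since M =
    -- 3k + 5, the share 2/3 alone gives 2k + 10/3 instead of the required 2k + 4 per block
    -- position; the surplus (a/16)M makes up for it as k ≥ 200/a.
    have h2 : (m : ℝ) * (k + 2) * 2 < moved g := by
      refine lt_of_lt_of_le ?_ hgm
      have e : (M : ℝ) = 3 * (k + 1) + 2 := by rw [hM]; push_cast; ring
      rw [div_le_iff₀ ha0] at hk
      have hmR : (0 : ℝ) < m := by exact_mod_cast hm0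
      have : (k + 2) * 2 < (2 / 3 + a / 16) * (M : ℝ) := by
        rw [e]
        nlinarith
      calc (m : ℝ) * (k + 2) * 2 = m * ((k + 2) * 2) := by ring
        _ < m * ((2 / 3 + a / 16) * (M : ℝ)) := by gcongr
        _ = _ := by ring
    have h3 : m * (k + 2) * 2 < moved g := by exact_mod_cast h2
    omega

/-- **Covering lemma.** Almost all vertices outside a small set can be covered by disjoint tight
paths with connectable ends. -/
theorem exists_path_cover {α μ ε : ℝ} (hα : 0 < α) (hα1 : α ≤ 1) (hμ : 6 * μ ≤ α) (hε : 0 < ε) :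
    ∃ ζ : ℝ, 0 < ζ ∧ ζ ≤ ε ∧ ∀ M₀ : ℕ, ∃ M : ℕ, M₀ ≤ M ∧ ∃ n₀ : ℕ, ∀ (β : ℝ) (h : ℕ) (V : Type u)
      [Fintype V] (T : TripleSystem V) (Y : V → Finset V), n₀ ≤ Fintype.card V →
      RobustLinks T α μ β h Y → ∀ B U : Finset V, B ⊆ U →
      (U.card : ℝ) ≤ α / 128 * Fintype.card V →
      ∃ F, PathFamily T Y B U ζ M F ∧
        cnt (fun v => v ∉ U ∧ v ∉ F.flatten) ≤ ε * Fintype.card V := by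
  obtain ⟨a, ha⟩ : ∃ a, a = α / 8 := ⟨_, rfl⟩
  have ha0 : 0 < a := by rw [ha]; positivity
  have ha1 : a ≤ 1 := by rw [ha]; linarith
  refine ⟨ε * a / 2, by positivity, by nlinarith, fun M₀ => ?_⟩
  obtain ⟨m, hm⟩ := exists_nat_ge (4 / a)
  obtain ⟨k₁, hk₁⟩ := exists_nat_ge (200 / a + 8 / ε)
  have hm' : 4 ≤ a * m := by rwa [div_le_iff₀' ha0] at hm
  have hm0 : 0 < m := by
    have : (0 : ℝ) < m := (mul_pos_iff_of_pos_left ha0).1 (by linarith)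
    exact_mod_cast this
  set k := k₁ + M₀ with hk
  have hkk : (k₁ : ℝ) ≤ k := by rw [hk]; push_cast; linarith [(Nat.cast_nonneg M₀ : (0 : ℝ) ≤ M₀)]
  obtain ⟨M, hM⟩ : ∃ M, M = 3 * (k + 1) + 2 := ⟨_, rfl⟩
  obtain ⟨N₀, hblow⟩ := exists_injective_blowup (m + 1) (m * M * (k + 2))
    (Nat.mul_pos (by omega) (Nat.mul_pos (Nat.mul_pos hm0 (by omega)) (by omega)))
    (c := a / 8 / Fintype.card (Equiv.Perm (Fin m × Fin M)))
    (div_pos (by positivity) (by exact_mod_cast Fintype.card_pos))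
  obtain ⟨n₀, hn₀⟩ := exists_nat_ge (2 * ((N₀ : ℝ) + 1) * M + 100 / a * (M + 1) + 8 / ε)
  refine ⟨M, by omega, n₀, fun β h V _ T Y hV hR B U hBU hU => ?_⟩
  have hV' : (n₀ : ℝ) ≤ Fintype.card V := by exact_mod_cast hV
  have p1 : 0 ≤ 2 * ((N₀ : ℝ) + 1) * M := by positivity
  have p2 : 0 ≤ 100 / a * ((M : ℝ) + 1) := by positivity
  have p3 : 0 ≤ 8 / ε := by positivity
  have p4 : 0 ≤ 200 / a := by positivity
  by_contra! hcon
  -- Without an almost perfect cover the enlargement never stops, although disjoint nonempty paths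
  -- number at most n.
  have key : ∀ s : ℕ, ∃ F, PathFamily T Y B U (ε * a / 2) M F ∧ s ≤ F.length := by
    intro s
    induction s with
    | zero => exact ⟨[], ⟨by simp, by simp, by simp⟩, le_rfl⟩
    | succ s ih =>
      obtain ⟨F, hF, hs⟩ := ih
      obtain ⟨F', hF', hs'⟩ := hR.exists_larger_family ha ha0 ha1 hμ hε rfl hm' hM
        (by linarith) (by linarith) hblow (by linarith) (by linarith) (by linarith) hBU
        (by rw [ha]; linarith) hF (hcon F hF)
      exact ⟨F', hF', by omega⟩
  obtain ⟨F, hF, hs⟩ := key (Fintype.card V + 1)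
  have h1 := length_flatten_le fun t ht => (hF.path t ht).1
  have h2 := hF.nodup.length_le_card
  rw [h1] at h2
  have : F.length ≤ M * F.length := Nat.le_mul_of_pos_left _ (by omega)
  omega

end Cover

/-! ### Assembling the Hamiltonian cycle. -/

section Hamiltonian

variable {V : Type u} [Fintype V] {T : TripleSystem V} {Y : V → Finset V} {α μ β ζ : ℝ} {h : ℕ}

/-- The list `l` joins the pair `x, y` to the pair `z, w`. -/
def Joins (T : TripleSystem V) (x y z w : V) (l : List V) : Prop := T.Tight ([x, y] ++ l ++ [z, w])

/-- Joining disjoint paths with connections from a reservoir. -/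
lemma exists_joined_tail {B : Finset V} (F R : List (List V)) {c d : V}
    (hF : ∀ t ∈ F, ∃ a b c d, ConnPath T Y B ζ t a b c d) (hcd : Conn T Y B ζ c d)
    (hR : ∀ x y z w, Conn T Y B ζ x y → Conn T Y B ζ z w → F.length ≤ hits R (Joins T x y z w)) :
    ∃ (Z : List V) (C R' : List (List V)) (c' d' : V) (Z' : List V), R.Perm (C ++ R') ∧
      C.length = F.length ∧ Z.Perm (F.flatten ++ C.flatten) ∧ Conn T Y B ζ c' d' ∧
      [c, d] ++ Z = Z' ++ [c', d'] ∧ T.Tight ([c, d] ++ Z) := by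
  induction F generalizing R c d with
  | nil => exact ⟨[], [], R, c, d, [], by simp, rfl, by simp, hcd, by simp, by simp⟩
  | cons t F ih =>
    obtain ⟨p, q, r, s, ⟨m, hm⟩, ht, hc1, hc2⟩ := hF t (by simp)
    have h1 : 0 < hits R (Joins T c d p q) := lt_of_lt_of_le (by simp) (hR c d p q hcd hc1)
    obtain ⟨w, hwR, hw⟩ := List.countP_pos_iff.1 h1
    simp only [decide_eq_true_eq] at hw
    have hperm := List.perm_cons_erase hwR
    -- Erasing w lowers each count of available connections by at most one, and the required number
    -- drops by one together with the path t.
    obtain ⟨Z, C, R', c', d', Z', k1, k2, k3, k4, k5, k6⟩ := ih (R.erase w) (c := r) (d := s)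
      (fun t ht => hF t (by simp [ht])) hc2 fun x y z u hxy hzu => by
        have h2 := hR x y z u hxy hzu
        have h3 : hits R (Joins T x y z u) = hits (w :: R.erase w) (Joins T x y z u) :=
          hperm.countP_eq _
        rw [h3, hits_cons, List.length_cons] at h2
        split_ifs at h2 <;> omega
    refine ⟨w ++ t ++ Z, w :: C, R', c', d', [c, d] ++ w ++ (p :: q :: m) ++ Z', ?_, by simp [k2],
      ?_, k4, ?_, ?_⟩
    · exact hperm.trans (by simpa using k1)
    · rw [List.perm_iff_count]
      intro v
      have := k3.count_eq v
      simp only [List.count_append, List.flatten_cons] at *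
      omega
    · calc [c, d] ++ (w ++ t ++ Z) = [c, d] ++ w ++ (p :: q :: m) ++ ([r, s] ++ Z) := by
            rw [hm]; simp
        _ = _ := by rw [k5]; simp
    · have e : [c, d] ++ (w ++ t ++ Z) = ([c, d] ++ w ++ (p :: q :: m)) ++ r :: s :: Z := by
        rw [hm]; simp
      rw [e, tight_overlap]
      refine ⟨?_, k6⟩
      have e2 : ([c, d] ++ w ++ (p :: q :: m)) ++ [r, s] =
          ([c, d] ++ w) ++ p :: q :: (m ++ [r, s]) := by simp
      rw [e2, tight_overlap]
      exact ⟨hw, hm ▸ ht⟩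

omit [Fintype V] in
/-- Closing a cycle through the absorbing path. -/
lemma tight_cycle {A Z Z' w : List V} {a b c d c' d' : V} (hA : HasEnds A a b c d)
    (hAt : T.Tight A) (hZ : [c, d] ++ Z = Z' ++ [c', d']) (hZt : T.Tight ([c, d] ++ Z))
    (hw : Joins T c' d' a b w) : T.Tight (A ++ Z ++ w ++ [a, b]) := by
  obtain ⟨m, rfl⟩ := hA
  have e1 : a :: b :: (m ++ [c, d]) ++ Z ++ w ++ [a, b] =
      (a :: b :: m) ++ c :: d :: (Z ++ w ++ [a, b]) := by simp
  rw [e1, tight_overlap]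
  refine ⟨by simpa using hAt, ?_⟩
  have e2 : c :: d :: (Z ++ w ++ [a, b]) = Z' ++ c' :: d' :: (w ++ [a, b]) := by
    calc c :: d :: (Z ++ w ++ [a, b]) = ([c, d] ++ Z) ++ (w ++ [a, b]) := by simp
      _ = _ := by rw [hZ]; simp
  rw [e2, tight_overlap, ← hZ]
  exact ⟨hZt, by simpa [Joins] using hw⟩

/-- Removing B destroys at most |B| of the link vertices that witness connectability. -/
lemma Conn.avoid {ζ' : ℝ} {B : Finset V} {x y : V} (hc : Conn T Y ∅ ζ x y)
    (hB : (B.card : ℝ) ≤ (ζ - ζ') * Fintype.card V) : Conn T Y B ζ' x y := by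
  unfold Conn at *
  have h1 := cnt_sub_le (fun u => u ∉ (∅ : Finset V) ∧ lk T Y u x y) (fun u => u ∈ B)
  rw [cnt_mem] at h1
  have h2 : cnt (fun u => (u ∉ (∅ : Finset V) ∧ lk T Y u x y) ∧ ¬ u ∈ B) ≤
      cnt (fun u => u ∉ B ∧ lk T Y u x y) := cnt_mono fun u hu => ⟨hu.2, hu.1.2⟩
  linarith

/-- Assembling an absorbing path, a reservoir and an almost perfect path cover. -/
lemma exists_hamiltonian_of_parts {A : List V} {a b c d : V} {R F : List (List V)} {M : ℕ}
    {U : Finset V} (hA : ConnPath T Y A.toFinset ζ A a b c d) (hAnd : A.Nodup)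
    (hU : U = A.toFinset ∪ R.flatten.toFinset) (hRnd : R.flatten.Nodup)
    (hRA : ∀ v ∈ R.flatten, v ∉ A.toFinset) (hF : PathFamily T Y A.toFinset U ζ M F)
    (hhits : ∀ x y z w, Conn T Y A.toFinset ζ x y → Conn T Y A.toFinset ζ z w →
      F.length + 1 ≤ hits R (Joins T x y z w))
    (habs : ∀ S : List V, (S.length : ℝ) ≤ R.flatten.length + cnt (fun v => v ∉ U ∧ v ∉ F.flatten) →
      Absorbs T A S) :
    ∃ a b l, (a :: b :: l).Nodup ∧ (∀ v, v ∈ a :: b :: l) ∧ T.Tight (a :: b :: l ++ [a, b]) := by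
  obtain ⟨hA1, hA2, hA3, hA4⟩ := hA
  obtain ⟨Z, C, R', c', d', Z', k1, k2, k3, k4, k5, k6⟩ := exists_joined_tail F R
    (fun t ht => (hF.path t ht).2) hA4 fun x y z w hxy hzw =>
      (Nat.le_succ _).trans (hhits x y z w hxy hzw)
  have h1 : 0 < hits R' (Joins T c' d' a b) := by
    have h2 := hhits c' d' a b k4 hA3
    have h3 : hits R (Joins T c' d' a b) = hits (C ++ R') (Joins T c' d' a b) := k1.countP_eq _
    have h4 : hits (C ++ R') (Joins T c' d' a b) =
      hits C (Joins T c' d' a b) + hits R' (Joins T c' d' a b) := List.countP_append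
    have h5 : hits C (Joins T c' d' a b) ≤ C.length := List.countP_le_length
    omega
  obtain ⟨w, hwR, hw⟩ := List.countP_pos_iff.1 h1
  simp only [decide_eq_true_eq] at hw
  have hperm : R.flatten.Perm (C.flatten ++ w ++ (R'.erase w).flatten) := by
    have := (k1.trans ((List.perm_cons_erase hwR).append_left C)).flatten
    simpa using this
  have hRnd' := hperm.nodup_iff.1 hRnd
  rw [List.nodup_append] at hRnd'
  have hZw : (Z ++ w).Perm (F.flatten ++ (C.flatten ++ w)) := by
    simpa using k3.append_right w
  have hCwR : ∀ v ∈ C.flatten ++ w, v ∈ R.flatten := fun v hv =>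
    hperm.mem_iff.2 (List.mem_append.2 (Or.inl hv))
  have hZwnd : (Z ++ w).Nodup := by
    rw [hZw.nodup_iff, List.nodup_append]
    refine ⟨hF.nodup, hRnd'.1, fun x hx y hy e => hF.avoid x hx ?_⟩
    rw [hU, mem_union, List.mem_toFinset, List.mem_toFinset, e]
    exact Or.inr (hCwR y hy)
  have hZwA : ∀ v ∈ Z ++ w, v ∉ A := by
    intro v hv hvA
    rcases List.mem_append.1 (hZw.mem_iff.1 hv) with hv | hv
    · exact hF.avoid v hv (by rw [hU, mem_union, List.mem_toFinset]; exact Or.inl hvA)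
    · exact hRA v (hCwR v hv) (List.mem_toFinset.2 hvA)
  -- What the cycle still misses: unused reservoir vertices and vertices that no path covers.
  set S : List V := (fil fun v => v ∉ A ∧ v ∉ Z ++ w).toList with hS
  have hSmem : ∀ v, v ∈ S ↔ v ∉ A ∧ v ∉ Z ++ w := fun v => by rw [hS, mem_toList, mem_fil]
  obtain ⟨A', q1, q2, q3⟩ := habs S (by
    rw [hS, length_toList, card_fil]
    have h2 : cnt (fun v => v ∉ A ∧ v ∉ Z ++ w) ≤ cnt (fun v => v ∈ R.flatten.toFinset) +
        cnt (fun v => v ∉ U ∧ v ∉ F.flatten) := by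
      refine le_trans (cnt_mono fun v hv => ?_) (cnt_or_le _ _)
      rw [hZw.mem_iff, List.mem_append] at hv
      rw [hU, mem_union, List.mem_toFinset, List.mem_toFinset]
      tauto
    rw [cnt_mem] at h2
    have h3 : (R.flatten.toFinset.card : ℝ) ≤ R.flatten.length := by
      exact_mod_cast List.toFinset_card_le _
    linarith) a b c d hA1
  have hcyc := tight_cycle q3 q2 k5 k6 hw
  have hfull : (A' ++ Z ++ w).Perm ((A ++ S) ++ (Z ++ w)) := by
    simpa using q1.append_right (Z ++ w)
  have hnd : (A' ++ Z ++ w).Nodup := by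
    rw [hfull.nodup_iff, List.nodup_append, List.nodup_append]
    refine ⟨⟨hAnd, nodup_toList _, fun x hx y hy e => ((hSmem y).1 hy).1 (e ▸ hx)⟩, hZwnd,
      fun x hx y hy e => ?_⟩
    subst e
    rcases List.mem_append.1 hx with hx | hx
    · exact hZwA x hy hx
    · exact ((hSmem x).1 hx).2 hy
  have hall : ∀ v, v ∈ A' ++ Z ++ w := by
    intro v
    rw [hfull.mem_iff, List.mem_append, List.mem_append, hSmem]
    tauto
  obtain ⟨m, rfl⟩ := q3
  exact ⟨a, b, m ++ [c, d] ++ Z ++ w, by simpa using hnd, by simpa using hall, by simpa using hcyc⟩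

/-- Dense triple systems have tight Hamiltonian cycles. -/
theorem exists_hamiltonian {α : ℝ} (hα : 0 < α) (hα1 : α ≤ 1) :
    ∃ n₀ : ℕ, ∀ (V : Type u) [Fintype V] (T : TripleSystem V), n₀ ≤ Fintype.card V →
      (∀ u, (5 / 9 + α) * (Fintype.card V : ℝ) ^ 2 ≤ ec (T.adj u) univ univ) →
      ∃ a b l, (a :: b :: l).Nodup ∧ (∀ v, v ∈ a :: b :: l) ∧
        T.Tight (a :: b :: l ++ [a, b]) := by
  set μ := α / 100 with hμ
  have hμ0 : 0 < μ := by positivity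
  obtain ⟨h, β, hβ, hrob⟩ := exists_robustLinks.{u} (α := α) hμ0 (by rw [hμ]; linarith)
    (by rw [hμ]; linarith)
  obtain ⟨ζ₁, hζ₁, habs⟩ := exists_absorbing_path.{u} (h := h) hα hβ
    (by rw [hμ]; linarith : 6 * μ ≤ α) hμ0
  obtain ⟨cA, hcA, n₁, habs⟩ := habs (min (ζ₁ / 2) (min (α / 256) (min (β / (4 * h + 4)) (α / 4))))
    (by positivity)
  -- The uncovered vertices and the reservoir each use half of the absorbing capacity cA. The bound
  -- ζ ≤ ε ≤ ζ₁/2 leaves room to forbid the vertices of the absorbing path as witnesses of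
  -- connectability.
  set ε := min (cA / 2) (ζ₁ / 2) with hε
  obtain ⟨ζ, hζ, hζε, hcov⟩ := exists_path_cover.{u} (α := α) (μ := μ) (ε := ε) hα hα1
    (by rw [hμ]; linarith) (by positivity)
  set k := 6 * h + 4 with hk
  have hk0 : (0 : ℝ) < k := by exact_mod_cast (by omega : 0 < k)
  set θ := ζ ^ 2 * α / 4 * ((ζ ^ 2 * α / 4 * β / 4) ^ (h + 2)) ^ 2 with hθ
  obtain ⟨cR, hcR, n₂, hres⟩ := exists_selection.{u} (k := k) (θ := θ)
    (γ := min (α / 256) (cA / 2) / k) (by omega) (by positivity) (by positivity)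
  -- Paths on M ≥ 2/cR vertices number at most (cR/2)n, fewer than the connections kept for each
  -- request. This is consistent because ζ, on which cR depends, is fixed before M.
  obtain ⟨M₀, hM₀⟩ := exists_nat_ge (2 / cR)
  obtain ⟨M, hM, n₃, hcov⟩ := hcov M₀
  obtain ⟨n₄, hn₄⟩ := exists_nat_ge (2 / cR)
  refine ⟨n₁ + n₂ + n₃ + n₄ + 2, fun V _ T hV hdens => ?_⟩
  obtain ⟨Y, hR⟩ := hrob V T (by omega) hdens
  set n : ℝ := (Fintype.card V : ℝ) with hn
  have hn0 : 0 < n := hR.pos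
  obtain ⟨A, a, b, c, d, ⟨hA1, hA2, hA3, hA4⟩, hAnd, hAlen, hAabs⟩ := habs V T Y (by omega) hR
  set B := A.toFinset with hB
  have hBc : (B.card : ℝ) ≤ A.length := by exact_mod_cast List.toFinset_card_le A
  have hBle : ∀ x : ℝ, min (ζ₁ / 2) (min (α / 256) (min (β / (4 * h + 4)) (α / 4))) ≤ x →
      (B.card : ℝ) ≤ x * n := fun x hx =>
    hBc.trans (hAlen.trans (mul_le_mul_of_nonneg_right hx hn0.le))
  have hB1 := hBle (ζ₁ / 2) (min_le_left _ _)
  have hB2 := hBle (α / 256) ((min_le_right _ _).trans (min_le_left _ _))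
  have hB3 := hBle (min (β / (4 * h + 4)) (α / 4)) ((min_le_right _ _).trans (min_le_right _ _))
  have hζ' : ζ ≤ ζ₁ / 2 := hζε.trans (min_le_right _ _)
  have hBζ : (B.card : ℝ) ≤ (ζ₁ - ζ) * n := by
    refine hB1.trans ?_
    gcongr
    linarith
  -- the reservoir
  set ι := {z : V × V × V × V // Conn T Y B ζ z.1 z.2.1 ∧ Conn T Y B ζ z.2.2.1 z.2.2.2} with hι
  obtain ⟨R, hR1, hR2, hR3, hR4⟩ := hres V (by omega) ι
    (fun z l => (∀ v ∈ l, v ∉ B) ∧ T.Tight (z.1.1 :: z.1.2.1 :: (l ++ [z.1.2.2.1, z.1.2.2.2])))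
    (by
      have h1 : Fintype.card ι ≤ Fintype.card (V × V × V × V) := Fintype.card_subtype_le _
      simp only [Fintype.card_prod] at h1
      have h2 : (Fintype.card ι : ℝ) ≤ n * (n * (n * n)) := by rw [hn]; exact_mod_cast h1
      exact h2.trans (le_of_eq (by ring)))
    fun z => hR.connect hβ hα (by rw [hμ]; linarith) hζ hB3 z.2.1 z.2.2
  have hRlen : (R.flatten.length : ℝ) ≤ min (α / 256) (cA / 2) * n := by
    rw [length_flatten_le fun l hl => (hR1 l hl).1]
    push_cast
    calc (k : ℝ) * R.length ≤ k * (min (α / 256) (cA / 2) / k * n) := by gcongr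
      _ = _ := by field_simp
  have hRl1 : (R.flatten.length : ℝ) ≤ α / 256 * n :=
    hRlen.trans (mul_le_mul_of_nonneg_right (min_le_left _ _) hn0.le)
  have hRl2 : (R.flatten.length : ℝ) ≤ cA / 2 * n :=
    hRlen.trans (mul_le_mul_of_nonneg_right (min_le_right _ _) hn0.le)
  obtain ⟨U, hU⟩ : ∃ U, U = B ∪ R.flatten.toFinset := ⟨_, rfl⟩
  obtain ⟨F, hF, hFcov⟩ := hcov β h V T Y (by omega) hR B U (by rw [hU]; exact subset_union_left) (by
    have h1 : (U.card : ℝ) ≤ B.card + R.flatten.toFinset.card := by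
      rw [hU]; exact_mod_cast card_union_le _ _
    have h2 : (R.flatten.toFinset.card : ℝ) ≤ R.flatten.length := by
      exact_mod_cast List.toFinset_card_le _
    rw [← hn]
    linarith)
  refine exists_hamiltonian_of_parts (ζ := ζ) (Y := Y) (A := A) (R := R) (F := F) (U := U)
    ⟨hA1, hA2, hA3.avoid hBζ, hA4.avoid hBζ⟩ hAnd hU hR2 (fun v hv => ?_) hF ?_ fun S hS => ?_
  · obtain ⟨l, hl, hvl⟩ := List.mem_flatten.1 hv
    obtain ⟨r, hr⟩ := (hR1 l hl).2
    exact hr.1 v hvl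
  · intro x y z w hxy hzw
    have h1 := hR4 ⟨(x, y, z, w), hxy, hzw⟩
    have h2 : hits R (fun l => (∀ v ∈ l, v ∉ B) ∧ T.Tight (x :: y :: (l ++ [z, w]))) ≤
        hits R (Joins T x y z w) := List.countP_mono_left fun l _ hl => by
      simp only [decide_eq_true_eq] at *
      simpa [Joins] using hl.2
    have h3 : (M : ℝ) * F.length ≤ n := by
      have h4 := length_flatten_le fun t ht => (hF.path t ht).1
      have h5 := hF.nodup.length_le_card
      rw [h4] at h5
      rw [hn]
      exact_mod_cast h5
    have h6 : 2 / cR ≤ M := hM₀.trans (by exact_mod_cast hM)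
    have h7 : 2 / cR ≤ n := hn₄.trans (by rw [hn]; exact_mod_cast (by omega))
    rw [div_le_iff₀ hcR] at h6 h7
    have h8 : 2 * (F.length : ℝ) ≤ n * cR := by
      calc 2 * (F.length : ℝ) ≤ M * cR * F.length := by gcongr
        _ = M * F.length * cR := by ring
        _ ≤ _ := by gcongr
    have h9 : (F.length : ℝ) + 1 ≤ hits R (Joins T x y z w) := by
      have h10 : (hits R (fun l => (∀ v ∈ l, v ∉ B) ∧ T.Tight (x :: y :: (l ++ [z, w]))) : ℝ) ≤
        hits R (Joins T x y z w) := by exact_mod_cast h2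
      have h11 : cR * n ≤
        (hits R (fun l => (∀ v ∈ l, v ∉ B) ∧ T.Tight (x :: y :: (l ++ [z, w]))) : ℝ) := h1
      linarith
    exact_mod_cast h9
  · refine hAabs S (hS.trans ?_)
    have : ε * n ≤ cA / 2 * n := mul_le_mul_of_nonneg_right (min_le_left _ _) hn0.le
    rw [← hn] at hFcov ⊢
    linarith

end Hamiltonian

/-! ### From hypergraphs to triple systems and back. -/

section Translation

variable {V : Type u}

/-- The triple system of a hypergraph on its vertex set. -/
def ofHypergraph (H : Hypergraph V) : TripleSystem V(H) where
  adj a b c := (a ≠ b ∧ b ≠ c ∧ a ≠ c) ∧ ({a.1, b.1, c.1} : Set V) ∈ E(H)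
  swap12 := fun {a b c} h => ⟨⟨h.1.1.symm, h.1.2.2, h.1.2.1⟩, by
    rw [Set.insert_comm]; exact h.2⟩
  swap23 := fun {a b c} h => ⟨⟨h.1.2.2, h.1.2.1.symm, h.1.1⟩, by
    rw [Set.pair_comm]; exact h.2⟩
  ne := fun h => h.1.1

lemma exists_eq_insert_pair {H : Hypergraph V} (hu : H.IsUniform 3) {e : Set V} (he : e ∈ E(H))
    {v : V(H)} (hv : v.1 ∈ e) : ∃ a b : V(H), (ofHypergraph H).adj v a b ∧ e = {v.1, a.1, b.1} := by
  obtain ⟨x, y, z, hxy, hxz, hyz, rfl⟩ := Set.ncard_eq_three.1 (hu e he).2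
  have hs := Hypergraph.subset_vertexSet_of_mem_edgeSet he
  have hx : x ∈ V(H) := hs (by simp)
  have hy : y ∈ V(H) := hs (by simp)
  have hz : z ∈ V(H) := hs (by simp)
  have key : ∀ (a b : V) (ha : a ∈ V(H)) (hb : b ∈ V(H)), v.1 ≠ a → a ≠ b → v.1 ≠ b →
      ({x, y, z} : Set V) = {v.1, a, b} → ∃ a b : V(H), (ofHypergraph H).adj v a b ∧
        ({x, y, z} : Set V) = {v.1, a.1, b.1} := fun a b ha hb h1 h2 h3 h4 =>
    ⟨⟨a, ha⟩, ⟨b, hb⟩, ⟨⟨fun h => h1 (congrArg Subtype.val h), fun h => h2 (congrArg Subtype.val h),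
      fun h => h3 (congrArg Subtype.val h)⟩, by rw [← h4]; exact he⟩, h4⟩
  simp only [Set.mem_insert_iff, Set.mem_singleton_iff] at hv
  rcases hv with hv | hv | hv
  · exact key y z hy hz (hv ▸ hxy) hyz (hv ▸ hxz) (by rw [hv])
  · exact key x z hx hz (hv ▸ hxy.symm) hxz (hv ▸ hyz) (by rw [hv, Set.insert_comm])
  · exact key x y hx hy (hv ▸ hxz.symm) hxy (hv ▸ hyz.symm) (by
      rw [hv]; ext w; simp only [Set.mem_insert_iff, Set.mem_singleton_iff]; tauto)

/-- Each edge through v gives the two orders of its remaining pair. This turns n²/2 in the degree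
condition into n² for ordered pairs. -/
lemma two_mul_degree_le (H : Hypergraph V) [Fintype V(H)] (hu : H.IsUniform 3) (v : V(H)) :
    2 * (H.degree v.1 : ℝ) ≤ ec ((ofHypergraph H).adj v) univ univ := by
  have hfin : {e ∈ E(H) | v.1 ∈ e}.Finite :=
    (Set.toFinite V(H)).powerset.subset fun e he =>
      Hypergraph.subset_vertexSet_of_mem_edgeSet he.1
  have : Fintype {e ∈ E(H) | v.1 ∈ e} := hfin.fintype
  choose a b hab he using fun e : {e ∈ E(H) | v.1 ∈ e} => exists_eq_insert_pair hu e.2.1 e.2.2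
  have h1 : 2 * (H.degree v.1 : ℝ) = cnt (fun _ : {e ∈ E(H) | v.1 ∈ e} × Bool => True) := by
    rw [cnt_true, Fintype.card_prod, Fintype.card_bool, Hypergraph.degree,
      ← Nat.card_coe_set_eq, Nat.card_eq_fintype_card]
    push_cast
    ring
  rw [h1, ec_eq_cnt]
  refine cnt_le_of_injOn (fun z => if z.2 then (a z.1, b z.1) else (b z.1, a z.1)) ?_ ?_
  · rintro ⟨e, i⟩ -
    refine ⟨⟨mem_univ _, mem_univ _⟩, ?_⟩
    cases i
    · exact swap23 _ (hab e)
    · exact hab e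
  · rintro ⟨e, i⟩ ⟨e', i'⟩ - - hh
    have hne := (hab e).1.2.1
    have hset : ∀ p q : V(H), ({v.1, p.1, q.1} : Set V) = {v.1, q.1, p.1} := fun p q => by
      rw [Set.pair_comm]
    have hee : e = e' := by
      apply Subtype.ext
      rw [he e, he e']
      cases i <;> cases i' <;>
        simp only [if_true, Bool.false_eq_true, if_false, Prod.mk.injEq] at hh <;> rw [hh.1, hh.2]
      · exact hset _ _
      · exact hset _ _
    subst hee
    cases i <;> cases i' <;>
      simp only [if_true, Bool.false_eq_true, if_false, Prod.mk.injEq] at hh ⊢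
    · exact absurd hh.2 hne
    · exact absurd hh.1 hne

lemma zmod_val_add {n : ℕ} [NeZero n] (i : ZMod n) (k : ℕ) :
    (i + (k : ZMod n)).val = (i.val + k) % n := by
  have : i + (k : ZMod n) = ((i.val + k : ℕ) : ZMod n) := by
    push_cast; rw [ZMod.natCast_zmod_val]
  rw [this, ZMod.val_natCast]

/-- A cyclic enumeration gives a tight Hamiltonian cycle. -/
lemma hasTightHamiltonianCycle_of_list {H : Hypergraph V} {a b : V(H)} {l : List V(H)}
    (hnd : (a :: b :: l).Nodup) (hall : ∀ v, v ∈ a :: b :: l)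
    (ht : (ofHypergraph H).Tight (a :: b :: l ++ [a, b])) (hl : 4 ≤ (a :: b :: l).length) :
    H.HasTightHamiltonianCycle := by
  set L := a :: b :: l with hL
  set n := L.length with hn
  have : NeZero n := ⟨by omega⟩
  set x : ZMod n → V := fun i => (L[i.val]'(ZMod.val_lt i)).1 with hx
  -- Appending the first two entries makes reading the list agree with indices modulo n up to n + 1,
  -- which covers the triples that wrap around.
  have hget : ∀ (j : ℕ) (hj : j < n + 2),
      (L ++ [a, b])[j]'(by simpa using hj) = L[j % n]'(Nat.mod_lt _ (by omega)) := by
    intro j hj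
    rcases lt_or_ge j n with h | h
    · rw [List.getElem_append_left h]
      congr 1
      exact (Nat.mod_eq_of_lt h).symm
    · rw [List.getElem_append_right h]
      have h2 : j = n ∨ j = n + 1 := by omega
      rcases h2 with rfl | rfl
      · have e : n - L.length = 0 := by omega
        simp only [e, Nat.mod_self]
        rfl
      · have e : n + 1 - L.length = 1 := by omega
        have : (n + 1) % n = 1 := by rw [Nat.add_mod_left, Nat.mod_eq_of_lt (by omega)]
        simp only [e, this]
        rfl
  have hedge : ∀ i : ZMod n, ({x i, x (i + 1), x (i + 2)} : Set V) ∈ E(H) := by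
    intro i
    have hi : i.val < n := ZMod.val_lt i
    have h1 := (ht.get i.val (by simp [← hn]; omega)).2
    rw [hget i.val (by omega), hget (i.val + 1) (by omega), hget (i.val + 2) (by omega)] at h1
    have e0 : i.val % n = i.val := Nat.mod_eq_of_lt hi
    have e1 : (i + 1).val = (i.val + 1) % n := by simpa using zmod_val_add i 1
    have e2 : (i + 2).val = (i.val + 2) % n := by simpa using zmod_val_add i 2
    simp only [hx, e1, e2]
    simp only [e0] at h1
    exact h1
  have hrange : Set.range x = V(H) := by
    ext v
    constructor
    · rintro ⟨i, rfl⟩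
      exact (L[i.val]'(ZMod.val_lt i)).2
    · intro hv
      obtain ⟨j, hj, hjv⟩ := List.getElem_of_mem (hall ⟨v, hv⟩)
      refine ⟨(j : ZMod n), ?_⟩
      have : (j : ZMod n).val = j := by rw [ZMod.val_natCast, Nat.mod_eq_of_lt hj]
      simp only [hx, this]
      rw [hjv]
  refine ⟨⟨Set.range x, Set.range fun i => ({x i, x (i + 1), x (i + 2)} : Set V), ?_⟩, n,
    ⟨hl, x, fun i j hij => ?_, rfl, rfl⟩, ⟨hrange.le, ?_⟩, hrange⟩
  · rintro _ ⟨i, rfl⟩ v hv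
    simp only [Set.mem_insert_iff, Set.mem_singleton_iff] at hv
    rcases hv with rfl | rfl | rfl <;> exact ⟨_, rfl⟩
  · exact ZMod.val_injective n ((List.Nodup.getElem_inj_iff hnd).1 (Subtype.ext hij))
  · rintro _ ⟨i, rfl⟩
    exact hedge i

theorem hasTightHamiltonianCycle_of_minDegree (α : ℝ) (hα : 0 < α) :
    ∃ n₀ : ℕ, ∀ n : ℕ, n₀ ≤ n →
      ∀ (V : Type u) (H : Hypergraph V), V(H).Finite → V(H).ncard = n → H.IsUniform 3 →
        (5 / 9 + α) * ((n : ℝ) ^ 2 / 2) ≤ (H.minDegree : ℝ) →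
        H.HasTightHamiltonianCycle := by
  obtain ⟨n₀, h⟩ := exists_hamiltonian.{u} (α := min α 1) (by positivity) (min_le_right _ _)
  refine ⟨n₀ + 4, fun n hn V H hfin hcard hu hdeg => ?_⟩
  have : Fintype V(H) := hfin.fintype
  have hc : Fintype.card V(H) = n := by
    rw [← hcard, ← Nat.card_coe_set_eq, Nat.card_eq_fintype_card]
  obtain ⟨a, b, l, h1, h2, h3⟩ := h V(H) (ofHypergraph H) (by omega) fun v => by
    refine le_trans ?_ (two_mul_degree_le H hu v)
    have h1 : (H.minDegree : ℝ) ≤ H.degree v.1 := by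
      have : H.minDegree ≤ H.degree v.1 := Nat.sInf_le ⟨v.1, v.2, rfl⟩
      exact_mod_cast this
    have h2 : (5 / 9 + min α 1) * (n : ℝ) ^ 2 ≤ (5 / 9 + α) * (n : ℝ) ^ 2 := by
      gcongr
      exact min_le_left _ _
    rw [hc]
    linarith
  refine hasTightHamiltonianCycle_of_list h1 h2 h3 ?_
  have h4 : (a :: b :: l).toFinset = univ := eq_univ_iff_forall.2 fun v => by
    rw [List.mem_toFinset]; exact h2 v
  rw [← List.toFinset_card_of_nodup h1, h4, card_univ, hc]
  omega

end Translation

/-! ### The extremal construction. -/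

section LowerBound

/-- The triples which do not meet `A` in exactly two vertices. -/
def notTwo {n : ℕ} (A : Finset (Fin n)) : Hypergraph (Fin n) where
  vertexSet := Set.univ
  edgeSet := {e | ∃ f : Finset (Fin n), (f : Set (Fin n)) = e ∧ f.card = 3 ∧ (f ∩ A).card ≠ 2}
  subset_vertexSet_of_mem_edgeSet' := fun _ _ => Set.subset_univ _

variable {n : ℕ} {A : Finset (Fin n)}

lemma le_degree_notTwo {v : Fin n} {G : Finset (Finset (Fin n))}
    (hG : ∀ p ∈ G, p.card = 2 ∧ v ∉ p ∧ (insert v p ∩ A).card ≠ 2) :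
    G.card ≤ (notTwo A).degree v := by
  rw [Hypergraph.degree, ← Set.ncard_coe_finset G]
  refine Set.ncard_le_ncard_of_injOn (fun p => ((insert v p : Finset (Fin n)) : Set (Fin n)))
    (fun p hp => ?_) (fun p hp q hq hpq => ?_) (Set.toFinite _)
  · have h := hG p hp
    refine ⟨⟨_, rfl, by rw [card_insert_of_notMem h.2.1, h.1], h.2.2⟩, by simp⟩
  · have h1 : insert v p = insert v q := coe_injective hpq
    rw [← erase_insert (hG p hp).2.1, h1, erase_insert (hG q hq).2.1]

/-- The pairs completing v lie entirely inside A or entirely outside. With |A| about n/3 this gives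
about (1/9 + 4/9)n²/2, the critical degree; vertices outside A have larger degree. -/
lemma degree_notTwo_of_mem {v : Fin n} (hv : v ∈ A) :
    (A.card - 1).choose 2 + (n - A.card).choose 2 ≤ (notTwo A).degree v := by
  have hd : Disjoint (powersetCard 2 (A.erase v)) (powersetCard 2 Aᶜ) := by
    rw [disjoint_left]
    intro p hp hq
    rw [mem_powersetCard] at hp hq
    obtain ⟨w, hw⟩ := card_pos.1 (by omega : 0 < p.card)
    exact (mem_compl.1 (hq.1 hw)) (mem_of_mem_erase (hp.1 hw))
  have h := le_degree_notTwo (A := A) (v := v)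
    (G := powersetCard 2 (A.erase v) ∪ powersetCard 2 Aᶜ) (fun p hp => by
      rcases mem_union.1 hp with hp | hp
      · rw [mem_powersetCard] at hp
        have hvp : v ∉ p := fun h => (notMem_erase v A) (hp.1 h)
        refine ⟨hp.2, hvp, ?_⟩
        have : insert v p ⊆ A := insert_subset hv (hp.1.trans (erase_subset _ _))
        rw [inter_eq_left.2 this, card_insert_of_notMem hvp]
        omega
      · rw [mem_powersetCard] at hp
        have hvp : v ∉ p := fun h => (mem_compl.1 (hp.1 h)) hv
        refine ⟨hp.2, hvp, ?_⟩
        have h1 : insert v p ∩ A ⊆ {v} := fun w hw => by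
          rw [mem_inter, mem_insert] at hw
          rcases hw.1 with h | h
          · simp [h]
          · exact absurd hw.2 (mem_compl.1 (hp.1 h))
        have := card_le_card h1
        rw [card_singleton] at this
        omega)
  rwa [card_union_of_disjoint hd, card_powersetCard, card_powersetCard, card_erase_of_mem hv,
    card_compl, Fintype.card_fin] at h

lemma degree_notTwo_of_notMem {v : Fin n} (hv : v ∉ A) :
    (n - 1).choose 2 - A.card.choose 2 ≤ (notTwo A).degree v := by
  have h := le_degree_notTwo (A := A) (v := v)
    (G := powersetCard 2 (univ.erase v) \ powersetCard 2 A) (fun p hp => by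
      rw [mem_sdiff, mem_powersetCard, mem_powersetCard] at hp
      have hvp : v ∉ p := fun h => (notMem_erase v univ) (hp.1.1 h)
      refine ⟨hp.1.2, hvp, fun h => hp.2 ⟨?_, hp.1.2⟩⟩
      rw [insert_inter_of_notMem hv] at h
      have : p ∩ A = p := eq_of_subset_of_card_le inter_subset_left (by rw [h, hp.1.2])
      exact inter_eq_left.1 this)
  refine le_trans ?_ h
  refine le_trans ?_ (le_card_sdiff _ _)
  rw [card_powersetCard, card_powersetCard, card_erase_of_mem (mem_univ v), card_univ,
    Fintype.card_fin]

lemma mem_of_card_ne_two {p q r : Fin n} (hpq : p ≠ q) (h : (({p, q, r} : Finset (Fin n)) ∩ A).card ≠ 2)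
    (hp : p ∈ A) (hq : q ∈ A) : r ∈ A := by
  by_contra hr
  apply h
  have : ({p, q, r} : Finset (Fin n)) ∩ A = {p, q} := by
    ext w
    simp only [mem_inter, mem_insert, mem_singleton]
    constructor
    · rintro ⟨h1 | h1 | h1, h2⟩
      · exact Or.inl h1
      · exact Or.inr h1
      · exact absurd (h1 ▸ h2) hr
    · rintro (rfl | rfl)
      · exact ⟨Or.inl rfl, hp⟩
      · exact ⟨Or.inr (Or.inl rfl), hq⟩
  rw [this, card_pair hpq]

/-- Two consecutive vertices in A force the next into A, hence all of them, contrary to |A| < n.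
Otherwise vertices of A are not at cyclic distance 1 or 2, so each window of three contains at most
one. Summing over the windows gives 3|A| ≤ n. -/
lemma not_hasTightHamiltonianCycle_notTwo (hA : A.card < n) (hA' : n < 3 * A.card) :
    ¬ (notTwo A).HasTightHamiltonianCycle := by
  rintro ⟨C, l, ⟨hl, x, hinj, hV, hE⟩, hsub, hVC⟩
  have : NeZero l := ⟨by omega⟩
  have hsurj : Function.Surjective x := fun v => by
    have : v ∈ Set.range x := by rw [← hV, hVC]; exact Set.mem_univ v
    exact this
  have hln : l = n := by
    have := Fintype.card_of_bijective ⟨hinj, hsurj⟩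
    rwa [ZMod.card, Fintype.card_fin] at this
  have hne : ∀ k : ℕ, 0 < k → k < 4 → ∀ i : ZMod l, x i ≠ x (i + k) := by
    intro k hk hk4 i h
    have h1 : (k : ZMod l) = 0 := by simpa using (hinj h).symm
    rw [ZMod.natCast_eq_zero_iff] at h1
    have := Nat.le_of_dvd hk h1
    omega
  have hcard : ∀ i : ZMod l, (({x i, x (i + 1), x (i + 2)} : Finset (Fin n)) ∩ A).card ≠ 2 := by
    intro i
    have : ({x i, x (i + 1), x (i + 2)} : Set (Fin n)) ∈ E(notTwo A) :=
      hsub.2 (by rw [hE]; exact ⟨i, rfl⟩)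
    obtain ⟨f, hf, -, hf2⟩ := this
    have : f = {x i, x (i + 1), x (i + 2)} := by
      apply coe_injective
      rw [hf]
      simp
    rwa [this] at hf2
  by_cases hex : ∃ i, x i ∈ A ∧ x (i + 1) ∈ A
  · obtain ⟨i, hi⟩ := hex
    have hstep : ∀ k : ℕ, x (i + k) ∈ A ∧ x (i + k + 1) ∈ A := by
      intro k
      induction k with
      | zero => simpa using hi
      | succ k ih =>
        have e : i + ((k + 1 : ℕ) : ZMod l) = i + k + 1 := by push_cast; ring
        rw [e]
        refine ⟨ih.2, ?_⟩
        have h1 := mem_of_card_ne_two (by simpa using hne 1 (by omega) (by omega) (i + k))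
          (hcard (i + k)) ih.1 ih.2
        have e2 : i + (k : ZMod l) + 1 + 1 = i + k + 2 := by ring
        rwa [e2]
    have hAu : A = univ := eq_univ_iff_forall.2 fun v => by
      obtain ⟨j, rfl⟩ := hsurj v
      have := (hstep (j - i).val).1
      rwa [ZMod.natCast_zmod_val, add_sub_cancel] at this
    rw [hAu, card_univ, Fintype.card_fin] at hA
    exact lt_irrefl _ hA
  · push Not at hex
    have h2 : ∀ i, x i ∈ A → x (i + 2) ∉ A := fun i h1 h2 => by
      have h3 := hcard i
      rw [show ({x i, x (i + 1), x (i + 2)} : Finset (Fin n)) = {x i, x (i + 2), x (i + 1)} by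
        rw [pair_comm]] at h3
      exact hex i h1 (mem_of_card_ne_two (by simpa using hne 2 (by omega) (by omega) i) h3 h1 h2)
    set χ : ZMod l → ℕ := fun i => if x i ∈ A then 1 else 0 with hχ
    have hsum : ∑ i, χ i = A.card := by
      rw [hχ, ← card_filter]
      refine card_bij (fun i _ => x i) (fun i hi => (mem_filter.1 hi).2) (fun i _ j _ h => hinj h)
        fun v hv => ?_
      obtain ⟨j, rfl⟩ := hsurj v
      exact ⟨j, mem_filter.2 ⟨mem_univ _, hv⟩, rfl⟩
    have hshift : ∀ c : ZMod l, ∑ i, χ (i + c) = A.card := fun c => by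
      rw [← hsum]
      exact Equiv.sum_comp (Equiv.addRight c) χ
    have hle : ∑ i, (χ i + χ (i + 1) + χ (i + 2)) ≤ ∑ _i : ZMod l, 1 := by
      refine sum_le_sum fun i _ => ?_
      have q1 := hex i
      have q2 := hex (i + 1)
      have q3 := h2 i
      rw [show i + 1 + 1 = i + 2 by ring] at q2
      simp only [hχ]
      split_ifs <;> first | omega | tauto
    rw [sum_add_distrib, sum_add_distrib, hsum, hshift, hshift, sum_const, card_univ, ZMod.card,
      smul_eq_mul, mul_one] at hle
    omega

theorem exists_minDegree_not_hasTightHamiltonianCycle (ε : ℝ) (hε : 0 < ε) :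
    ∃ n₀ : ℕ, ∀ n : ℕ, n₀ ≤ n →
      ∃ H : Hypergraph (Fin n), V(H) = Set.univ ∧ H.IsUniform 3 ∧
        (5 / 9 - ε) * ((n : ℝ) ^ 2 / 2) ≤ (H.minDegree : ℝ) ∧
        ¬ H.HasTightHamiltonianCycle := by
  obtain ⟨n₀, hn₀⟩ := exists_nat_ge (4 / ε)
  refine ⟨n₀ + 4, fun n hn => ?_⟩
  -- The choice n/3 + 1 is the least size with n < 3|A|.
  obtain ⟨A, -, hA⟩ := Finset.exists_subset_card_eq (s := (univ : Finset (Fin n))) (n := n / 3 + 1)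
    (by rw [card_univ, Fintype.card_fin]; omega)
  refine ⟨notTwo A, rfl, ?_, ?_, not_hasTightHamiltonianCycle_notTwo (by omega) (by omega)⟩
  · rintro e ⟨f, rfl, hf, -⟩
    exact ⟨f.finite_toSet, by rw [Set.ncard_coe_finset, hf]⟩
  have hnε : 4 ≤ ε * n := by
    rw [div_le_iff₀' hε] at hn₀
    have : (n₀ : ℝ) ≤ n := by exact_mod_cast (by omega : n₀ ≤ n)
    exact hn₀.trans (by gcongr)
  have hn4 : (4 : ℝ) ≤ n := by exact_mod_cast (by omega : 4 ≤ n)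
  set s : ℝ := (A.card : ℝ) with hs
  have hs1 : (n : ℝ) < 3 * s := by rw [hs]; exact_mod_cast (by omega : n < 3 * A.card)
  have hs2 : 3 * s ≤ n + 3 := by rw [hs]; exact_mod_cast (by omega : 3 * A.card ≤ n + 3)
  have hdeg : ∀ v : Fin n, (5 / 9 - ε) * ((n : ℝ) ^ 2 / 2) ≤ ((notTwo A).degree v : ℝ) := by
    intro v
    have hεn : 4 * (n : ℝ) ≤ ε * n * n := by gcongr
    by_cases hv : v ∈ A
    · have h1 : (((A.card - 1).choose 2 + (n - A.card).choose 2 : ℕ) : ℝ) ≤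
        ((notTwo A).degree v : ℝ) := by exact_mod_cast degree_notTwo_of_mem hv
      push_cast at h1
      rw [Nat.cast_choose_two, Nat.cast_choose_two, Nat.cast_sub (by omega : 1 ≤ A.card),
        Nat.cast_sub (by omega : A.card ≤ n), ← hs, Nat.cast_one] at h1
      nlinarith
    · have h1 : ((n - 1).choose 2 : ℝ) ≤ ((notTwo A).degree v : ℝ) + (A.card.choose 2 : ℝ) := by
        have := degree_notTwo_of_notMem hv
        exact_mod_cast (by omega)
      rw [Nat.cast_choose_two, Nat.cast_choose_two, Nat.cast_sub (by omega : 1 ≤ n), ← hs,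
        Nat.cast_one] at h1
      nlinarith
  have hne : ((notTwo A).degree '' V(notTwo A)).Nonempty :=
    ⟨_, ⟨0, by omega⟩, Set.mem_univ _, rfl⟩
  obtain ⟨v, -, hv⟩ := Nat.sInf_mem hne
  rw [Hypergraph.minDegree, ← hv]
  exact hdeg v

end LowerBound

end TightHam

theorem theorem1p1 :
    (∀ α : ℝ, 0 < α → ∃ n₀ : ℕ, ∀ n : ℕ, n₀ ≤ n →
      ∀ (V : Type u) (H : Hypergraph V), V(H).Finite → V(H).ncard = n → H.IsUniform 3 →
        (5 / 9 + α) * ((n : ℝ) ^ 2 / 2) ≤ (H.minDegree : ℝ) →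
        H.HasTightHamiltonianCycle) ∧
    (∀ ε : ℝ, 0 < ε → ∃ n₀ : ℕ, ∀ n : ℕ, n₀ ≤ n →
      ∃ H : Hypergraph (Fin n), V(H) = Set.univ ∧ H.IsUniform 3 ∧
        (5 / 9 - ε) * ((n : ℝ) ^ 2 / 2) ≤ (H.minDegree : ℝ) ∧
        ¬ H.HasTightHamiltonianCycle) :=
  ⟨TightHam.hasTightHamiltonianCycle_of_minDegree,
    TightHam.exists_minDegree_not_hasTightHamiltonianCycle⟩
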